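/- **Notation.** Functions on $\mathbb R^d$ are complex valued, $\widehat f(\xi)=\int_{\mathbb R^d} f(x)e^{-ix\cdot\xi}\,dx$ (entrywise for vectors of functions), and $\langle f,g\rangle=\int f\,\overline{g}$. A filter is a finitely supported sequence $u$ on $\mathbb Z^d$ with scalar, vector or matrix values, and $\widehat u(\xi)=\sum_{k\in\mathbb Z^d}u(k)e^{-ik\cdot\xi}$. Write $\boldsymbol\delta(0)=1$ and $\boldsymbol\delta(x)=0$ for $x\ne0$. A dilation matrix is an integer matrix all of whose eigenvalues have modulus greater than $1$. For a $d\times d$ dilation matrix $M$ put $\Omega_M=(M^{-T}\mathbb Z^d)\cap[0,1)^d$. All $O$-relations are meant as $\xi\to0$. **Setting.** Let $M$ be a $d\times d$ dilation matrix, let $N$ be a $d\times d$ integer matrix with $|\det N|=r\ge2$, let $\kappa_1=0,\kappa_2,\dots,\kappa_r$ be a complete set of representatives of $\mathbb Z^d/N\mathbb Z^d$, and let $$\widehat\Upsilon_N(\xi)=\big(e^{iN^{-1}\kappa_1\cdot\xi},\dots,e^{iN^{-1}\kappa_r\cdot\xi}\big).$$ Let $m\ge1$ and $n\ge2m$ be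 integers. Let $\mathring a$ be an $r\times r$ matrix-valued filter, let $\mathring v$ be a $1\times r$ filter, and let $\mathring\phi=(\mathring\phi_1,\dots,\mathring\phi_r)^T$ be a vector of compactly supported functions in $L_2(\mathbb R^d)$. With $\|\widehat{\mathring\phi}(\xi)\|^2=\sum_{\ell=1}^r|\widehat{\mathring\phi}_\ell(\xi)|^2$, suppose that: 1. ($\mathring a$ is an order $m$ $E_N$-balanced refinement filter of $\mathring\phi$.) $\widehat{\mathring\phi}(M^T\xi)=\widehat{\mathring a}(\xi)\widehat{\mathring\phi}(\xi)$ for all $\xi\in\mathbb R^d$, and $\widehat{\mathring\phi}(\xi)=\widehat c_1(\xi)\,\overline{\widehat\Upsilon_N(\xi)}^T+O(\|\xi\|^m)$ for some scalar filter $c_1$ with $\widehat c_1(0)\neq0$. 2. ($\mathring a$ has order $m$ $E_N$-balanced sum rules with matching filter $\mathring v$.) $\widehat{\mathring v}(0)\ne0$; $\widehat{\mathring v}(M^T\xi)\,\widehat{\mathring a}(\xi+2\pi\omega)=\boldsymbol\delta(\omega)\widehat{\mathring v}(\xi)+O(\|\xi\|^m)$ for all $\omega\in\Omega_M$; and $\widehat{\mathring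 v}(\xi)=\widehat c_2(\xi)\widehat\Upsilon_N(\xi)+O(\|\xi\|^m)$ for some scalar filter $c_2$ with $\widehat c_2(0)\ne0$. 3. $\widehat{\mathring v}(\xi)=\|\widehat{\mathring\phi}(\xi)\|^{-2}\,\overline{\widehat{\mathring\phi}(\xi)}^T+O(\|\xi\|^m)$, and $\|\widehat{\mathring\phi}(\xi)\|^{-2}\,\overline{\widehat{\mathring\phi}(\xi)}^T=\widehat g(\xi)\widehat\Upsilon_N(\xi)+O(\|\xi\|^m)$ for some scalar filter $g$ with $\widehat g(0)\neq0$. 4. $\|\widehat{\mathring\phi}(\xi)\|^2=1+O(\|\xi\|^n)$. **Conclusion.** There are an integer $s\ge1$, an $s\times r$ matrix-valued filter $\mathring b$ and signs $\varepsilon_1,\dots,\varepsilon_s\in\{1,-1\}$ such that: (i) $\{\mathring a;\mathring b\}_{\boldsymbol\delta I_r,(\varepsilon_1,\dots,\varepsilon_s)}$ is a quasi-tight $M$-framelet filter bank, that is, for all $\xi\in\mathbb R^d$ and $\omega\in\Omega_M$, $$\overline{\widehat{\mathring a}(\xi)}^T\,\widehat{\mathring a}(\xi+2\pi\omega)+\overline{\widehat{\mathring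 b}(\xi)}^T\operatorname{diag}(\varepsilon_1,\dots,\varepsilon_s)\,\widehat{\mathring b}(\xi+2\pi\omega)=\boldsymbol\delta(\omega)I_r;$$ (ii) the vector $\psi=(\psi_1,\dots,\psi_s)^T$ given by $\widehat\psi(\xi)=\widehat{\mathring b}(M^{-T}\xi)\,\widehat{\mathring\phi}(M^{-T}\xi)$, $\xi\in\mathbb R^d$, consists of compactly supported functions in $L_2(\mathbb R^d)$, and $\{\mathring\phi;\psi\}_{(\varepsilon_1,\dots,\varepsilon_s)}$ is a quasi-tight $M$-framelet in $L_2(\mathbb R^d)$. That is, with $\psi_{\ell,j,k}(x)=|\det M|^{j/2}\psi_\ell(M^jx-k)$, there are constants $C_1,C_2>0$ such that for every $f\in L_2(\mathbb R^d)$ $$C_1\|f\|^2\le\sum_{\ell=1}^r\sum_{k\in\mathbb Z^d}|\langle f,\mathring\phi_\ell(\cdot-k)\rangle|^2+\sum_{j=0}^\infty\sum_{\ell=1}^s\sum_{k\in\mathbb Z^d}|\langle f,\psi_{\ell,j,k}\rangle|^2\le C_2\|f\|^2,$$ $$f=\sum_{\ell=1}^r\sum_{k\in\mathbb Z^d}\langle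 f,\mathring\phi_\ell(\cdot-k)\rangle\,\mathring\phi_\ell(\cdot-k)+\sum_{j=0}^\infty\sum_{\ell=1}^s\sum_{k\in\mathbb Z^d}\varepsilon_\ell\,\langle f,\psi_{\ell,j,k}\rangle\,\psi_{\ell,j,k},$$ the last series converging unconditionally in $L_2(\mathbb R^d)$. Moreover $\psi$ has order $m$ vanishing moments: $\langle p,\psi_\ell\rangle=0$ for every polynomial $p$ of degree less than $m$ and every $\ell=1,\dots,s$. -/

import Mathlib

open MeasureTheory Filter Topology Asymptotics
open scoped Matrix ComplexConjugate ENNReal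

noncomputable section

namespace Framelet

/-- The space `ℝ^d` with its Euclidean norm and Lebesgue measure. -/
abbrev Rd (d : ℕ) : Type := EuclideanSpace ℝ (Fin d)

/-- The integer lattice `ℤ^d`. -/
abbrev Zd (d : ℕ) : Type := Fin d → ℤ

/-- The inclusion `ℤ^d ⊆ ℝ^d`. -/
def latt {d : ℕ} (k : Zd d) : Rd d := WithLp.toLp 2 (fun i => (k i : ℝ))

/-- An integer matrix regarded as a real matrix. -/
def realMat {d : ℕ} (M : Matrix (Fin d) (Fin d) ℤ) : Matrix (Fin d) (Fin d) ℝ :=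
  M.map (Int.cast : ℤ → ℝ)

/-- The matrix-vector product `A x` for `x ∈ ℝ^d`. -/
def act {d : ℕ} (A : Matrix (Fin d) (Fin d) ℝ) (x : Rd d) : Rd d :=
  Matrix.toEuclideanLin A x

/-- A dilation matrix: an integer matrix all of whose (complex) eigenvalues have modulus
greater than one. -/
def IsDilation {d : ℕ} (M : Matrix (Fin d) (Fin d) ℤ) : Prop :=
  ∀ z ∈ spectrum ℂ (M.map (Int.cast : ℤ → ℂ)), 1 < ‖z‖

/-- `Ω_M = (M^{-T} ℤ^d) ∩ [0,1)^d`. -/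
def Omega {d : ℕ} (M : Matrix (Fin d) (Fin d) ℤ) : Set (Rd d) :=
  {ω | (∃ k : Zd d, ω = act ((realMat M)ᵀ)⁻¹ (latt k)) ∧ ∀ i, 0 ≤ ω i ∧ ω i < 1}

open Classical in
/-- `δ(0) = 1` and `δ(x) = 0` for `x ≠ 0`. -/
def delta {d : ℕ} (ω : Rd d) : ℂ := if ω = 0 then 1 else 0

/-- `κ` enumerates a complete set of representatives of `ℤ^d / N ℤ^d`, the first of them
being `0`. -/
def IsCosetEnum {d r : ℕ} (N : Matrix (Fin d) (Fin d) ℤ) (κ : Fin r → Zd d) : Prop :=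
  (∀ j : Fin r, (j : ℕ) = 0 → κ j = 0) ∧
    ∀ k : Zd d, ∃! j : Fin r, ∃ l : Zd d, k = κ j + N *ᵥ l

/-- Finitely supported sequences on `ℤ^d` with values in `V`. -/
abbrev Filt (d : ℕ) (V : Type) [Zero V] : Type := Zd d →₀ V

/-- The Fourier series `û(ξ) = ∑_k u(k) e^{-i k·ξ}`. -/
def symbol {d : ℕ} {V : Type} [AddCommGroup V] [Module ℂ V] (u : Filt d V) (ξ : Rd d) : V :=
  u.sum fun k c => Complex.exp (-Complex.I * (inner ℝ (latt k) ξ : ℝ)) • c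

/-- The Fourier transform `f̂(ξ) = ∫ f(x) e^{-i x·ξ} dx` (used for integrable `f` only). -/
def hat {d : ℕ} (f : Rd d → ℂ) (ξ : Rd d) : ℂ :=
  ∫ x, f x * Complex.exp (-Complex.I * (inner ℝ x ξ : ℝ))

/-- The entrywise Fourier transform of a vector of functions. -/
def vhat {d r : ℕ} (φ : Fin r → Rd d → ℂ) (ξ : Rd d) : Fin r → ℂ := fun ℓ => hat (φ ℓ) ξ

/-- `‖φ̂(ξ)‖² = ∑_ℓ |φ̂_ℓ(ξ)|²`. -/
def normSqHat {d r : ℕ} (φ : Fin r → Rd d → ℂ) (ξ : Rd d) : ℝ := ∑ ℓ, ‖vhat φ ξ ℓ‖ ^ 2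

/-- `f(ξ) = g(ξ) + O(‖ξ‖^m)` as `ξ → 0`. For functions that are smooth near `0` this says that
all partial derivatives of order less than `m` of `f` and `g` agree at `0`. -/
def EqMod {d : ℕ} {V : Type} [NormedAddCommGroup V] (m : ℕ) (f g : Rd d → V) : Prop :=
  (fun ξ => f ξ - g ξ) =O[𝓝 0] (fun ξ => ‖ξ‖ ^ m)

/-- `Υ_N(ξ) = (e^{i N⁻¹κ_1·ξ}, …, e^{i N⁻¹κ_r·ξ})`. -/
def upsilon {d r : ℕ} (N : Matrix (Fin d) (Fin d) ℤ) (κ : Fin r → Zd d) (ξ : Rd d) :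
    Fin r → ℂ :=
  fun j => Complex.exp (Complex.I * (inner ℝ (act (realMat N)⁻¹ (latt (κ j))) ξ : ℝ))

/-- `a` has order `m` sum rules with respect to `M` with the matching filter `v`. -/
def HasSumRules {d r : ℕ} (M : Matrix (Fin d) (Fin d) ℤ) (m : ℕ)
    (a : Filt d (Matrix (Fin r) (Fin r) ℂ)) (v : Filt d (Fin r → ℂ)) : Prop :=
  symbol v 0 ≠ 0 ∧ ∀ ω ∈ Omega M,
    EqMod m (fun ξ => symbol v (act (realMat M)ᵀ ξ) ᵥ* symbol a (ξ + (2 * Real.pi) • ω))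
      (fun ξ => delta ω • symbol v ξ)

/-- The row vector `w(ξ)` is, modulo `O(‖ξ‖^m)`, of the form `ĉ(ξ) Υ_N(ξ)` with `c` finitely
supported and `ĉ(0) ≠ 0`. -/
def IsBalancedRow {d r : ℕ} (N : Matrix (Fin d) (Fin d) ℤ) (κ : Fin r → Zd d) (m : ℕ)
    (w : Rd d → Fin r → ℂ) : Prop :=
  ∃ c : Filt d ℂ, symbol c 0 ≠ 0 ∧ EqMod m w (fun ξ => symbol c ξ • upsilon N κ ξ)

/-- `a` has order `m` `E_N`-balanced sum rules with respect to `M`, with the order `m`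
`E_N`-balanced matching filter `v`. -/
def HasBalancedSumRules {d r : ℕ} (M N : Matrix (Fin d) (Fin d) ℤ) (κ : Fin r → Zd d) (m : ℕ)
    (a : Filt d (Matrix (Fin r) (Fin r) ℂ)) (v : Filt d (Fin r → ℂ)) : Prop :=
  HasSumRules M m a v ∧ IsBalancedRow N κ m (symbol v)

/-- `a` is an order `n` `E_N`-balanced refinement filter associated to `φ`:
`φ̂(Mᵀ ξ) = â(ξ) φ̂(ξ)`, and `φ̂(ξ) = ĉ(ξ) conj(Υ_N(ξ))ᵀ + O(‖ξ‖^n)` with `ĉ(0) ≠ 0`. -/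
def IsBalancedRefinementFilter {d r : ℕ} (M N : Matrix (Fin d) (Fin d) ℤ) (κ : Fin r → Zd d)
    (n : ℕ) (a : Filt d (Matrix (Fin r) (Fin r) ℂ)) (φ : Fin r → Rd d → ℂ) : Prop :=
  (∀ ξ, vhat φ (act (realMat M)ᵀ ξ) = symbol a ξ *ᵥ vhat φ ξ) ∧
    ∃ c : Filt d ℂ, symbol c 0 ≠ 0 ∧
      EqMod n (vhat φ) (fun ξ => symbol c ξ • star (upsilon N κ ξ))

/-- The function vanishes almost everywhere outside some compact set. -/
def IsCompactlySupported {d : ℕ} (f : Rd d → ℂ) : Prop :=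
  ∃ K : Set (Rd d), IsCompact K ∧ ∀ᵐ x, x ∉ K → f x = 0

/-- `⟨f, g⟩ = ∫ f(x) conj(g(x)) dx`. -/
def ip {d : ℕ} (f g : Rd d → ℂ) : ℂ := ∫ x, f x * conj (g x)

/-- The index set of the system generated by `r` functions `φ_ℓ` and `s` functions `ψ_ℓ`. -/
abbrev Idx (d r s : ℕ) : Type := (Fin r × Zd d) ⊕ (ℕ × Fin s × Zd d)

/-- The system consisting of `φ_ℓ(x - k)` and `|det M|^{j/2} ψ_ℓ(M^j x - k)`, `j ≥ 0`. -/
def system {d r s : ℕ} (M : Matrix (Fin d) (Fin d) ℤ) (φ : Fin r → Rd d → ℂ)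
    (ψ : Fin s → Rd d → ℂ) : Idx d r s → Rd d → ℂ
  | Sum.inl (ℓ, k) => fun x => φ ℓ (x - latt k)
  | Sum.inr (j, ℓ, k) => fun x =>
      ((|(realMat M).det| ^ ((j : ℝ) / 2) : ℝ) : ℂ) * ψ ℓ (act (realMat M ^ j) x - latt k)

/-- The sign attached to each element of the system: `1` for shifts of `φ`, and `ε_ℓ` for the
elements generated by `ψ_ℓ`. -/
def signs {d r s : ℕ} (ε : Fin s → ℂ) : Idx d r s → ℂ
  | Sum.inl _ => 1
  | Sum.inr (_, ℓ, _) => ε ℓ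

/-- `{φ; ψ}` is an `M`-framelet in `L²(ℝ^d)`. -/
def IsFramelet {d r s : ℕ} (M : Matrix (Fin d) (Fin d) ℤ) (φ : Fin r → Rd d → ℂ)
    (ψ : Fin s → Rd d → ℂ) : Prop :=
  (∀ ℓ, MemLp (φ ℓ) 2 volume) ∧ (∀ ℓ, MemLp (ψ ℓ) 2 volume) ∧
    ∃ C₁ C₂ : ℝ, 0 < C₁ ∧ 0 < C₂ ∧ ∀ f : Rd d → ℂ, MemLp f 2 volume →
      ENNReal.ofReal C₁ * eLpNorm f 2 volume ^ 2 ≤ ∑' i, ‖ip f (system M φ ψ i)‖ₑ ^ 2 ∧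
      ∑' i, ‖ip f (system M φ ψ i)‖ₑ ^ 2 ≤ ENNReal.ofReal C₂ * eLpNorm f 2 volume ^ 2

/-- `{φ; ψ}_{(ε_1, …, ε_s)}` is a quasi-tight `M`-framelet in `L²(ℝ^d)`: it is an `M`-framelet,
the `ε_ℓ` are signs, and every `f ∈ L²(ℝ^d)` is the sum of the signed expansion. Convergence of
the net of finite partial sums in `L²` is unconditional convergence. -/
def IsQuasiTightFramelet {d r s : ℕ} (M : Matrix (Fin d) (Fin d) ℤ) (φ : Fin r → Rd d → ℂ)
    (ψ : Fin s → Rd d → ℂ) (ε : Fin s → ℂ) : Prop :=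
  (∀ ℓ, ε ℓ = 1 ∨ ε ℓ = -1) ∧ IsFramelet M φ ψ ∧
    ∀ f : Rd d → ℂ, MemLp f 2 volume →
      Tendsto (fun F : Finset (Idx d r s) =>
        eLpNorm (fun x => f x -
          ∑ i ∈ F, signs ε i * ip f (system M φ ψ i) * system M φ ψ i x) 2 volume)
        atTop (𝓝 0)

/-- `{a; b}_{δ I_r, (ε_1, …, ε_s)}` is a quasi-tight `M`-framelet filter bank. -/
def IsQuasiTightFilterBank {d r s : ℕ} (M : Matrix (Fin d) (Fin d) ℤ)
    (a : Filt d (Matrix (Fin r) (Fin r) ℂ)) (b : Filt d (Matrix (Fin s) (Fin r) ℂ))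
    (ε : Fin s → ℂ) : Prop :=
  (∀ ℓ, ε ℓ = 1 ∨ ε ℓ = -1) ∧ ∀ ξ : Rd d, ∀ ω ∈ Omega M,
    (symbol a ξ)ᴴ * symbol a (ξ + (2 * Real.pi) • ω)
      + (symbol b ξ)ᴴ * Matrix.diagonal ε * symbol b (ξ + (2 * Real.pi) • ω)
      = delta ω • (1 : Matrix (Fin r) (Fin r) ℂ)

/-- `⟨p, ψ⟩ = 0` for every polynomial `p` of degree less than `m`
(for compactly supported `ψ ∈ L²`). -/
def HasVanishingMoments {d : ℕ} (m : ℕ) (ψ : Rd d → ℂ) : Prop :=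
  ∀ p : MvPolynomial (Fin d) ℂ, p.totalDegree < m →
    ip (fun x => MvPolynomial.eval (fun i => ((x i : ℝ) : ℂ)) p) ψ = 0

end Framelet

end

/-!
The argument has an algebraic half, which constructs `b`, and an analytic half, which shows that
the resulting functions `ψ` form a framelet.

*Construction of `b`.* Polyphase decomposition along `ℤ^d / Mℤ^d` turns the identity over all
`ω ∈ Ω_M` into the factorization `D⁻¹ - A* A = B* diag(ε) B` of a single Hermitian matrix over the
ring of trigonometric polynomials, where `D = |det M|` and `A`, `B` are the polyphase matrices of
`a` and `b`. Let `w` be the polyphase vector of `φ̂`, replaced by trigonometric polynomials that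
agree with it to order `2m`, and let `𝔞` be the ideal of trigonometric polynomials that vanish to
order `m` at the origin. The refinement equation says `A w ≡ φ̂`. Since `‖φ̂‖² ≡ 1`, the matching
filter is `φ̂*` modulo `O(‖ξ‖^m)`, and the sum rules say that `D A* φ̂ ≡ w`; hence
`(D⁻¹ - A* A) w` has its entries in `𝔞`, while `w* (D⁻¹ - A* A) w`, a multiple of
`‖φ̂(ξ)‖² - ‖φ̂(Mᵀξ)‖²` up to a change of variables, vanishes to order `2m` and so lies in `𝔞²`
(`vanIdeal_add_le`). These two facts are exactly what is needed to write the matrix as a signed sum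
of squares `∑ ε_l B_l* B_l` whose rows satisfy `B_l w ∈ 𝔞` (`exists_signed_gram`): the projection
along `w` splits the matrix into sums of products of such rows, and polarization makes squares of
products at the price of signs. The outcome is `exists_highpass`; the relation `B_l w ∈ 𝔞` says
that `b̂ φ̂ = O(‖ξ‖^m)`, which gives the vanishing moments of `ψ`
(`hasVanishingMoments_of_isBigO`).

*From the filter bank to the framelet.* The filter bank identity splits the energy of the
coefficients at one scale into low-pass coefficients and signed high-pass coefficients at the next
coarser scale (`PolyphaseIdentity.energy`, `MultiScale.energy_step`), so the signed energy
telescopes. For `f` in a dense set the energy at the finest scale tends to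
`‖f‖² ‖φ̂(0)‖² = ‖f‖²` (`tendsto_level_energy`), so the signed quadratic form of the system is
`‖f‖²` there. If the system is also a Bessel family, then by density and polarization it has the
signed expansion, unconditionally, and the lower frame bound follows from `|ε_l| = 1`
(`IsBessel.hasSum_of_quadratic`).

*The Bessel bound.* For a fixed scale it follows from the compactness of the supports. Across
scales no regularity of `φ` beyond `L²` is available, so Fourier decay cannot be used. Instead,
the coefficients of `φ` against scale `J` of the system generated by `ψ_l` tend to zero because
`∫ ψ_l = 0`, and by refinability the finitely many nonzero correlations of these coefficients
satisfy a linear recursion in `J` on a finite-dimensional space. A convergent iteration of this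
kind decays geometrically (`exists_geometric_of_tendsto`, `exists_geometric_level`). As `ψ_l` is
itself a finite combination of dilated shifts of `φ`, distinct scales are almost orthogonal, and
Schur's test bounds the whole family (`isBessel_of_refinable`).
-/

noncomputable section

namespace Framelet

/-! ### Signed Gram representations over a commutative star ring -/

section SignedGram

variable {S ι : Type*} [CommRing S] [StarRing S] [Algebra ℂ S] [Fintype ι]

/-- The matrix `K + Kᴴ` is a signed sum of squares `Bᴴ diag(ε) B` in which every row of `B` is
annihilated by `w` modulo the ideal `𝔞`. -/
def HasSignedGram (𝔞 : Ideal S) (w : ι → S) (K : Matrix ι ι S) : Prop :=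
  ∃ (s : ℕ) (B : Fin s → ι → S) (ε : Fin s → ℂ), 1 ≤ s ∧ (∀ l, ε l = 1 ∨ ε l = -1) ∧
    (∀ l, B l ⬝ᵥ w ∈ 𝔞) ∧
    ∀ i j, K i j + star (K j i) = ∑ l, ε l • (star (B l i) * B l j)

variable {𝔞 : Ideal S} {w : ι → S}

lemma HasSignedGram.zero : HasSignedGram 𝔞 w 0 :=
  ⟨1, 0, 1, le_rfl, by simp, by simp, by simp⟩

lemma HasSignedGram.add {K K' : Matrix ι ι S} (h : HasSignedGram 𝔞 w K)
    (h' : HasSignedGram 𝔞 w K') : HasSignedGram 𝔞 w (K + K') := by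
  obtain ⟨s, B, ε, hs, hε, hB, hK⟩ := h
  obtain ⟨s', B', ε', hs', hε', hB', hK'⟩ := h'
  refine ⟨s + s', Fin.append B B', Fin.append ε ε', by omega, ?_, ?_, ?_⟩
  · intro l; refine Fin.addCases (fun l => ?_) (fun l => ?_) l
    · simpa using hε l
    · simpa using hε' l
  · intro l; refine Fin.addCases (fun l => ?_) (fun l => ?_) l
    · simpa using hB l
    · simpa using hB' l
  · intro i j
    simp only [Matrix.add_apply, star_add, Fin.sum_univ_add, Fin.append_left, Fin.append_right,
      ← hK, ← hK']
    abel

lemma HasSignedGram.sum {κ : Type*} (t : Finset κ) {K : κ → Matrix ι ι S}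
    (h : ∀ k ∈ t, HasSignedGram 𝔞 w (K k)) : HasSignedGram 𝔞 w (∑ k ∈ t, K k) := by
  classical
  induction t using Finset.induction_on with
  | empty => simpa using HasSignedGram.zero
  | insert k t hk ih =>
    rw [Finset.sum_insert hk]
    exact (h k (by simp)).add (ih fun k' hk' => h k' (by simp [hk']))

variable [StarModule ℂ S]

/-- Polarization: `R* S + S* R` is half the difference of the squares of `R + S` and `R - S`. -/
lemma HasSignedGram.of_rows {R T : ι → S} (hR : R ⬝ᵥ w ∈ 𝔞) (hT : T ⬝ᵥ w ∈ 𝔞) :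
    HasSignedGram 𝔞 w (Matrix.of fun i j => star (R i) * T j) := by
  -- the scaling `c = 1/√2` absorbs the factor `2` of the polarization identity
  set c : ℂ := (((Real.sqrt 2)⁻¹ : ℝ) : ℂ) with hc
  have hcc : star c * c = 1 / 2 := by
    rw [hc, Complex.star_def, Complex.conj_ofReal, ← Complex.ofReal_mul, ← mul_inv,
      Real.mul_self_sqrt (by norm_num)]
    norm_num
  refine ⟨2, ![c • (R + T), c • (R - T)], ![1, -1], by norm_num, ?_, ?_, ?_⟩
  · intro l; fin_cases l <;> simp
  · have hc' : ∀ x : S, x ∈ 𝔞 → c • x ∈ 𝔞 := fun x hx => by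
      rw [Algebra.smul_def]; exact 𝔞.mul_mem_left _ hx
    rw [Fin.forall_fin_two]
    refine ⟨?_, ?_⟩
    · change (c • (R + T)) ⬝ᵥ w ∈ 𝔞
      rw [smul_dotProduct, add_dotProduct]
      exact hc' _ (𝔞.add_mem hR hT)
    · change (c • (R - T)) ⬝ᵥ w ∈ 𝔞
      rw [smul_dotProduct, sub_dotProduct]
      exact hc' _ (𝔞.sub_mem hR hT)
  · intro i j
    have key : ∀ x y : S, star (c • x) * (c • y) = (1 / 2 : ℂ) • (star x * y) := by
      intro x y; rw [star_smul, smul_mul_smul_comm, hcc]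
    simp only [Matrix.of_apply, Fin.sum_univ_two, Matrix.cons_val_zero, Matrix.cons_val_one,
      Pi.smul_apply, Pi.add_apply, Pi.sub_apply, key, one_smul, neg_smul, ← sub_eq_add_neg,
      ← smul_sub]
    have : star (R i + T i) * (R j + T j) - star (R i - T i) * (R j - T j)
        = (2 : ℂ) • (star (R i) * T j + star (T i) * R j) := by
      rw [ofNat_smul_eq_nsmul ℂ 2, two_nsmul]
      simp only [star_add, star_sub]; ring
    rw [this, smul_smul]
    simp only [star_mul, star_star]
    norm_num

variable [DecidableEq ι]

/-- A Hermitian matrix `H` with `H w ∈ 𝔞` and `w* H w ∈ 𝔞²`, where `w` is normalized modulo `𝔞`,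
is a signed sum of squares of rows annihilated by `w` modulo `𝔞`. With `P = 1 - c w w*`, the four
terms of `H = (P + c w w*) H (P + c w w*)` are sums of products `R* T` of such rows. -/
theorem exists_signed_gram (hstar : ∀ p ∈ 𝔞, star p ∈ 𝔞) (c : ℂ) (hcr : star c = c)
    (hc : c • ∑ i, star (w i) * w i - 1 ∈ 𝔞) {H : Matrix ι ι S} (hH : H.IsHermitian)
    (h1 : ∀ i, (H *ᵥ w) i ∈ 𝔞) (h2 : star w ⬝ᵥ (H *ᵥ w) ∈ 𝔞 * 𝔞) :
    ∃ (s : ℕ) (B : Fin s → ι → S) (ε : Fin s → ℂ), 1 ≤ s ∧ (∀ l, ε l = 1 ∨ ε l = -1) ∧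
      (∀ l, B l ⬝ᵥ w ∈ 𝔞) ∧ ∀ i j, H i j = ∑ l, ε l • (star (B l i) * B l j) := by
  set P : Matrix ι ι S := 1 - c • Matrix.vecMulVec w (star w) with hP
  have hPH : Pᴴ = P := by
    rw [hP, Matrix.conjTranspose_sub, Matrix.conjTranspose_one, Matrix.conjTranspose_smul, hcr,
      Matrix.conjTranspose_vecMulVec, star_star]
  have hPs : ∀ i j, star (P i j) = P j i := fun i j => by
    conv_rhs => rw [← hPH]
    rfl
  have hPw : ∀ i, (P *ᵥ w) i ∈ 𝔞 := by
    intro i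
    have : (P *ᵥ w) i = -(w i * (c • ∑ i, star (w i) * w i - 1)) := by
      rw [hP, Matrix.sub_mulVec, Matrix.one_mulVec, Matrix.smul_mulVec, Matrix.vecMulVec_mulVec]
      simp only [Pi.sub_apply, Pi.smul_apply, MulOpposite.smul_eq_mul_unop, MulOpposite.unop_op,
        dotProduct, Pi.star_apply, mul_sub, mul_one, neg_sub, Algebra.mul_smul_comm]
    rw [this]
    exact 𝔞.neg_mem (𝔞.mul_mem_left _ hc)
  have hI : (1 : Matrix ι ι S) = P + c • Matrix.vecMulVec w (star w) := by rw [hP]; abel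
  -- any multiple of `w*` with coefficient in `𝔞` is annihilated by `w` modulo `𝔞`
  have hrow : ∀ p ∈ 𝔞, (fun j => p * star (w j)) ⬝ᵥ w ∈ 𝔞 := by
    intro p hp
    simp only [dotProduct, mul_assoc, ← Finset.mul_sum]
    exact 𝔞.mul_mem_right _ hp
  have hHw : ∀ i, star ((star w ᵥ* H) i) = (H *ᵥ w) i := by
    intro i
    simp only [Matrix.vecMul, Matrix.mulVec, dotProduct, star_sum, star_mul, Pi.star_apply,
      star_star]
    refine Finset.sum_congr rfl fun j _ => ?_
    rw [← hH.apply j i, star_star]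
  have t1 : HasSignedGram 𝔞 w (P * H * P) := by
    have : P * H * P = ∑ k, Matrix.of fun i j => star (P k i) * (H * P) k j := by
      ext i j
      rw [Matrix.mul_assoc, Matrix.mul_apply, Matrix.sum_apply]
      simp [hPs]
    rw [this]
    refine HasSignedGram.sum _ fun k _ => HasSignedGram.of_rows (hPw k) ?_
    have : ((H * P) k) ⬝ᵥ w = H k ⬝ᵥ (P *ᵥ w) := by
      change ((H * P) *ᵥ w) k = (H *ᵥ (P *ᵥ w)) k
      rw [Matrix.mulVec_mulVec]
    rw [this]
    exact 𝔞.sum_mem fun j _ => 𝔞.mul_mem_left _ (hPw j)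
  have t2 : HasSignedGram 𝔞 w (c • (P * H * Matrix.vecMulVec w (star w))) := by
    have : c • (P * H * Matrix.vecMulVec w (star w))
        = ∑ k, Matrix.of fun i j => star (P k i) * ((c • (H *ᵥ w) k) * star (w j)) := by
      ext i j
      rw [Matrix.mul_vecMulVec, Matrix.sum_apply, ← Matrix.mulVec_mulVec]
      simp only [Matrix.smul_apply, Matrix.vecMulVec_apply, Matrix.of_apply, hPs, Pi.star_apply]
      rw [Matrix.mulVec, dotProduct, Finset.sum_mul, Finset.smul_sum]
      refine Finset.sum_congr rfl fun k _ => ?_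
      rw [Algebra.smul_mul_assoc, Algebra.mul_smul_comm, mul_assoc]
    rw [this]
    refine HasSignedGram.sum _ fun k _ => HasSignedGram.of_rows (hPw k) (hrow _ ?_)
    rw [Algebra.smul_def]
    exact 𝔞.mul_mem_left _ (h1 k)
  have t3 : HasSignedGram 𝔞 w (c • (Matrix.vecMulVec w (star w) * H * P)) := by
    have : c • (Matrix.vecMulVec w (star w) * H * P)
        = ∑ k, Matrix.of fun i j => star ((c • (H *ᵥ w) k) * star (w i)) * P k j := by
      ext i j
      rw [Matrix.vecMulVec_mul, Matrix.vecMulVec_mul, Matrix.sum_apply]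
      simp only [Matrix.smul_apply, Matrix.vecMulVec_apply, Matrix.of_apply, star_mul, star_star,
        star_smul, hcr, ← hHw]
      rw [Matrix.vecMul, dotProduct, Finset.mul_sum, Finset.smul_sum]
      refine Finset.sum_congr rfl fun k _ => ?_
      rw [Algebra.mul_smul_comm, Algebra.smul_mul_assoc, mul_assoc]
    rw [this]
    refine HasSignedGram.sum _ fun k _ => HasSignedGram.of_rows (hrow _ ?_) (hPw k)
    rw [Algebra.smul_def]
    exact 𝔞.mul_mem_left _ (h1 k)
  have t4' : ∀ t ∈ 𝔞 * 𝔞, HasSignedGram 𝔞 w (Matrix.of fun i j => w i * t * star (w j)) := by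
    intro t ht
    refine Submodule.mul_induction_on ht (fun p hp q hq => ?_) (fun x y hx hy => ?_)
    · have := HasSignedGram.of_rows (hrow _ (hstar p hp)) (hrow _ hq)
      convert! this using 1
      ext i j
      simp only [Matrix.of_apply, star_mul, star_star]; ring
    · convert! hx.add hy using 1
      ext i j
      simp only [Matrix.of_apply, Matrix.add_apply]; ring
  have t4 : HasSignedGram 𝔞 w
      ((c * c) • (Matrix.vecMulVec w (star w) * H * Matrix.vecMulVec w (star w))) := by
    have := t4' ((c * c) • (star w ⬝ᵥ (H *ᵥ w)))
      (by rw [Algebra.smul_def]; exact (𝔞 * 𝔞).mul_mem_left _ h2)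
    convert! this using 1
    ext i j
    rw [Matrix.vecMulVec_mul, Matrix.vecMulVec_mul_vecMulVec, ← Matrix.dotProduct_mulVec]
    simp only [Matrix.smul_apply, Matrix.vecMulVec_apply, Matrix.of_apply, Pi.star_apply,
      Algebra.mul_smul_comm, Algebra.smul_mul_assoc, Pi.smul_apply, smul_eq_mul]
    congr 1
    ring
  have hdec : H = P * H * P + c • (P * H * Matrix.vecMulVec w (star w))
      + c • (Matrix.vecMulVec w (star w) * H * P)
      + (c * c) • (Matrix.vecMulVec w (star w) * H * Matrix.vecMulVec w (star w)) := by
    conv_lhs => rw [← Matrix.one_mul H, ← Matrix.mul_one (1 * H), hI]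
    simp only [add_mul, mul_add, Algebra.smul_mul_assoc, Algebra.mul_smul_comm, smul_add,
      smul_smul]
    abel
  have hall : HasSignedGram 𝔞 w H := hdec ▸ ((t1.add t2).add t3).add t4
  obtain ⟨s, B, ε, hs, hε, hB, hK⟩ := hall
  set c' : ℂ := (((Real.sqrt 2)⁻¹ : ℝ) : ℂ) with hc'
  have hcc : star c' * c' = 1 / 2 := by
    rw [hc', Complex.star_def, Complex.conj_ofReal, ← Complex.ofReal_mul, ← mul_inv,
      Real.mul_self_sqrt (by norm_num)]
    norm_num
  refine ⟨s, fun l => c' • B l, ε, hs, hε, fun l => ?_, fun i j => ?_⟩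
  · rw [smul_dotProduct, Algebra.smul_def]
    exact 𝔞.mul_mem_left _ (hB l)
  · simp only [Pi.smul_apply, star_smul, smul_mul_smul_comm, hcc]
    simp only [smul_comm _ (1 / 2 : ℂ), ← Finset.smul_sum]
    rw [← hK, hH.apply, ← two_nsmul, ← ofNat_smul_eq_nsmul ℂ 2, smul_smul]
    norm_num

end SignedGram

/-! ### Trigonometric polynomials and their vanishing ideals at the origin -/

section Trig

variable {d : ℕ}

lemma latt_add (k l : Zd d) : latt (k + l) = latt k + latt l := by
  ext i; simp [latt]

lemma latt_neg (k : Zd d) : latt (-k) = -latt k := by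
  ext i; simp [latt]

@[simp] lemma latt_zero : latt (0 : Zd d) = 0 := by
  ext i; simp [latt]

lemma latt_apply (k : Zd d) (i : Fin d) : latt k i = k i := rfl

/-- The character `ξ ↦ e^{-i x·ξ}` of `ℝ^d`. -/
def chi (x ξ : Rd d) : ℂ := Complex.exp (-Complex.I * (inner ℝ x ξ : ℝ))

lemma chi_add_left (x y ξ : Rd d) : chi (x + y) ξ = chi x ξ * chi y ξ := by
  rw [chi, chi, chi, ← Complex.exp_add, inner_add_left]; push_cast; ring_nf

lemma chi_add_right (x ξ η : Rd d) : chi x (ξ + η) = chi x ξ * chi x η := by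
  rw [chi, chi, chi, ← Complex.exp_add, inner_add_right]; push_cast; ring_nf

@[simp] lemma chi_zero_left (ξ : Rd d) : chi 0 ξ = 1 := by simp [chi]

@[simp] lemma chi_zero_right (x : Rd d) : chi x 0 = 1 := by simp [chi]

lemma star_chi (x ξ : Rd d) : star (chi x ξ) = chi (-x) ξ := by
  rw [chi, chi, Complex.star_def, ← Complex.exp_conj]; simp [inner_neg_left]

lemma norm_chi (x ξ : Rd d) : ‖chi x ξ‖ = 1 := by
  rw [chi, ← Complex.norm_exp_ofReal_mul_I (-(inner ℝ x ξ))]; congr 2; push_cast; ring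

lemma chi_neg_mul (x ξ : Rd d) : chi (-x) ξ * chi x ξ = 1 := by
  rw [← chi_add_left, neg_add_cancel, chi_zero_left]

@[fun_prop] lemma continuous_chi (x : Rd d) : Continuous (chi x) := by
  unfold chi; fun_prop

lemma symbol_eq_sum {V : Type} [AddCommGroup V] [Module ℂ V] (u : Filt d V) (ξ : Rd d) :
    symbol u ξ = u.sum fun k c => chi (latt k) ξ • c := rfl

/-- The `*`-algebra of trigonometric polynomials on `ℝ^d` with frequencies in `ℤ^d`. -/
def Trig (d : ℕ) : StarSubalgebra ℂ (Rd d → ℂ) where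
  carrier := (Submodule.span ℂ (Set.range fun k : Zd d => chi (latt k)) : Set (Rd d → ℂ))
  mul_mem' := by
    intro a b ha hb
    have h := Submodule.mul_mem_mul ha hb
    rw [Submodule.span_mul_span] at h
    refine Submodule.span_mono ?_ h
    rintro _ ⟨_, ⟨k, rfl⟩, _, ⟨l, rfl⟩, rfl⟩
    exact ⟨k + l, by ext ξ; simp [latt_add, chi_add_left]⟩
  add_mem' := fun ha hb => Submodule.add_mem _ ha hb
  algebraMap_mem' := by
    intro c
    have h : algebraMap ℂ (Rd d → ℂ) c = c • chi (latt 0) := by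
      ext ξ; simp
    rw [h]
    exact Submodule.smul_mem _ _ (Submodule.subset_span ⟨0, rfl⟩)
  star_mem' := by
    intro a ha
    refine Submodule.span_induction ?_ ?_ ?_ ?_ ha
    · rintro _ ⟨k, rfl⟩
      refine Submodule.subset_span ⟨-k, ?_⟩
      ext ξ
      change chi (latt (-k)) ξ = star (chi (latt k) ξ)
      rw [star_chi, latt_neg]
    · simp
    · intro x y _ _ hx hy
      rw [star_add]; exact Submodule.add_mem _ hx hy
    · intro c x _ hx
      rw [star_smul]; exact Submodule.smul_mem _ _ hx

lemma mem_trig_iff {f : Rd d → ℂ} :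
    f ∈ Trig d ↔ f ∈ Submodule.span ℂ (Set.range fun k : Zd d => chi (latt k)) := Iff.rfl

lemma chi_mem_trig (k : Zd d) : chi (latt k) ∈ Trig d := Submodule.subset_span ⟨k, rfl⟩

lemma symbol_mem_trig (u : Filt d ℂ) : symbol u ∈ Trig d := by
  have : symbol u = ∑ k ∈ u.support, u k • chi (latt k) := by
    ext ξ
    simp [symbol_eq_sum, Finsupp.sum, mul_comm]
  rw [this]
  exact sum_mem fun k _ => (Trig d).smul_mem (chi_mem_trig k) _

lemma exists_symbol_eq {f : Rd d → ℂ} (hf : f ∈ Trig d) : ∃ u : Filt d ℂ, symbol u = f := by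
  obtain ⟨u, hu⟩ := (Finsupp.mem_span_range_iff_exists_finsupp).1 (mem_trig_iff.1 hf)
  refine ⟨u, ?_⟩
  rw [← hu]
  ext ξ
  simp [symbol_eq_sum, Finsupp.sum, mul_comm]

lemma continuous_of_mem_trig {f : Rd d → ℂ} (hf : f ∈ Trig d) : Continuous f := by
  refine Submodule.span_induction ?_ ?_ ?_ ?_ (mem_trig_iff.1 hf)
  · rintro _ ⟨k, rfl⟩; exact continuous_chi _
  · exact continuous_const
  · intro x y _ _ hx hy; exact hx.add hy
  · intro c x _ hx; exact hx.const_smul c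

lemma isBigO_one_of_continuous {f : Rd d → ℂ} (hf : Continuous f) :
    f =O[𝓝 0] (fun _ => (1 : ℝ)) :=
  (hf.tendsto 0).isBigO_one ℝ

/-- The ideal of trigonometric polynomials that are `O(‖ξ‖^k)` at the origin. -/
def vanIdeal (d k : ℕ) : Ideal (Trig d) where
  carrier := {p | (p : Rd d → ℂ) =O[𝓝 0] fun ξ => ‖ξ‖ ^ k}
  add_mem' := fun ha hb => ha.add hb
  zero_mem' := isBigO_zero _ _
  smul_mem' := by
    intro c x hx
    have := (isBigO_one_of_continuous (continuous_of_mem_trig c.2)).mul hx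
    simp only [one_mul] at this
    exact this

lemma mem_vanIdeal {k : ℕ} {p : Trig d} :
    p ∈ vanIdeal d k ↔ (p : Rd d → ℂ) =O[𝓝 0] fun ξ => ‖ξ‖ ^ k := Iff.rfl

lemma star_mem_vanIdeal {k : ℕ} {p : Trig d} (hp : p ∈ vanIdeal d k) : star p ∈ vanIdeal d k := by
  rw [mem_vanIdeal] at hp ⊢
  refine hp.norm_left.congr_left (fun ξ => ?_) |>.of_norm_left
  change ‖(p : Rd d → ℂ) ξ‖ = ‖star ((p : Rd d → ℂ) ξ)‖
  rw [norm_star]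

lemma vanIdeal_mul_le (k l : ℕ) : vanIdeal d k * vanIdeal d l ≤ vanIdeal d (k + l) := by
  rw [Ideal.mul_le]
  intro p hp q hq
  rw [mem_vanIdeal] at hp hq ⊢
  refine (hp.mul hq).congr_right fun ξ => ?_
  rw [pow_add]

lemma isBigO_pow_of_le {k l : ℕ} (h : k ≤ l) :
    (fun ξ : Rd d => ‖ξ‖ ^ l) =O[𝓝 0] fun ξ => ‖ξ‖ ^ k := by
  refine IsBigO.of_bound 1 ?_
  filter_upwards [Metric.ball_mem_nhds (0 : Rd d) one_pos] with ξ hξ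
  rw [mem_ball_zero_iff] at hξ
  simp only [norm_pow, norm_norm, one_mul]
  exact pow_le_pow_of_le_one (norm_nonneg _) hξ.le h

/-- The trigonometric polynomial `e^{-i ξ_j} - 1`. -/
def zvar (j : Fin d) : Trig d :=
  ⟨chi (latt (Pi.single j 1)), chi_mem_trig _⟩ - 1

lemma inner_latt_single (j : Fin d) (ξ : Rd d) : inner ℝ (latt (Pi.single j 1)) ξ = ξ j := by
  rw [PiLp.inner_apply, Finset.sum_eq_single j]
  · simp [latt]
  · intro i _ hi; simp [latt, hi]
  · simp

lemma zvar_apply (j : Fin d) (ξ : Rd d) :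
    (zvar j : Rd d → ℂ) ξ = Complex.exp (-Complex.I * (ξ j : ℝ)) - 1 := by
  change chi (latt (Pi.single j 1)) ξ - 1 = _
  rw [chi, inner_latt_single]

/-- The augmentation ideal, generated by the functions `e^{-i ξ_j} - 1`. -/
def augIdeal (d : ℕ) : Ideal (Trig d) := Ideal.span (Set.range zvar)

/-- Modulo the augmentation ideal all characters are `1`, as the set of `k` with
`e^{-i k·ξ} ≡ 1` is a subgroup of `ℤ^d` containing the unit vectors. -/
lemma chi_sub_one_mem (k : Zd d) :
    (⟨chi (latt k), chi_mem_trig k⟩ - 1 : Trig d) ∈ augIdeal d := by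
  let H : AddSubgroup (Zd d) :=
    { carrier := {k | (⟨chi (latt k), chi_mem_trig k⟩ - 1 : Trig d) ∈ augIdeal d}
      zero_mem' := by
        have : (⟨chi (latt 0), chi_mem_trig 0⟩ - 1 : Trig d) = 0 := by
          ext ξ; simp
        simp only [Set.mem_ofPred_eq, this, zero_mem]
      add_mem' := by
        intro a b ha hb
        have : (⟨chi (latt (a + b)), chi_mem_trig _⟩ - 1 : Trig d)
            = ⟨chi (latt a), chi_mem_trig a⟩ * (⟨chi (latt b), chi_mem_trig b⟩ - 1)
              + (⟨chi (latt a), chi_mem_trig a⟩ - 1) := by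
          ext ξ; simp [latt_add, chi_add_left]; ring
        simp only [Set.mem_ofPred_eq, this] at *
        exact add_mem (Ideal.mul_mem_left _ _ hb) ha
      neg_mem' := by
        intro a ha
        have : (⟨chi (latt (-a)), chi_mem_trig _⟩ - 1 : Trig d)
            = -⟨chi (latt (-a)), chi_mem_trig _⟩ * (⟨chi (latt a), chi_mem_trig a⟩ - 1) := by
          ext ξ
          have := chi_neg_mul (latt a) ξ
          simp [latt_neg, mul_sub, this]
          ring
        simp only [Set.mem_ofPred_eq, this] at *
        exact Ideal.mul_mem_left _ _ ha }
  have hk : k = ∑ j, k j • (Pi.single j 1 : Zd d) := by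
    ext i; simp [Finset.sum_apply, Pi.single_apply]
  have : k ∈ H := by
    rw [hk]
    exact sum_mem fun j _ => H.zsmul_mem (Ideal.subset_span ⟨j, rfl⟩ : Pi.single j 1 ∈ H) _
  exact this

lemma sub_const_mem_augIdeal (p : Trig d) :
    p - algebraMap ℂ (Trig d) ((p : Rd d → ℂ) 0) ∈ augIdeal d := by
  obtain ⟨f, hf⟩ := p
  refine Submodule.span_induction (p := fun f hf =>
    (⟨f, hf⟩ - algebraMap ℂ (Trig d) (f 0) : Trig d) ∈ augIdeal d) ?_ ?_ ?_ ?_ (mem_trig_iff.1 hf)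
  · rintro _ ⟨k, rfl⟩
    simpa using chi_sub_one_mem k
  · have : (⟨0, zero_mem _⟩ - algebraMap ℂ (Trig d) ((0 : Rd d → ℂ) 0) : Trig d) = 0 := by
      ext ξ; simp
    rw [this]; exact zero_mem _
  · intro x y hx hy h1 h2
    have := add_mem h1 h2
    convert! this using 1
    ext ξ
    simp
    ring
  · intro c x hx h1
    have := (augIdeal d).mul_mem_left (algebraMap ℂ (Trig d) c) h1
    convert! this using 1
    ext ξ
    simp [mul_sub]

lemma isBigO_exp_sub_one (j : Fin d) (c : ℂ) :
    (fun ξ : Rd d => Complex.exp (c * (ξ j : ℝ)) - 1) =O[𝓝 0] fun ξ => ‖ξ‖ := by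
  have h1 : (fun z : ℂ => Complex.exp z - 1) =O[𝓝 0] fun z => z := by
    have := (Complex.hasDerivAt_exp 0).isBigO_sub
    simpa using this
  have h2 : Tendsto (fun ξ : Rd d => c * ((ξ j : ℝ) : ℂ)) (𝓝 0) (𝓝 0) := by
    have : Continuous fun ξ : Rd d => c * ((ξ j : ℝ) : ℂ) := by fun_prop
    simpa using this.tendsto 0
  refine (h1.comp_tendsto h2).trans ?_
  refine IsBigO.of_bound ‖c‖ (Eventually.of_forall fun ξ => ?_)
  simp only [Function.comp, norm_mul, Complex.norm_real, norm_norm]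
  gcongr
  exact PiLp.norm_apply_le ξ j

lemma augIdeal_le : augIdeal d ≤ vanIdeal d 1 := by
  rw [augIdeal, Ideal.span_le]
  rintro _ ⟨j, rfl⟩
  rw [SetLike.mem_coe, mem_vanIdeal]
  simp only [pow_one]
  exact (isBigO_exp_sub_one j (-Complex.I)).congr_left fun ξ => (zvar_apply j ξ).symm

lemma augIdeal_pow_le (k : ℕ) : augIdeal d ^ k ≤ vanIdeal d k := by
  induction k with
  | zero =>
    intro p _
    rw [mem_vanIdeal]
    simpa using isBigO_one_of_continuous (continuous_of_mem_trig p.2)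
  | succ k ih =>
    rw [pow_succ]
    exact (Ideal.mul_mono ih augIdeal_le).trans (vanIdeal_mul_le k 1)

/-- Modulo the next power, elements of the `k`-th power of the augmentation ideal are homogeneous
polynomials of degree `k` in its generators. -/
lemma exists_homogeneous_of_mem_augIdeal_pow (k : ℕ) {p : Trig d} (hp : p ∈ augIdeal d ^ k) :
    ∃ P : MvPolynomial (Fin d) ℂ, P.IsHomogeneous k ∧
      p - MvPolynomial.aeval zvar P ∈ augIdeal d ^ (k + 1) := by
  induction k generalizing p with
  | zero =>
    refine ⟨MvPolynomial.C ((p : Rd d → ℂ) 0), MvPolynomial.isHomogeneous_C _ _, ?_⟩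
    rw [MvPolynomial.aeval_C, zero_add, pow_one]
    exact sub_const_mem_augIdeal p
  | succ k ih =>
    rw [pow_succ] at hp
    refine Submodule.mul_induction_on hp ?_ ?_
    · intro a ha b hb
      refine Submodule.span_induction (p := fun b _ => ∃ P : MvPolynomial (Fin d) ℂ,
        P.IsHomogeneous (k + 1) ∧ a * b - MvPolynomial.aeval zvar P ∈ augIdeal d ^ (k + 1 + 1))
        ?_ ?_ ?_ ?_ hb
      · rintro _ ⟨j, rfl⟩
        obtain ⟨P, hP, hPa⟩ := ih ha
        refine ⟨P * MvPolynomial.X j, hP.mul (MvPolynomial.isHomogeneous_X ℂ j), ?_⟩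
        rw [map_mul, MvPolynomial.aeval_X, ← sub_mul, pow_succ]
        exact Ideal.mul_mem_mul hPa (Ideal.subset_span ⟨j, rfl⟩)
      · exact ⟨0, MvPolynomial.isHomogeneous_zero _ _ _, by simp⟩
      · rintro x y _ _ ⟨P, hP, hPa⟩ ⟨Q, hQ, hQa⟩
        refine ⟨P + Q, hP.add hQ, ?_⟩
        have := add_mem hPa hQa
        convert! this using 1
        rw [map_add]; ring
      · rintro c x hx ⟨P, hP, hPa⟩
        refine ⟨MvPolynomial.C ((c : Rd d → ℂ) 0) * P, ?_, ?_⟩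
        · simpa using (MvPolynomial.isHomogeneous_C (Fin d) ((c : Rd d → ℂ) 0)).mul hP
        · have h1 := Ideal.mul_mem_left _ c hPa
          have h2 : MvPolynomial.aeval zvar P ∈ augIdeal d ^ (k + 1) := by
            have h3 : a * x ∈ augIdeal d ^ (k + 1) := by
              rw [pow_succ]; exact Ideal.mul_mem_mul ha hx
            have := sub_mem h3 (Ideal.pow_le_pow_right (Nat.le_succ _) hPa)
            simpa using this
          have h4 := Ideal.mul_mem_mul h2 (sub_const_mem_augIdeal c)
          rw [← pow_succ] at h4
          have := add_mem h1 h4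
          convert! this using 1
          rw [map_mul, MvPolynomial.aeval_C, smul_eq_mul]; ring
    · rintro x y ⟨P, hP, hPa⟩ ⟨Q, hQ, hQa⟩
      refine ⟨P + Q, hP.add hQ, ?_⟩
      have := add_mem hPa hQa
      convert! this using 1
      rw [map_add]; ring

end Trig

/-! ### Polynomials of prescribed vanishing order at the origin -/

section Poly

variable {d : ℕ}

lemma sum_eq_of_mem_support {k : ℕ} {P : MvPolynomial (Fin d) ℂ} (hP : P.IsHomogeneous k)
    {α : Fin d →₀ ℕ} (hα : α ∈ P.support) : ∑ i, α i = k := by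
  have := hP (MvPolynomial.mem_support_iff.1 hα)
  rw [← this, Finsupp.weight_apply, Finsupp.sum_fintype] <;> simp

lemma eval_mul_of_isHomogeneous {k : ℕ} {P : MvPolynomial (Fin d) ℂ} (hP : P.IsHomogeneous k)
    (t : ℂ) (x : Fin d → ℂ) :
    MvPolynomial.eval (fun j => t * x j) P = t ^ k * MvPolynomial.eval x P := by
  rw [MvPolynomial.eval_eq', MvPolynomial.eval_eq', Finset.mul_sum]
  refine Finset.sum_congr rfl fun α hα => ?_
  simp only [mul_pow, Finset.prod_mul_distrib, Finset.prod_pow_eq_pow_sum,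
    sum_eq_of_mem_support hP hα]
  ring

/-- Leading-order comparison along rays: a homogeneous polynomial of degree `k` evaluated at
functions `x_j(ξ) ∼ c ξ_j` cannot be `O(‖ξ‖^{k+1})`. -/
lemma eq_zero_of_isHomogeneous_of_isBigO {k : ℕ} {P : MvPolynomial (Fin d) ℂ}
    (hP : P.IsHomogeneous k) {c : ℂ} (hc : c ≠ 0) (x : Rd d → Fin d → ℂ)
    (hx : ∀ (ξ : Rd d) j, Tendsto (fun t : ℝ => (t : ℂ)⁻¹ * x (t • ξ) j) (𝓝[>] 0)
      (𝓝 (c * (ξ j : ℝ))))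
    (hO : (fun ξ => MvPolynomial.eval (x ξ) P) =O[𝓝 0] fun ξ => ‖ξ‖ ^ (k + 1)) : P = 0 := by
  have hval : ∀ ξ : Rd d, MvPolynomial.eval (fun j => c * ((ξ j : ℝ) : ℂ)) P = 0 := by
    intro ξ
    have h1 : Tendsto (fun t : ℝ => MvPolynomial.eval (fun j => (t : ℂ)⁻¹ * x (t • ξ) j) P)
        (𝓝[>] 0) (𝓝 (MvPolynomial.eval (fun j => c * ((ξ j : ℝ) : ℂ)) P)) :=
      (MvPolynomial.continuous_eval P).continuousAt.tendsto.comp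
        (tendsto_pi_nhds.2 fun j => hx ξ j)
    have h2 : Tendsto (fun t : ℝ => MvPolynomial.eval (fun j => (t : ℂ)⁻¹ * x (t • ξ) j) P)
        (𝓝[>] 0) (𝓝 0) := by
      have hray : Tendsto (fun t : ℝ => t • ξ) (𝓝[>] 0) (𝓝 0) := by
        have : Continuous fun t : ℝ => t • ξ := by fun_prop
        exact (by simpa using this.tendsto 0 : Tendsto (fun t : ℝ => t • ξ) (𝓝 0) (𝓝 0)).mono_left
          nhdsWithin_le_nhds
      obtain ⟨C, hC⟩ := (hO.comp_tendsto hray).bound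
      have h0 : Tendsto (fun t : ℝ => C * ‖ξ‖ ^ (k + 1) * t) (𝓝[>] 0) (𝓝 0) := by
        have : Continuous fun t : ℝ => C * ‖ξ‖ ^ (k + 1) * t := by fun_prop
        exact (by simpa using this.tendsto 0 :
          Tendsto (fun t : ℝ => C * ‖ξ‖ ^ (k + 1) * t) (𝓝 0) (𝓝 0)).mono_left nhdsWithin_le_nhds
      refine squeeze_zero_norm' ?_ h0
      filter_upwards [hC, self_mem_nhdsWithin] with t ht htpos
      have htpos' : (0 : ℝ) < t := htpos
      have hhom : MvPolynomial.eval (fun j => (t : ℂ)⁻¹ * x (t • ξ) j) P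
          = ((t : ℂ)⁻¹) ^ k * MvPolynomial.eval (x (t • ξ)) P := eval_mul_of_isHomogeneous hP _ _
      rw [hhom, norm_mul, norm_pow, norm_inv, Complex.norm_real, Real.norm_of_nonneg htpos'.le]
      simp only [Function.comp, norm_pow, norm_norm, norm_smul,
        Real.norm_of_nonneg htpos'.le, norm_mul] at ht
      calc t⁻¹ ^ k * ‖MvPolynomial.eval (x (t • ξ)) P‖
          ≤ t⁻¹ ^ k * (C * (t * ‖ξ‖) ^ (k + 1)) := by gcongr
        _ = C * ‖ξ‖ ^ (k + 1) * t := by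
          rw [inv_pow, mul_pow, pow_succ t]; field_simp
    exact tendsto_nhds_unique h1 h2
  refine MvPolynomial.funext_set (s := fun _ => Set.range fun t : ℝ => c * (t : ℂ)) ?_ ?_
  · intro _
    exact Set.infinite_range_of_injective fun a b hab => by
      simpa [hc] using hab
  · intro y hy
    choose t ht using fun j => hy j (Set.mem_univ j)
    have := hval (WithLp.toLp 2 t)
    simp only [ht] at this
    rw [map_zero]; exact this

/-- The `k`-th power of the augmentation ideal consists of all trigonometric polynomials that
vanish to order `k` at the origin. -/
lemma vanIdeal_le_augIdeal_pow (k : ℕ) : vanIdeal d k ≤ augIdeal d ^ k := by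
  induction k with
  | zero => simp
  | succ k ih =>
    intro p hp
    have hpk : p ∈ vanIdeal d k := by
      rw [mem_vanIdeal] at hp ⊢
      exact hp.trans (isBigO_pow_of_le (Nat.le_succ k))
    obtain ⟨P, hP, hPa⟩ := exists_homogeneous_of_mem_augIdeal_pow k (ih hpk)
    have hO : MvPolynomial.aeval zvar P ∈ vanIdeal d (k + 1) := by
      have := sub_mem hp (augIdeal_pow_le _ hPa)
      simpa using this
    have heval : ∀ ξ, ((MvPolynomial.aeval zvar P : Trig d) : Rd d → ℂ) ξ
        = MvPolynomial.eval (fun j => (zvar j : Rd d → ℂ) ξ) P := by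
      intro ξ
      let e : Trig d →ₐ[ℂ] ℂ := (Pi.evalAlgHom ℂ (fun _ : Rd d => ℂ) ξ).comp
        (Trig d).subtype.toAlgHom
      change e (MvPolynomial.aeval zvar P) = _
      exact DFunLike.congr_fun (MvPolynomial.comp_aeval zvar e) P
    have hP0 : P = 0 := by
      refine eq_zero_of_isHomogeneous_of_isBigO hP (c := -Complex.I) (by simp)
        (fun ξ j => (zvar j : Rd d → ℂ) ξ) ?_ ?_
      · intro ξ j
        have hd : HasDerivAt (fun t : ℝ => Complex.exp (-Complex.I * (t * (ξ j : ℝ) : ℂ)))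
            (-Complex.I * (ξ j : ℝ)) 0 := by
          have h1 : HasDerivAt (fun t : ℝ => -Complex.I * (t * (ξ j : ℝ) : ℂ))
              (-Complex.I * (1 * (ξ j : ℝ))) 0 :=
            ((Complex.ofRealCLM.hasDerivAt).mul_const _).const_mul _
          simpa using h1.cexp
        have := hd.tendsto_slope_zero_right
        refine this.congr fun t => ?_
        simp only [zvar_apply]
        simp [Complex.real_smul]
      · exact (mem_vanIdeal.1 hO).congr_left heval
    simpa [hP0] using hPa

/-- Vanishing ideals are powers of the augmentation ideal, so vanishing orders factor: in
particular `vanIdeal d (m + m)` is contained in the square of `vanIdeal d m`. -/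
lemma vanIdeal_add_le (k l : ℕ) : vanIdeal d (k + l) ≤ vanIdeal d k * vanIdeal d l := by
  refine (vanIdeal_le_augIdeal_pow _).trans ?_
  rw [pow_add]
  exact Ideal.mul_mono (augIdeal_pow_le k) (augIdeal_pow_le l)

/-- The point `ξ ∈ ℝ^d` with complex coordinates. -/
def cpt (ξ : Rd d) : Fin d → ℂ := fun j => ((ξ j : ℝ) : ℂ)

lemma isBigO_eval_of_isHomogeneous {k : ℕ} {P : MvPolynomial (Fin d) ℂ} (hP : P.IsHomogeneous k) :
    (fun ξ : Rd d => MvPolynomial.eval (cpt ξ) P) =O[𝓝 0] fun ξ => ‖ξ‖ ^ k := by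
  simp only [MvPolynomial.eval_eq']
  refine IsBigO.fun_sum fun α hα => ?_
  refine IsBigO.const_mul_left ?_ _
  refine IsBigO.of_bound 1 (Eventually.of_forall fun ξ => ?_)
  rw [norm_prod, one_mul, norm_pow, norm_norm, ← sum_eq_of_mem_support hP hα,
    ← Finset.prod_pow_eq_pow_sum]
  refine Finset.prod_le_prod (fun i _ => norm_nonneg (cpt ξ i ^ α i)) fun i _ => ?_
  rw [norm_pow, cpt, Complex.norm_real]
  gcongr
  exact PiLp.norm_apply_le ξ i

lemma homogeneousComponent_eq_zero_of_isBigO {m : ℕ} {P : MvPolynomial (Fin d) ℂ}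
    (hP : (fun ξ : Rd d => MvPolynomial.eval (cpt ξ) P) =O[𝓝 0] fun ξ => ‖ξ‖ ^ m)
    (k : ℕ) (hk : k < m) : MvPolynomial.homogeneousComponent k P = 0 := by
  induction k using Nat.strong_induction_on with
  | _ k ih =>
    refine eq_zero_of_isHomogeneous_of_isBigO
      (MvPolynomial.homogeneousComponent_isHomogeneous k P) one_ne_zero cpt ?_ ?_
    · intro ξ j
      refine Tendsto.congr' ?_ tendsto_const_nhds
      filter_upwards [self_mem_nhdsWithin] with t ht
      have : (t : ℂ) ≠ 0 := by
        have h : (0 : ℝ) < t := ht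
        exact_mod_cast h.ne'
      simp [cpt, this]
    · set T := Finset.range (P.totalDegree + 1)
      have hsum : ∀ ξ : Rd d, MvPolynomial.eval (cpt ξ) (MvPolynomial.homogeneousComponent k P)
          = MvPolynomial.eval (cpt ξ) P - ∑ i ∈ T.erase k,
            MvPolynomial.eval (cpt ξ) (MvPolynomial.homogeneousComponent i P) := by
        intro ξ
        have hP' : MvPolynomial.eval (cpt ξ) P = ∑ i ∈ T,
            MvPolynomial.eval (cpt ξ) (MvPolynomial.homogeneousComponent i P) := by
          rw [← map_sum, MvPolynomial.sum_homogeneousComponent]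
        rw [hP', eq_sub_iff_add_eq]
        by_cases hkT : k ∈ T
        · exact Finset.add_sum_erase T (fun i => MvPolynomial.eval (cpt ξ)
            (MvPolynomial.homogeneousComponent i P)) hkT
        · rw [Finset.erase_eq_of_notMem hkT, MvPolynomial.homogeneousComponent_eq_zero, map_zero,
            zero_add]
          simpa [T] using hkT
      refine IsBigO.congr_left ?_ fun ξ => (hsum ξ).symm
      refine (hP.trans (isBigO_pow_of_le hk)).sub ?_
      refine IsBigO.fun_sum fun i hi => ?_
      rcases lt_trichotomy i k with h | h | h
      · rw [ih i h (h.trans hk)]; simp only [map_zero]; exact isBigO_zero _ _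
      · simp [h] at hi
      · exact (isBigO_eval_of_isHomogeneous
          (MvPolynomial.homogeneousComponent_isHomogeneous i P)).trans (isBigO_pow_of_le h)

end Poly

/-! ### Calculus of congruences modulo `O(‖ξ‖^k)` -/

section EqMod

variable {d : ℕ} {k : ℕ}

section

variable {V : Type} [NormedAddCommGroup V] {f g h f' g' : Rd d → V}

lemma EqMod.refl (f : Rd d → V) : EqMod k f f := by
  simpa [EqMod] using isBigO_zero _ _

lemma EqMod.symm (h : EqMod k f g) : EqMod k g f := by
  simpa [EqMod] using h.neg_left

lemma EqMod.trans (h1 : EqMod k f g) (h2 : EqMod k g h) : EqMod k f h := by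
  simpa [EqMod] using h1.add h2

lemma EqMod.add (h1 : EqMod k f f') (h2 : EqMod k g g') :
    EqMod k (fun ξ => f ξ + g ξ) (fun ξ => f' ξ + g' ξ) :=
  (IsBigO.add h1 h2).congr_left fun _ => (add_sub_add_comm _ _ _ _).symm

lemma EqMod.sum {ι : Type*} (s : Finset ι) {F G : ι → Rd d → V}
    (h : ∀ i ∈ s, EqMod k (F i) (G i)) :
    EqMod k (fun ξ => ∑ i ∈ s, F i ξ) (fun ξ => ∑ i ∈ s, G i ξ) :=
  (IsBigO.fun_sum h).congr_left fun ξ => by rw [Finset.sum_sub_distrib]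

lemma EqMod.mono {l : ℕ} (h : EqMod k f g) (hl : l ≤ k) : EqMod l f g :=
  IsBigO.trans h (isBigO_pow_of_le hl)

/-- Congruences are preserved by linear substitutions. -/
lemma EqMod.comp_act (h : EqMod k f g) (A : Matrix (Fin d) (Fin d) ℝ) :
    EqMod k (fun ξ => f (act A ξ)) (fun ξ => g (act A ξ)) := by
  have hc : Continuous (act A) := (Matrix.toEuclideanLin A).continuous_of_finiteDimensional
  have ht : Tendsto (act A) (𝓝 0) (𝓝 0) := by
    have := hc.tendsto 0
    rwa [show act A 0 = 0 from map_zero _] at this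
  refine (IsBigO.comp_tendsto h ht).trans ?_
  have : (act A) =O[𝓝 0] (fun ξ => ξ) :=
    (Matrix.toEuclideanLin A).toContinuousLinearMap.isBigO_id _
  exact this.norm_norm.pow k

lemma EqMod.congr_left (h : EqMod k f g) (hf : ∀ ξ, f ξ = f' ξ) : EqMod k f' g :=
  (funext hf : f = f') ▸ h

lemma EqMod.congr_right (h : EqMod k f g) (hg : ∀ ξ, g ξ = g' ξ) : EqMod k f g' :=
  (funext hg : g = g') ▸ h

lemma EqMod.isBigO_one (h : EqMod k f g) (hg : g =O[𝓝 0] fun _ => (1 : ℝ)) :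
    f =O[𝓝 0] fun _ => (1 : ℝ) := by
  have h1 : (fun ξ => f ξ - g ξ) =O[𝓝 0] fun _ => (1 : ℝ) := by
    simpa using IsBigO.trans h (isBigO_pow_of_le (Nat.zero_le k))
  simpa using h1.add hg

end

lemma EqMod.mul {f g f' g' : Rd d → ℂ} (h1 : EqMod k f f') (h2 : EqMod k g g')
    (hf : f =O[𝓝 0] fun _ => (1 : ℝ)) (hg' : g' =O[𝓝 0] fun _ => (1 : ℝ)) :
    EqMod k (fun ξ => f ξ * g ξ) (fun ξ => f' ξ * g' ξ) := by
  have e1 := IsBigO.mul hf h2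
  have e2 := IsBigO.mul h1 hg'
  simp only [one_mul, mul_one] at e1 e2
  exact (e1.add e2).congr_left fun ξ => by ring

lemma EqMod.star {f g : Rd d → ℂ} (h : EqMod k f g) :
    EqMod k (fun ξ => star (f ξ)) (fun ξ => star (g ξ)) := by
  refine IsBigO.of_norm_left (IsBigO.congr_left (IsBigO.norm_left h) fun ξ => ?_)
  rw [← star_sub, norm_star]

lemma EqMod.apply {r : ℕ} {f g : Rd d → Fin r → ℂ} (h : EqMod k f g) (i : Fin r) :
    EqMod k (fun ξ => f ξ i) (fun ξ => g ξ i) :=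
  isBigO_pi.1 h i

lemma mem_vanIdeal_iff_eqMod_zero {p : Trig d} :
    p ∈ vanIdeal d k ↔ EqMod k (p : Rd d → ℂ) (fun _ => 0) := by
  simp [EqMod, mem_vanIdeal]

/-- The function agrees with a trigonometric polynomial up to `O(‖ξ‖^k)`. -/
def TrigApprox (k : ℕ) (f : Rd d → ℂ) : Prop := ∃ p : Trig d, EqMod k f (p : Rd d → ℂ)

lemma isBigO_one_trig (p : Trig d) : (p : Rd d → ℂ) =O[𝓝 0] fun _ => (1 : ℝ) :=
  isBigO_one_of_continuous (continuous_of_mem_trig p.2)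

lemma TrigApprox.const (c : ℂ) : TrigApprox (d := d) k fun _ => c :=
  ⟨algebraMap ℂ (Trig d) c, EqMod.refl _⟩

lemma TrigApprox.mul {f g : Rd d → ℂ} (hf : TrigApprox k f) (hg : TrigApprox k g) :
    TrigApprox k fun ξ => f ξ * g ξ := by
  obtain ⟨p, hp⟩ := hf
  obtain ⟨q, hq⟩ := hg
  exact ⟨p * q, hp.mul hq (hp.isBigO_one (isBigO_one_trig p)) (isBigO_one_trig q)⟩

lemma TrigApprox.pow {f : Rd d → ℂ} (hf : TrigApprox k f) (n : ℕ) :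
    TrigApprox k fun ξ => f ξ ^ n := by
  induction n with
  | zero => simpa using TrigApprox.const (d := d) 1
  | succ n ih => simpa only [pow_succ] using ih.mul hf

lemma TrigApprox.prod {ι : Type*} (s : Finset ι) {f : ι → Rd d → ℂ}
    (hf : ∀ i ∈ s, TrigApprox k (f i)) : TrigApprox k fun ξ => ∏ i ∈ s, f i ξ := by
  classical
  induction s using Finset.induction_on with
  | empty => simpa using TrigApprox.const (d := d) 1
  | insert i s hi ih =>
    simp only [Finset.prod_insert hi]
    exact (hf i (by simp)).mul (ih fun j hj => hf j (by simp [hj]))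

lemma TrigApprox.sum {ι : Type*} (s : Finset ι) {f : ι → Rd d → ℂ}
    (hf : ∀ i ∈ s, TrigApprox k (f i)) : TrigApprox k fun ξ => ∑ i ∈ s, f i ξ := by
  classical
  induction s using Finset.induction_on with
  | empty => simpa using TrigApprox.const (d := d) 0
  | insert i s hi ih =>
    simp only [Finset.sum_insert hi]
    obtain ⟨p, hp⟩ := hf i (by simp)
    obtain ⟨q, hq⟩ := ih fun j hj => hf j (by simp [hj])
    exact ⟨p + q, hp.add hq⟩

/-- The coordinate `ξ_j` is approximated by the truncated logarithm series in `e^{i ξ_j} - 1`. -/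
lemma TrigApprox.coord (j : Fin d) : TrigApprox k fun ξ => ((ξ j : ℝ) : ℂ) := by
  set q : Trig d := star (zvar j) with hq
  have hqv : ∀ ξ, (q : Rd d → ℂ) ξ = Complex.exp (Complex.I * (ξ j : ℝ)) - 1 := by
    intro ξ
    change star ((zvar j : Rd d → ℂ) ξ) = _
    rw [zvar_apply, Complex.star_def, map_sub, ← Complex.exp_conj]
    simp
  refine ⟨algebraMap ℂ (Trig d) (-Complex.I) * ∑ i ∈ Finset.range (k + 1),
    algebraMap ℂ (Trig d) ((-1) ^ (i + 1) / i) * q ^ i, ?_⟩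
  have hval : ∀ ξ, ((algebraMap ℂ (Trig d) (-Complex.I) * ∑ i ∈ Finset.range (k + 1),
      algebraMap ℂ (Trig d) ((-1) ^ (i + 1) / i) * q ^ i : Trig d) : Rd d → ℂ) ξ
      = -Complex.I * Complex.logTaylor (k + 1) ((q : Rd d → ℂ) ξ) := by
    intro ξ
    rw [Complex.logTaylor]
    simp [Finset.sum_apply, mul_div_right_comm]
  refine EqMod.congr_right ?_ fun ξ => (hval ξ).symm
  have hO : (q : Rd d → ℂ) =O[𝓝 0] fun ξ => ‖ξ‖ := by
    refine (isBigO_exp_sub_one j Complex.I).congr_left fun ξ => (hqv ξ).symm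
  have hq0 : Tendsto (q : Rd d → ℂ) (𝓝 0) (𝓝 0) := by
    have := (continuous_of_mem_trig q.2).tendsto 0
    rwa [hqv, show ((0 : Rd d) j) = 0 from rfl, Complex.ofReal_zero, mul_zero, Complex.exp_zero,
      sub_self] at this
  have hsmall : ∀ᶠ ξ in 𝓝 (0 : Rd d), ‖(q : Rd d → ℂ) ξ‖ < 1 / 2 := by
    have := hq0.norm
    rw [norm_zero] at this
    exact this.eventually (gt_mem_nhds (by norm_num))
  have hlog : (fun ξ : Rd d => ((ξ j : ℝ) : ℂ)
      - -Complex.I * Complex.logTaylor (k + 1) ((q : Rd d → ℂ) ξ)) =O[𝓝 0]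
      fun ξ => ‖(q : Rd d → ℂ) ξ‖ ^ (k + 1) := by
    refine IsBigO.of_bound 2 ?_
    filter_upwards [hsmall, Metric.ball_mem_nhds (0 : Rd d) one_pos] with ξ h1 h2
    rw [mem_ball_zero_iff] at h2
    have hj : |ξ j| < 1 := (PiLp.norm_apply_le ξ j).trans_lt h2
    have hl : Complex.log (1 + (q : Rd d → ℂ) ξ) = Complex.I * (ξ j : ℝ) := by
      rw [hqv, add_sub_cancel, Complex.log_exp]
      · simp; linarith [(abs_lt.1 hj).1, Real.pi_gt_three]
      · simp; linarith [(abs_lt.1 hj).2, Real.pi_gt_three]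
    have h3 := Complex.norm_log_sub_logTaylor_le k (h1.trans (by norm_num))
    rw [hl] at h3
    have h4 : ((ξ j : ℝ) : ℂ) - -Complex.I * Complex.logTaylor (k + 1) ((q : Rd d → ℂ) ξ)
        = -Complex.I * (Complex.I * (ξ j : ℝ)
          - Complex.logTaylor (k + 1) ((q : Rd d → ℂ) ξ)) := by
      linear_combination (((ξ j : ℝ) : ℂ)) * Complex.I_sq
    rw [h4, norm_mul, norm_neg, Complex.norm_I, one_mul, norm_pow, norm_norm]
    refine h3.trans ?_
    have h5 : (1 - ‖(q : Rd d → ℂ) ξ‖)⁻¹ ≤ 2 := by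
      rw [inv_le_comm₀ (by linarith) (by norm_num)]; linarith
    have h6 : ‖(q : Rd d → ℂ) ξ‖ ^ (k + 1) * (1 - ‖(q : Rd d → ℂ) ξ‖)⁻¹ ≤
        ‖(q : Rd d → ℂ) ξ‖ ^ (k + 1) * 2 := by gcongr
    have h7 : 0 ≤ (1 - ‖(q : Rd d → ℂ) ξ‖)⁻¹ := inv_nonneg.2 (by linarith)
    refine (div_le_self (by positivity) (by linarith)).trans ?_
    linarith
  refine hlog.trans ((hO.norm_left.pow (k + 1)).trans ?_)
  exact isBigO_pow_of_le (Nat.le_succ k)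

end EqMod

/-! ### Taylor expansion of Fourier transforms of compactly supported functions -/

section Taylor

variable {d : ℕ}

lemma norm_prod_sub_prod_le {ι : Type*} (s : Finset ι) {a b : ι → ℂ} {B ε : ℝ} (hB : 1 ≤ B)
    (ha : ∀ i ∈ s, ‖a i‖ ≤ B) (hb : ∀ i ∈ s, ‖b i‖ ≤ B) (hab : ∀ i ∈ s, ‖a i - b i‖ ≤ ε) :
    ‖∏ i ∈ s, a i - ∏ i ∈ s, b i‖ ≤ s.card * B ^ s.card * ε := by
  classical
  induction s using Finset.induction_on with
  | empty => simp
  | insert i s hi ih =>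
    have hε : 0 ≤ ε := (norm_nonneg _).trans (hab i (by simp))
    rw [Finset.prod_insert hi, Finset.prod_insert hi, Finset.card_insert_of_notMem hi]
    have h1 := ih (fun j hj => ha j (by simp [hj])) (fun j hj => hb j (by simp [hj]))
      (fun j hj => hab j (by simp [hj]))
    have h2 : ‖∏ j ∈ s, b j‖ ≤ B ^ s.card := by
      rw [norm_prod]
      refine (Finset.prod_le_prod (fun j _ => norm_nonneg _) fun j hj =>
        hb j (by simp [hj])).trans_eq ?_
      rw [Finset.prod_const]
    have h3 : a i * ∏ j ∈ s, a j - b i * ∏ j ∈ s, b j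
        = a i * (∏ j ∈ s, a j - ∏ j ∈ s, b j) + (a i - b i) * ∏ j ∈ s, b j := by ring
    rw [h3]
    have hpow : B ^ s.card ≤ B ^ (s.card + 1) := pow_le_pow_right₀ hB (Nat.le_succ _)
    calc _ ≤ ‖a i‖ * ‖∏ j ∈ s, a j - ∏ j ∈ s, b j‖ + ‖a i - b i‖ * ‖∏ j ∈ s, b j‖ := by
          refine (norm_add_le _ _).trans ?_
          rw [norm_mul, norm_mul]
      _ ≤ B * (s.card * B ^ s.card * ε) + ε * B ^ s.card := by
          gcongr
          · exact ha i (by simp)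
          · exact hab i (by simp)
      _ ≤ B * (s.card * B ^ s.card * ε) + ε * B ^ (s.card + 1) := by gcongr
      _ = _ := by push_cast; ring

lemma chi_eq_prod (y ξ : Rd d) :
    chi y ξ = ∏ i, Complex.exp (-Complex.I * (y i : ℝ) * (ξ i : ℝ)) := by
  rw [chi, ← Complex.exp_sum]
  congr 1
  rw [PiLp.inner_apply, Complex.ofReal_sum, Finset.mul_sum]
  refine Finset.sum_congr rfl fun i _ => ?_
  simp only [RCLike.inner_apply, conj_trivial, Complex.ofReal_mul]
  ring

/-- The coefficient `∏ (-i y_j)^{α_j} / α_j!` of `ξ^α` in the power series of `e^{-i y·ξ}`. -/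
def taylorCoeff (α : Fin d → ℕ) (y : Rd d) : ℂ :=
  ∏ i, (-Complex.I * (y i : ℝ)) ^ α i / (α i).factorial

lemma continuous_taylorCoeff (α : Fin d → ℕ) : Continuous (taylorCoeff α) := by
  unfold taylorCoeff; fun_prop

lemma norm_chi_sub_taylor_le (K : ℕ) {R : ℝ} (hR : 0 ≤ R) :
    ∃ C, ∀ y ξ : Rd d, ‖y‖ ≤ R → ‖ξ‖ ≤ 1 →
      ‖chi y ξ - ∑ α ∈ Fintype.piFinset fun _ : Fin d => Finset.range K,
        taylorCoeff α y * ∏ i, ((ξ i : ℝ) : ℂ) ^ α i‖ ≤ C * ‖ξ‖ ^ K := by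
  refine ⟨(Finset.univ : Finset (Fin d)).card * (2 * Real.exp R * (R + 1) ^ K) ^
    (Finset.univ : Finset (Fin d)).card * (R ^ K * Real.exp R), fun y ξ hy hξ => ?_⟩
  have hsum : ∑ α ∈ Fintype.piFinset fun _ : Fin d => Finset.range K,
        taylorCoeff α y * ∏ i, ((ξ i : ℝ) : ℂ) ^ α i
      = ∏ i, ∑ n ∈ Finset.range K, (-Complex.I * (y i : ℝ) * (ξ i : ℝ)) ^ n / n.factorial := by
    rw [Finset.prod_univ_sum]
    refine Finset.sum_congr rfl fun α _ => ?_
    rw [taylorCoeff, ← Finset.prod_mul_distrib]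
    refine Finset.prod_congr rfl fun i _ => ?_
    rw [mul_pow (_ * _)]; ring
  rw [hsum, chi_eq_prod, mul_assoc _ _ (‖ξ‖ ^ K)]
  have hnorm : ∀ i, ‖-Complex.I * (y i : ℝ) * (ξ i : ℝ)‖ ≤ R * ‖ξ‖ := by
    intro i
    rw [norm_mul, norm_mul, norm_neg, Complex.norm_I, one_mul, Complex.norm_real,
      Complex.norm_real]
    exact mul_le_mul ((PiLp.norm_apply_le y i).trans hy) (PiLp.norm_apply_le ξ i)
      (norm_nonneg _) hR
  have hRξ : R * ‖ξ‖ ≤ R := mul_le_of_le_one_right hR hξ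
  have hdiff : ∀ i, ‖Complex.exp (-Complex.I * (y i : ℝ) * (ξ i : ℝ)) -
      ∑ n ∈ Finset.range K, (-Complex.I * (y i : ℝ) * (ξ i : ℝ)) ^ n / n.factorial‖
      ≤ R ^ K * Real.exp R * ‖ξ‖ ^ K := by
    intro i
    refine (Complex.norm_exp_sub_sum_le_norm_mul_exp _ K).trans ?_
    calc _ ≤ (R * ‖ξ‖) ^ K * Real.exp R := by
          gcongr
          · exact hnorm i
          · exact (hnorm i).trans hRξ
      _ = _ := by ring
  have hexp : ∀ i, ‖Complex.exp (-Complex.I * (y i : ℝ) * (ξ i : ℝ))‖ ≤ Real.exp R := fun i =>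
    (Complex.norm_exp_le_exp_norm _).trans (Real.exp_le_exp.2 ((hnorm i).trans hRξ))
  have h1R : 1 ≤ Real.exp R := Real.one_le_exp hR
  have hpw : (1 : ℝ) ≤ (R + 1) ^ K := one_le_pow₀ (by linarith)
  have hRK : R ^ K ≤ (R + 1) ^ K := by gcongr; linarith
  have hb1 : Real.exp R ≤ 2 * Real.exp R * (R + 1) ^ K := by nlinarith [Real.exp_pos R]
  refine (norm_prod_sub_prod_le Finset.univ (by linarith) (fun i _ => (hexp i).trans hb1) ?_
    fun i _ => hdiff i).trans_eq (by ring)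
  intro i _
  have h := norm_sub_norm_le (∑ n ∈ Finset.range K,
    (-Complex.I * (y i : ℝ) * (ξ i : ℝ)) ^ n / n.factorial)
    (Complex.exp (-Complex.I * (y i : ℝ) * (ξ i : ℝ)))
  rw [norm_sub_rev] at h
  have h2 : ‖ξ‖ ^ K ≤ 1 := pow_le_one₀ (norm_nonneg _) hξ
  have h3 : R ^ K * Real.exp R * ‖ξ‖ ^ K ≤ R ^ K * Real.exp R :=
    mul_le_of_le_one_right (by positivity) h2
  have h4 : R ^ K * Real.exp R ≤ (R + 1) ^ K * Real.exp R := by gcongr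
  have h5 : Real.exp R ≤ (R + 1) ^ K * Real.exp R := by nlinarith [Real.exp_pos R]
  linarith [hdiff i, hexp i]

lemma IsCompactlySupported.integrable {f : Rd d → ℂ} (hf : IsCompactlySupported f)
    (h2 : MemLp f 2 volume) : Integrable f := by
  obtain ⟨K, hK, hKf⟩ := hf
  have : IsFiniteMeasure (volume.restrict K) := ⟨by simpa using hK.measure_lt_top⟩
  have h1 : IntegrableOn f K := (h2.restrict K).integrable (by norm_num)
  exact h1.integrable_of_ae_notMem_eq_zero hKf

lemma integrable_mul_of_compact {f g : Rd d → ℂ} (hf : Integrable f)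
    (hc : IsCompactlySupported f) (hg : Continuous g) : Integrable fun x => f x * g x := by
  obtain ⟨K, hK, hKf⟩ := hc
  obtain ⟨C, hC⟩ := hK.exists_bound_of_continuousOn hg.continuousOn
  refine Integrable.mono' (hf.norm.mul_const C) (hf.1.mul hg.aestronglyMeasurable) ?_
  filter_upwards [hKf] with x hx
  rw [norm_mul]
  by_cases h : x ∈ K
  · exact mul_le_mul_of_nonneg_left (hC x h) (norm_nonneg _)
  · simp [hx h]

/-- Taylor expansion at the origin of the Fourier integral of a compactly supported function
against `e^{-i y(x)·ξ}`. -/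
lemma eqMod_integral_chi (K : ℕ) {f : Rd d → ℂ} (hf : Integrable f)
    (hc : IsCompactlySupported f) {y : Rd d → Rd d} (hy : Continuous y) :
    EqMod K (fun ξ => ∫ x, f x * chi (y x) ξ)
      (fun ξ => ∑ α ∈ Fintype.piFinset fun _ : Fin d => Finset.range K,
        (∫ x, f x * taylorCoeff α (y x)) * ∏ i, ((ξ i : ℝ) : ℂ) ^ α i) := by
  obtain ⟨S, hS, hSf⟩ := id hc
  obtain ⟨R, hR⟩ := hS.exists_bound_of_continuousOn hy.continuousOn
  obtain ⟨C, hC⟩ := norm_chi_sub_taylor_le (d := d) K (le_max_right R 0)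
  refine IsBigO.of_bound ((∫ x, ‖f x‖) * C) ?_
  filter_upwards [Metric.ball_mem_nhds (0 : Rd d) one_pos] with ξ hξ
  rw [mem_ball_zero_iff] at hξ
  have hi1 : Integrable fun x => f x * chi (y x) ξ := by
    refine integrable_mul_of_compact hf hc ?_
    unfold chi; fun_prop
  have hi2 : ∀ α : Fin d → ℕ, Integrable fun x => f x * taylorCoeff α (y x) := fun α =>
    integrable_mul_of_compact hf hc ((continuous_taylorCoeff α).comp hy)
  have heq : (∫ x, f x * chi (y x) ξ) - ∑ α ∈ Fintype.piFinset fun _ : Fin d => Finset.range K,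
        (∫ x, f x * taylorCoeff α (y x)) * ∏ i, ((ξ i : ℝ) : ℂ) ^ α i
      = ∫ x, f x * (chi (y x) ξ - ∑ α ∈ Fintype.piFinset fun _ : Fin d => Finset.range K,
        taylorCoeff α (y x) * ∏ i, ((ξ i : ℝ) : ℂ) ^ α i) := by
    simp only [mul_sub, Finset.mul_sum, ← mul_assoc]
    rw [integral_sub hi1, integral_finsetSum]
    · simp only [integral_mul_const]
    · exact fun α _ => (hi2 α).mul_const _
    · exact integrable_finsetSum _ fun α _ => (hi2 α).mul_const _
  rw [heq, norm_pow, norm_norm, mul_assoc, ← integral_mul_const]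
  refine norm_integral_le_of_norm_le (hf.norm.mul_const _) ?_
  filter_upwards [hSf] with x hx
  rw [norm_mul]
  by_cases h : x ∈ S
  · exact mul_le_mul_of_nonneg_left (hC _ _ ((hR x h).trans (le_max_left _ _)) hξ.le)
      (norm_nonneg _)
  · simp [hx h]

lemma TrigApprox.integral_chi (K : ℕ) {f : Rd d → ℂ} (hf : Integrable f)
    (hc : IsCompactlySupported f) {y : Rd d → Rd d} (hy : Continuous y) :
    TrigApprox K fun ξ => ∫ x, f x * chi (y x) ξ := by
  have h : TrigApprox K (fun ξ => ∑ α ∈ Fintype.piFinset fun _ : Fin d => Finset.range K,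
        (∫ x, f x * taylorCoeff α (y x)) * ∏ i, ((ξ i : ℝ) : ℂ) ^ α i) :=
    TrigApprox.sum _ fun α _ => (TrigApprox.const _).mul
      (TrigApprox.prod _ fun i _ => (TrigApprox.coord i).pow _)
  obtain ⟨p, hp⟩ := h
  exact ⟨p, (eqMod_integral_chi K hf hc hy).trans hp⟩

lemma hat_eq (f : Rd d → ℂ) (ξ : Rd d) : hat f ξ = ∫ x, f x * chi x ξ := rfl

/-- A compactly supported function whose Fourier transform vanishes to order `m` at the origin
has `m` vanishing moments. -/
lemma hasVanishingMoments_of_isBigO {m : ℕ} {f : Rd d → ℂ} (hf : Integrable f)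
    (hc : IsCompactlySupported f) (hO : EqMod m (hat f) (fun _ => 0)) :
    HasVanishingMoments m f := by
  classical
  set c : (Fin d → ℕ) → ℂ := fun α => ∫ x, f x * taylorCoeff α x with hcdef
  set P : MvPolynomial (Fin d) ℂ := ∑ α ∈ Fintype.piFinset fun _ : Fin d => Finset.range m,
    MvPolynomial.monomial (Finsupp.equivFunOnFinite.symm α) (c α) with hPdef
  have hP : (fun ξ : Rd d => MvPolynomial.eval (cpt ξ) P) =O[𝓝 0] fun ξ => ‖ξ‖ ^ m := by
    have h1 := (eqMod_integral_chi m hf hc continuous_id).symm.trans hO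
    have h2 := h1
    simp only [EqMod, sub_zero] at h2
    refine h2.congr_left fun ξ => ?_
    rw [hPdef, map_sum]
    refine Finset.sum_congr rfl fun α _ => ?_
    rw [MvPolynomial.eval_monomial, Finsupp.prod_fintype _ _ (by simp)]
    rfl
  -- all moments of order less than `m` vanish
  have hmom : ∀ α : Fin d →₀ ℕ, α.degree < m → ∫ x, f x * taylorCoeff α x = 0 := by
    intro α hα
    have h0 := homogeneousComponent_eq_zero_of_isBigO hP _ hα
    have h1 := congrArg (MvPolynomial.coeff α) h0
    rw [MvPolynomial.coeff_homogeneousComponent, if_pos rfl, MvPolynomial.coeff_zero, hPdef,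
      MvPolynomial.coeff_sum, Finset.sum_eq_single (α : Fin d → ℕ)] at h1
    · simpa [MvPolynomial.coeff_monomial] using h1
    · intro β _ hβ
      rw [MvPolynomial.coeff_monomial, if_neg]
      rintro rfl
      exact hβ rfl
    · intro hnot
      exfalso
      apply hnot
      rw [Fintype.mem_piFinset]
      intro i
      rw [Finset.mem_range]
      exact (Finsupp.le_degree i α).trans_lt hα
  have hmono : ∀ α : Fin d →₀ ℕ, α.degree < m → ∫ x, f x * ∏ i, ((x i : ℝ) : ℂ) ^ α i = 0 := by
    intro α hα
    have h := hmom α hα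
    have hfac : ∀ x : Rd d, taylorCoeff α x
        = (∏ i, ((-Complex.I) ^ α i / (α i).factorial)) * ∏ i, ((x i : ℝ) : ℂ) ^ α i := by
      intro x
      rw [taylorCoeff, ← Finset.prod_mul_distrib]
      refine Finset.prod_congr rfl fun i _ => ?_
      rw [mul_pow]; ring
    simp only [hfac] at h
    simp only [mul_left_comm (f _)] at h
    rw [integral_const_mul] at h
    refine (mul_eq_zero.1 h).resolve_left (Finset.prod_ne_zero_iff.2 fun i _ => ?_)
    refine div_ne_zero (pow_ne_zero _ (by simp)) (by exact_mod_cast (α i).factorial_ne_zero)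
  intro p hp
  have hcongr : ∀ x : Rd d, MvPolynomial.eval (fun i => ((x i : ℝ) : ℂ)) p * conj (f x)
      = ∑ α ∈ p.support, MvPolynomial.coeff α p * conj (f x * ∏ i, ((x i : ℝ) : ℂ) ^ α i) := by
    intro x
    rw [MvPolynomial.eval_eq', Finset.sum_mul]
    refine Finset.sum_congr rfl fun α _ => ?_
    simp only [map_mul, map_prod, map_pow, Complex.conj_ofReal]
    ring
  rw [ip]
  simp only [hcongr]
  rw [integral_finsetSum]
  · refine Finset.sum_eq_zero fun α hα => ?_
    rw [integral_const_mul, integral_conj, hmono α, map_zero, mul_zero]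
    exact (MvPolynomial.le_totalDegree hα).trans_lt hp
  · intro α _
    refine Integrable.const_mul ?_ _
    have hi : Integrable fun x => f x * ∏ i, ((x i : ℝ) : ℂ) ^ α i :=
      integrable_mul_of_compact hf hc (by fun_prop)
    exact (Complex.conjLIE.integrable_comp_iff).2 hi

end Taylor

/-! ### Polyphase decomposition of filters -/

section Polyphase

variable {d : ℕ}

lemma symbol_zero {V : Type} [AddCommGroup V] [Module ℂ V] (ξ : Rd d) :
    symbol (0 : Filt d V) ξ = 0 := by
  simp [symbol_eq_sum]

lemma symbol_add {V : Type} [AddCommGroup V] [Module ℂ V] (u w : Filt d V) (ξ : Rd d) :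
    symbol (u + w) ξ = symbol u ξ + symbol w ξ := by
  simp only [symbol_eq_sum]
  exact Finsupp.sum_add_index' (by simp) (by simp)

lemma symbol_single {V : Type} [AddCommGroup V] [Module ℂ V] (k : Zd d) (c : V) (ξ : Rd d) :
    symbol (Finsupp.single k c) ξ = chi (latt k) ξ • c := by
  simp [symbol_eq_sum]

/-- A linear functional may be applied to a symbol coefficient by coefficient. -/
lemma symbol_mapRange {V W : Type} [AddCommGroup V] [Module ℂ V] [AddCommGroup W] [Module ℂ W]
    (T : V →ₗ[ℂ] W) (u : Filt d V) (ξ : Rd d) :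
    symbol (Finsupp.mapRange T T.map_zero u) ξ = T (symbol u ξ) := by
  simp only [symbol_eq_sum]
  rw [Finsupp.sum_mapRange_index (by simp), Finsupp.sum, Finsupp.sum, map_sum]
  simp

/-- Linear independence of characters: a filter is determined by its symbol. -/
lemma symbol_injective : Function.Injective (symbol : Filt d ℂ → Rd d → ℂ) := by
  let χ : Zd d → (Multiplicative (Rd d) →* ℂ) := fun k =>
    { toFun := fun ξ => chi (latt k) ξ.toAdd
      map_one' := chi_zero_right _
      map_mul' := fun ξ η => chi_add_right _ _ _ }
  have hχ : Function.Injective χ := by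
    intro k l hkl
    by_contra hne
    obtain ⟨i, hi⟩ := Function.ne_iff.1 hne
    have hi' : ((k i : ℝ) - l i) ≠ 0 := sub_ne_zero.2 (by exact_mod_cast hi)
    -- at this point the two characters differ by the factor `e^{-iπ} = -1`
    set ξ : Rd d := EuclideanSpace.single i (Real.pi / ((k i : ℝ) - l i))
    have h1 : chi (latt k) ξ = chi (latt l) ξ := DFunLike.congr_fun hkl (Multiplicative.ofAdd ξ)
    have h2 : chi (latt (k - l)) ξ = 1 := by
      rw [sub_eq_add_neg, latt_add, chi_add_left, h1, latt_neg, mul_comm, chi_neg_mul]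
    rw [chi, show inner ℝ (latt (k - l)) ξ = Real.pi by
      simp only [ξ, EuclideanSpace.inner_single_right, latt_apply]
      simp only [Pi.sub_apply, Int.cast_sub, conj_trivial]
      field_simp, mul_comm, mul_neg, Complex.exp_neg, Complex.exp_pi_mul_I] at h2
    norm_num at h2
  have hli := (linearIndependent_monoidHom (Multiplicative (Rd d)) ℂ).comp χ hχ
  intro u w huw
  refine hli ?_
  have h : ∀ u : Filt d ℂ, Finsupp.linearCombination ℂ
      ((fun f : Multiplicative (Rd d) →* ℂ => (f : Multiplicative (Rd d) → ℂ)) ∘ χ) u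
      = fun ξ => symbol u ξ.toAdd := by
    intro u
    ext ξ
    rw [Finsupp.linearCombination_apply, symbol_eq_sum, Finsupp.sum, Finsupp.sum,
      Finset.sum_apply]
    refine Finset.sum_congr rfl fun k _ => ?_
    simp [χ, mul_comm]
  rw [h, h, huw]

variable (M : Matrix (Fin d) (Fin d) ℤ)

/-- The sublattice `M ℤ^d` of `ℤ^d`. -/
def imLat : Submodule ℤ (Zd d) := LinearMap.range M.mulVecLin

/-- The group `ℤ^d / M ℤ^d`. -/
abbrev Cos : Type := Zd d ⧸ imLat M

variable {M}

lemma mulVec_injective (hM : M.det ≠ 0) : Function.Injective (M *ᵥ ·) :=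
  Matrix.mulVec_injective_of_det_ne_zero hM

lemma card_cos (hM : M.det ≠ 0) : Nat.card (Cos M) = M.det.natAbs := by
  let e : Zd d ≃ₗ[ℤ] imLat M := LinearEquiv.ofInjective M.mulVecLin (mulVec_injective hM)
  rw [← Submodule.natAbs_det_equiv (imLat M) e]
  congr 1
  have : (imLat M).subtype ∘ₗ ((AddEquiv.toIntLinearEquiv e : Zd d ≃ₗ[ℤ] imLat M) :
      Zd d →ₗ[ℤ] imLat M) = M.mulVecLin := by
    ext1 x; rfl
  erw [this]
  rw [← Matrix.toLin'_apply', LinearMap.det_toLin']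

lemma finite_cos (hM : M.det ≠ 0) : Finite (Cos M) :=
  Nat.finite_of_card_ne_zero (by rw [card_cos hM]; simpa using hM)

/-- A representative of a class of `ℤ^d / M ℤ^d`. -/
def rep (g : Cos M) : Zd d := Quotient.out g

lemma mk_rep (g : Cos M) : Submodule.Quotient.mk (p := imLat M) (rep g) = g := Quotient.out_eq g

lemma exists_eq_rep_add (n : Zd d) :
    ∃ k : Zd d, n = M *ᵥ k + rep (M := M) (Submodule.Quotient.mk n) := by
  have h : (Submodule.Quotient.mk (p := imLat M) n)
      = Submodule.Quotient.mk (rep (M := M) (Submodule.Quotient.mk n)) := (mk_rep _).symm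
  rw [Submodule.Quotient.eq] at h
  obtain ⟨k, hk⟩ := h
  refine ⟨k, ?_⟩
  rw [← sub_eq_iff_eq_add, ← hk]
  rfl

lemma mk_mulVec_add (k n : Zd d) :
    Submodule.Quotient.mk (p := imLat M) (M *ᵥ k + n) = Submodule.Quotient.mk n := by
  rw [Submodule.Quotient.eq, add_sub_cancel_right]
  exact ⟨k, rfl⟩

variable (M) in
/-- The subsequence `k ↦ u(M k + n)` of a filter. -/
def sub (hM : M.det ≠ 0) (u : Filt d ℂ) (n : Zd d) : Filt d ℂ :=
  u.comapDomain (fun k => M *ᵥ k + n) fun _ _ _ _ h => mulVec_injective hM (add_right_cancel h)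

@[simp] lemma sub_apply (hM : M.det ≠ 0) (u : Filt d ℂ) (n k : Zd d) :
    sub M hM u n k = u (M *ᵥ k + n) := rfl

lemma inner_latt_act (k : Zd d) (ξ : Rd d) :
    inner ℝ (latt k) (act (realMat M)ᵀ ξ) = inner ℝ (latt (M *ᵥ k)) ξ := by
  simp only [PiLp.inner_apply, RCLike.inner_apply, conj_trivial, act, Matrix.toLpLin_apply,
    latt_apply, Matrix.mulVec, dotProduct, Matrix.transpose_apply, realMat, Matrix.map_apply,
    Int.cast_sum, Int.cast_mul, Finset.mul_sum, Finset.sum_mul]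
  rw [Finset.sum_comm]
  refine Finset.sum_congr rfl fun i _ => Finset.sum_congr rfl fun j _ => by ring

lemma chi_latt_act (k : Zd d) (ξ : Rd d) :
    chi (latt k) (act (realMat M)ᵀ ξ) = chi (latt (M *ᵥ k)) ξ := by
  rw [chi, chi, inner_latt_act]

/-- Polyphase decomposition of the symbol along the cosets of `M ℤ^d`. -/
lemma symbol_eq_sum_cos [Fintype (Cos M)] (hM : M.det ≠ 0) (u : Filt d ℂ) (ξ : Rd d) :
    symbol u ξ = ∑ g : Cos M,
      chi (latt (rep g)) ξ * symbol (sub M hM u (rep g)) (act (realMat M)ᵀ ξ) := by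
  induction u using Finsupp.induction_linear with
  | zero =>
    rw [symbol_zero]
    refine (Finset.sum_eq_zero fun g _ => ?_).symm
    have : sub M hM 0 (rep g) = 0 := by ext k; simp
    rw [this, symbol_zero, mul_zero]
  | add u w hu hw =>
    rw [symbol_add, hu, hw, ← Finset.sum_add_distrib]
    refine Finset.sum_congr rfl fun g _ => ?_
    have : sub M hM (u + w) (rep g) = sub M hM u (rep g) + sub M hM w (rep g) := by
      ext k; simp
    rw [this, symbol_add, mul_add]
  | single n c =>
    obtain ⟨k, hk⟩ := exists_eq_rep_add (M := M) n
    rw [Finset.sum_eq_single (Submodule.Quotient.mk n : Cos M)]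
    · have : sub M hM (Finsupp.single n c) (rep (M := M) (Submodule.Quotient.mk n))
          = Finsupp.single k c := by
        ext l
        rw [sub_apply, Finsupp.single_apply, Finsupp.single_apply]
        congr 1
        rw [eq_iff_iff]
        constructor
        · intro h
          exact mulVec_injective hM (add_right_cancel (hk.symm.trans h))
        · rintro rfl; exact hk
      rw [this, symbol_single, symbol_single, chi_latt_act]
      conv_lhs => rw [hk, latt_add, chi_add_left]
      simp only [smul_eq_mul]; ring
    · intro g _ hg
      have : sub M hM (Finsupp.single n c) (rep g) = 0 := by
        ext l
        rw [sub_apply, Finsupp.single_apply, if_neg, Finsupp.zero_apply]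
        intro h
        apply hg
        rw [h, mk_mulVec_add, mk_rep]
      rw [this, symbol_zero, mul_zero]
    · simp

end Polyphase

/-! ### Characters of the coset group and the frequencies `Ω_M` -/

section Characters

variable {d : ℕ} {M : Matrix (Fin d) (Fin d) ℤ}

lemma chi_two_pi (n : Zd d) (ω : Rd d) :
    chi (latt n) ((2 * Real.pi) • ω)
      = Complex.exp (-((2 * Real.pi * inner ℝ (latt n) ω : ℝ) * Complex.I)) := by
  rw [chi, inner_smul_right]; ring_nf

lemma chi_two_pi_eq_one_iff (n : Zd d) (ω : Rd d) :
    chi (latt n) ((2 * Real.pi) • ω) = 1 ↔ ∃ z : ℤ, inner ℝ (latt n) ω = z := by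
  rw [chi_two_pi, Complex.exp_neg, inv_eq_one, Complex.exp_eq_one_iff]
  refine exists_congr fun z => ?_
  rw [← mul_assoc, mul_left_inj' Complex.I_ne_zero]
  constructor
  · intro h
    have h' : 2 * Real.pi * inner ℝ (latt n) ω = z * (2 * Real.pi) := by exact_mod_cast h
    have := Real.pi_pos
    exact mul_left_cancel₀ (by positivity : 2 * Real.pi ≠ 0) (h'.trans (mul_comm _ _))
  · intro h
    rw [h]; push_cast; ring

lemma inner_latt_latt (k l : Zd d) : ∃ z : ℤ, inner ℝ (latt k) (latt l) = z := by
  refine ⟨∑ i, l i * k i, ?_⟩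
  simp [PiLp.inner_apply, latt_apply]

lemma chi_latt_two_pi_latt (k l : Zd d) : chi (latt k) ((2 * Real.pi) • latt l) = 1 :=
  (chi_two_pi_eq_one_iff _ _).2 (inner_latt_latt k l)

lemma det_realMat_ne_zero (hM : M.det ≠ 0) : (realMat M).det ≠ 0 := by
  rw [realMat, ← Int.cast_det (R := ℝ)]; exact_mod_cast hM

lemma act_act (A B : Matrix (Fin d) (Fin d) ℝ) (x : Rd d) : act A (act B x) = act (A * B) x := by
  simp [act, Matrix.toLpLin_apply, Matrix.mulVec_mulVec]

lemma act_one (x : Rd d) : act 1 x = x := by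
  simp [act]

lemma act_add (A : Matrix (Fin d) (Fin d) ℝ) (x y : Rd d) : act A (x + y) = act A x + act A y :=
  map_add _ _ _

lemma act_sub (A : Matrix (Fin d) (Fin d) ℝ) (x y : Rd d) : act A (x - y) = act A x - act A y :=
  map_sub _ _ _

lemma act_smul (A : Matrix (Fin d) (Fin d) ℝ) (c : ℝ) (x : Rd d) : act A (c • x) = c • act A x :=
  map_smul _ _ _

lemma act_zero (A : Matrix (Fin d) (Fin d) ℝ) : act A 0 = 0 := map_zero _

lemma act_latt (k : Zd d) : act (realMat M) (latt k) = latt (M *ᵥ k) := by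
  ext i
  simp [act, Matrix.toLpLin_apply, latt, Matrix.mulVec, dotProduct, realMat]

lemma act_transpose_inv_cancel (hM : M.det ≠ 0) (x : Rd d) :
    act (realMat M)ᵀ (act ((realMat M)ᵀ)⁻¹ x) = x := by
  rw [act_act, Matrix.mul_nonsing_inv, act_one]
  simpa using det_realMat_ne_zero hM

lemma act_inv_transpose_cancel (hM : M.det ≠ 0) (x : Rd d) :
    act ((realMat M)ᵀ)⁻¹ (act (realMat M)ᵀ x) = x := by
  rw [act_act, Matrix.nonsing_inv_mul, act_one]
  simpa using det_realMat_ne_zero hM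

lemma exists_latt_of_mem_Omega (hM : M.det ≠ 0) {ω : Rd d} (hω : ω ∈ Omega M) :
    ∃ l : Zd d, act (realMat M)ᵀ ω = latt l := by
  obtain ⟨⟨l, rfl⟩, _⟩ := hω
  exact ⟨l, act_transpose_inv_cancel hM _⟩

lemma chi_mulVec_Omega (hM : M.det ≠ 0) {ω : Rd d} (hω : ω ∈ Omega M) (k : Zd d) :
    chi (latt (M *ᵥ k)) ((2 * Real.pi) • ω) = 1 := by
  obtain ⟨l, hl⟩ := exists_latt_of_mem_Omega hM hω
  rw [← chi_latt_act, act_smul, hl, chi_latt_two_pi_latt]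

lemma chi_eq_of_mk_eq (hM : M.det ≠ 0) {ω : Rd d} (hω : ω ∈ Omega M) {n n' : Zd d}
    (h : Submodule.Quotient.mk (p := imLat M) n = Submodule.Quotient.mk n') :
    chi (latt n) ((2 * Real.pi) • ω) = chi (latt n') ((2 * Real.pi) • ω) := by
  rw [Submodule.Quotient.eq] at h
  obtain ⟨k, hk⟩ := h
  have : n = M *ᵥ k + n' := by rw [← sub_eq_iff_eq_add, ← hk]; rfl
  rw [this, latt_add, chi_add_left, chi_mulVec_Omega hM hω, one_mul]

/-- The character of `ℤ^d / M ℤ^d` attached to a frequency in `Ω_M`. -/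
def omegaChar (hM : M.det ≠ 0) {ω : Rd d} (hω : ω ∈ Omega M) : AddChar (Cos M) ℂ where
  toFun g := chi (latt (rep g)) ((2 * Real.pi) • ω)
  map_zero_eq_one' := by
    rw [chi_eq_of_mk_eq hM hω (n' := 0) (by rw [mk_rep]; rfl), latt_zero, chi_zero_left]
  map_add_eq_mul' g h := by
    rw [chi_eq_of_mk_eq hM hω (n' := rep g + rep h), latt_add, chi_add_left]
    rw [mk_rep, Submodule.Quotient.mk_add, mk_rep, mk_rep]

lemma omegaChar_mk (hM : M.det ≠ 0) {ω : Rd d} (hω : ω ∈ Omega M) (n : Zd d) :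
    omegaChar hM hω (Submodule.Quotient.mk n) = chi (latt n) ((2 * Real.pi) • ω) :=
  chi_eq_of_mk_eq hM hω (mk_rep _)

lemma omega_eq_zero {ω : Rd d} (hω : ω ∈ Omega M)
    (h : ∀ n : Zd d, chi (latt n) ((2 * Real.pi) • ω) = 1) : ω = 0 := by
  ext i
  obtain ⟨z, hz⟩ := (chi_two_pi_eq_one_iff _ _).1 (h (Pi.single i 1))
  rw [inner_latt_single] at hz
  have h1 := hω.2 i
  rw [hz] at h1 ⊢
  have h2 : 0 ≤ z := Int.cast_nonneg_iff.1 h1.1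
  have h3 : z < 1 := by
    rw [← Int.cast_lt (R := ℝ), Int.cast_one]; exact h1.2
  have : z = 0 := by omega
  simp [this]

lemma sum_chi_rep [Fintype (Cos M)] (hM : M.det ≠ 0) {ω : Rd d} (hω : ω ∈ Omega M) :
    ∑ g : Cos M, chi (latt (rep g)) ((2 * Real.pi) • ω)
      = (Fintype.card (Cos M) : ℂ) * delta ω := by
  classical
  have h := AddChar.sum_eq_ite (omegaChar hM hω)
  have h0 : omegaChar hM hω = 0 ↔ ω = 0 := by
    constructor
    · intro h0
      refine omega_eq_zero hω fun n => ?_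
      rw [← omegaChar_mk hM hω, h0, AddChar.zero_apply]
    · rintro rfl
      ext g
      change chi (latt (rep g)) ((2 * Real.pi) • (0 : Rd d)) = 1
      rw [smul_zero, chi_zero_right]
  rw [delta, mul_ite, mul_one, mul_zero, ← if_congr h0 rfl rfl]
  exact h

/-- Every character of `ℤ^d / M ℤ^d` comes from a frequency in `Ω_M`. -/
lemma exists_omega_of_char (hM : M.det ≠ 0) (ψ : AddChar (Cos M) ℂ) :
    ∃ ω ∈ Omega M, ∀ n : Zd d,
      ψ (Submodule.Quotient.mk n) = chi (latt n) ((2 * Real.pi) • ω) := by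
  have := finite_cos hM
  let e : Fin d → ℂ := fun j => ψ (Submodule.Quotient.mk (Pi.single j 1))
  let θ : Rd d := WithLp.toLp 2 fun j => Int.fract (-(e j).arg / (2 * Real.pi))
  have hpi := Real.pi_pos
  have he : ∀ j, chi (latt (Pi.single j 1)) ((2 * Real.pi) • θ) = e j := by
    intro j
    have h1 : ‖e j‖ = 1 := AddChar.norm_apply _ _
    rw [chi_two_pi, inner_latt_single]
    have h2 : θ j = -(e j).arg / (2 * Real.pi) - ⌊-(e j).arg / (2 * Real.pi)⌋ := rfl
    have h3 : 2 * Real.pi * θ j = -(e j).arg - ⌊-(e j).arg / (2 * Real.pi)⌋ * (2 * Real.pi) := by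
      rw [h2]; field_simp
    have h4 : -(((2 * Real.pi * θ j : ℝ) : ℂ) * Complex.I)
        = (e j).arg * Complex.I
          + ⌊-(e j).arg / (2 * Real.pi)⌋ * (2 * Real.pi * Complex.I) := by
      rw [h3]; push_cast; ring
    rw [h4, Complex.exp_add, Complex.exp_int_mul_two_pi_mul_I, mul_one]
    have := Complex.norm_mul_exp_arg_mul_I (e j)
    rwa [h1, Complex.ofReal_one, one_mul] at this
  let F : AddChar (Zd d) ℂ :=
    { toFun := fun n => chi (latt n) ((2 * Real.pi) • θ)
      map_zero_eq_one' := by simp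
      map_add_eq_mul' := fun a b => by rw [latt_add, chi_add_left] }
  let F' : AddChar (Zd d) ℂ := ψ.compAddMonoidHom (imLat M).mkQ.toAddMonoidHom
  have hFF : F' = F := by
    ext n
    have hn : n = ∑ j, n j • (Pi.single j 1 : Zd d) := by
      ext i; simp [Finset.sum_apply, Pi.single_apply]
    have hsum : ∀ χ : AddChar (Zd d) ℂ, χ (∑ j, n j • (Pi.single j 1 : Zd d))
        = ∏ j, χ (Pi.single j 1) ^ n j := by
      intro χ
      have := map_prod χ.toMonoidHom
        (fun j => Multiplicative.ofAdd (n j • (Pi.single j 1 : Zd d))) Finset.univ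
      refine this.trans (Finset.prod_congr rfl fun j _ => ?_)
      exact χ.map_zsmul_eq_zpow _ _
    rw [hn, hsum, hsum]
    refine Finset.prod_congr rfl fun j _ => ?_
    congr 1
    exact (he j).symm
  have hF : ∀ n : Zd d, ψ (Submodule.Quotient.mk n) = chi (latt n) ((2 * Real.pi) • θ) :=
    fun n => DFunLike.congr_fun hFF n
  refine ⟨θ, ⟨?_, fun i => ⟨Int.fract_nonneg _, Int.fract_lt_one _⟩⟩, hF⟩
  have hint : ∀ j, ∃ z : ℤ, (act (realMat M)ᵀ θ) j = z := by
    intro j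
    have h1 := hF (M *ᵥ (Pi.single j 1))
    have h2 : Submodule.Quotient.mk (p := imLat M) (M *ᵥ (Pi.single j 1 : Zd d)) = 0 := by
      have := mk_mulVec_add (M := M) (Pi.single j 1) 0
      rw [add_zero] at this
      exact this
    rw [h2, AddChar.map_zero_eq_one] at h1
    obtain ⟨z, hz⟩ := (chi_two_pi_eq_one_iff _ _).1 h1.symm
    rw [← inner_latt_act, inner_latt_single] at hz
    exact ⟨z, hz⟩
  choose z hz using hint
  refine ⟨z, ?_⟩
  have : latt z = act (realMat M)ᵀ θ := by
    ext j; rw [hz, latt_apply]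
  rw [this, act_inv_transpose_cancel hM]

/-- Shifting the frequency by an element of `Ω_M` multiplies the polyphase components by the
corresponding character. -/
lemma symbol_add_omega [Fintype (Cos M)] (hM : M.det ≠ 0) (u : Filt d ℂ) (ξ : Rd d) {ω : Rd d}
    (hω : ω ∈ Omega M) :
    symbol u (ξ + (2 * Real.pi) • ω) = ∑ g : Cos M,
      chi (latt (rep g)) ((2 * Real.pi) • ω) *
        (chi (latt (rep g)) ξ * symbol (sub M hM u (rep g)) (act (realMat M)ᵀ ξ)) := by
  rw [symbol_eq_sum_cos hM]
  refine Finset.sum_congr rfl fun g _ => ?_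
  obtain ⟨l, hl⟩ := exists_latt_of_mem_Omega hM hω
  have h : ∀ w : Filt d ℂ, symbol w (act (realMat M)ᵀ (ξ + (2 * Real.pi) • ω))
      = symbol w (act (realMat M)ᵀ ξ) := by
    intro w
    simp only [symbol_eq_sum]
    refine Finsupp.sum_congr fun k _ => ?_
    rw [act_add, act_smul, hl, chi_add_right, chi_latt_two_pi_latt, mul_one]
  rw [h, chi_add_right]
  ring

/-- Sum rules in polyphase form, obtained by Fourier inversion on `ℤ^d / M ℤ^d`. -/
lemma polyphase_of_sumRules [Fintype (Cos M)] (hM : M.det ≠ 0) {r m : ℕ} (u : Fin r → Filt d ℂ)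
    (V : Fin r → Rd d → ℂ) (W : Rd d → ℂ)
    (h : ∀ ω ∈ Omega M, EqMod m
      (fun ξ => ∑ ℓ, V ℓ ξ * symbol (u ℓ) (ξ + (2 * Real.pi) • ω)) (fun ξ => delta ω * W ξ))
    (g : Cos M) :
    EqMod m (fun ξ => (Fintype.card (Cos M) : ℂ) *
        ∑ ℓ, V ℓ ξ * symbol (sub M hM (u ℓ) (rep g)) (act (realMat M)ᵀ ξ))
      (fun ξ => chi (-latt (rep g)) ξ * W ξ) := by
  classical
  choose ω hω hψ using fun ψ : AddChar (Cos M) ℂ => exists_omega_of_char hM ψ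
  have hψ' : ∀ ψ g', chi (latt (rep g')) ((2 * Real.pi) • ω ψ) = ψ g' := by
    intro ψ g'
    rw [← hψ ψ, mk_rep]
  have hb : chi (-latt (rep g)) =O[𝓝 0] fun _ => (1 : ℝ) :=
    isBigO_one_of_continuous (continuous_chi _)
  have h1 : EqMod m
      (fun ξ => ∑ ψ : AddChar (Cos M) ℂ, ψ (-g) * (chi (-latt (rep g)) ξ *
        ∑ ℓ, V ℓ ξ * symbol (u ℓ) (ξ + (2 * Real.pi) • ω ψ)))
      (fun ξ => ∑ ψ : AddChar (Cos M) ℂ, ψ (-g) *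
        (chi (-latt (rep g)) ξ * (delta (ω ψ) * W ξ))) := by
    refine EqMod.sum _ fun ψ _ => ?_
    have h2 := (IsBigO.mul hb (h (ω ψ) (hω ψ))).const_mul_left (ψ (-g))
    simp only [one_mul] at h2
    exact h2.congr_left fun ξ => by ring
  have hdelta : ∀ ψ, delta (ω ψ) = if ψ = 0 then 1 else 0 := by
    intro ψ
    rw [delta]
    refine if_congr ⟨fun h0 => ?_, fun h0 => ?_⟩ rfl rfl
    · ext g'
      rw [← hψ' ψ g', h0, smul_zero, chi_zero_right, AddChar.zero_apply]
    · refine omega_eq_zero (hω ψ) fun n => ?_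
      rw [← hψ, h0, AddChar.zero_apply]
  refine (h1.congr_left fun ξ => ?_).congr_right fun ξ => ?_
  · have h3 : ∀ ψ : AddChar (Cos M) ℂ, ψ (-g) * (chi (-latt (rep g)) ξ *
        ∑ ℓ, V ℓ ξ * symbol (u ℓ) (ξ + (2 * Real.pi) • ω ψ))
        = ∑ g' : Cos M, ψ (g' - g) * (chi (-latt (rep g)) ξ * chi (latt (rep g')) ξ *
          ∑ ℓ, V ℓ ξ * symbol (sub M hM (u ℓ) (rep g')) (act (realMat M)ᵀ ξ)) := by
      intro ψ
      simp only [symbol_add_omega hM _ ξ (hω ψ), hψ', Finset.mul_sum]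
      rw [Finset.sum_comm]
      refine Finset.sum_congr rfl fun g' _ => Finset.sum_congr rfl fun ℓ _ => ?_
      rw [sub_eq_add_neg, AddChar.map_add_eq_mul]
      ring
    simp only [h3]
    rw [Finset.sum_comm]
    simp only [← Finset.sum_mul, AddChar.sum_apply_eq_ite, sub_eq_zero, ite_mul, zero_mul]
    rw [Finset.sum_ite_eq' Finset.univ g]
    simp only [Finset.mem_univ, if_true, chi_neg_mul, one_mul]
  · simp only [hdelta]
    rw [Finset.sum_eq_single 0]
    · simp
    · intro ψ _ hne; simp [hne]
    · simp

end Characters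

/-! ### Construction of the high-pass filters -/

section FilterBank

variable {d : ℕ} {M : Matrix (Fin d) (Fin d) ℤ}

/-- The `(i, j)` entry of a matrix-valued filter. -/
def entry {s r : ℕ} (a : Filt d (Matrix (Fin s) (Fin r) ℂ)) (i : Fin s) (j : Fin r) : Filt d ℂ :=
  Finsupp.mapRange (Matrix.entryLinearMap ℂ ℂ i j) (map_zero _) a

lemma entry_apply {s r : ℕ} (a : Filt d (Matrix (Fin s) (Fin r) ℂ)) (i : Fin s) (j : Fin r)
    (k : Zd d) : entry a i j k = a k i j := rfl

lemma symbol_entry {s r : ℕ} (a : Filt d (Matrix (Fin s) (Fin r) ℂ)) (i : Fin s) (j : Fin r)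
    (ξ : Rd d) : symbol (entry a i j) ξ = symbol a ξ i j :=
  symbol_mapRange (Matrix.entryLinearMap ℂ ℂ i j) a ξ

/-- Filters may be prescribed by their polyphase components. -/
lemma exists_filter_of_polyphase [Fintype (Cos M)] (hM : M.det ≠ 0) {s r : ℕ}
    (B : Fin s → Cos M × Fin r → Filt d ℂ) :
    ∃ b : Filt d (Matrix (Fin s) (Fin r) ℂ), ∀ l (i : Cos M × Fin r),
      sub M hM (entry b l i.2) (rep i.1) = B l i := by
  choose q hq using exists_eq_rep_add (M := M)
  have hqk : ∀ (k : Zd d) (g : Cos M), q (M *ᵥ k + rep g) = k := by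
    intro k g
    have h := hq (M *ᵥ k + rep g)
    rw [mk_mulVec_add, mk_rep] at h
    exact (mulVec_injective hM (add_right_cancel h)).symm
  let f : Zd d → Matrix (Fin s) (Fin r) ℂ := fun n =>
    Matrix.of fun l p => B l (Submodule.Quotient.mk n, p) (q n)
  have hfin : (Function.support f).Finite := by
    refine (Set.finite_iUnion fun l : Fin s => Set.finite_iUnion fun i : Cos M × Fin r =>
      ((B l i).support.finite_toSet.image fun k => M *ᵥ k + rep i.1)).subset ?_
    intro n hn
    obtain ⟨l, p, hlp⟩ : ∃ l p, f n l p ≠ 0 := by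
      by_contra! h
      exact hn (by ext l p; exact h l p)
    simp only [Set.mem_iUnion, Set.mem_image, Finset.mem_coe, Finsupp.mem_support_iff]
    exact ⟨l, (Submodule.Quotient.mk n, p), q n, hlp, (hq n).symm⟩
  refine ⟨Finsupp.ofSupportFinite f hfin, fun l i => ?_⟩
  ext k
  rw [sub_apply, entry_apply]
  change B l (Submodule.Quotient.mk (M *ᵥ k + rep i.1), i.2) (q (M *ᵥ k + rep i.1)) = _
  rw [mk_mulVec_add, mk_rep, hqk]

/-- Evaluation of trigonometric polynomials at a point. -/
def trigEval (ζ : Rd d) : Trig d →⋆ₐ[ℂ] ℂ where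
  toFun p := (p : Rd d → ℂ) ζ
  map_one' := rfl
  map_mul' _ _ := rfl
  map_zero' := rfl
  map_add' _ _ := rfl
  commutes' _ := rfl
  map_star' _ := rfl

/-- Extension principle: the low-pass polyphase matrix `A` satisfies `A w ≡ φ̂` and
`D A* φ̂ ≡ w` for the polyphase vector `w` of `φ̂`, so `D⁻¹ - A* A` meets the hypotheses of
`exists_signed_gram` and factors through high-pass filters annihilating `φ̂` to order `m`. -/
theorem exists_highpass [Fintype (Cos M)] (hM : M.det ≠ 0) {r m : ℕ}
    (a : Filt d (Matrix (Fin r) (Fin r) ℂ)) (Φ : Fin r → Rd d → ℂ)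
    (hbdd : ∀ p, Φ p =O[𝓝 0] fun _ => (1 : ℝ))
    (href : ∀ ξ ℓ, Φ ℓ (act (realMat M)ᵀ ξ) = ∑ p, symbol (entry a ℓ p) ξ * Φ p ξ)
    (happ : ∀ (g : Cos M) p, TrigApprox (m + m) fun ζ =>
      chi (latt (rep g)) (act ((realMat M)ᵀ)⁻¹ ζ) * Φ p (act ((realMat M)ᵀ)⁻¹ ζ))
    (hnorm : EqMod (m + m) (fun ξ => ∑ p, star (Φ p ξ) * Φ p ξ) (fun _ => (1 : ℂ)))
    (hsum : ∀ ω ∈ Omega M, ∀ p, EqMod m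
      (fun ξ => ∑ ℓ, star (Φ ℓ (act (realMat M)ᵀ ξ)) *
        symbol (entry a ℓ p) (ξ + (2 * Real.pi) • ω)) (fun ξ => delta ω * star (Φ p ξ))) :
    ∃ (s : ℕ) (b : Filt d (Matrix (Fin s) (Fin r) ℂ)) (ε : Fin s → ℂ), 1 ≤ s ∧
      (∀ l, ε l = 1 ∨ ε l = -1) ∧
      (∀ (i j : Cos M × Fin r) (ζ : Rd d),
        ∑ ℓ, star (symbol (sub M hM (entry a ℓ i.2) (rep i.1)) ζ) *
            symbol (sub M hM (entry a ℓ j.2) (rep j.1)) ζ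
          + ∑ l, ε l * (star (symbol (sub M hM (entry b l i.2) (rep i.1)) ζ) *
            symbol (sub M hM (entry b l j.2) (rep j.1)) ζ)
          = open Classical in if i = j then ((Fintype.card (Cos M) : ℂ))⁻¹ else 0) ∧
      ∀ l, EqMod m (fun ξ => ∑ p, symbol (entry b l p) ξ * Φ p ξ) (fun _ => 0) := by
  classical
  set N := ((realMat M)ᵀ)⁻¹ with hN
  set D : ℂ := (Fintype.card (Cos M) : ℂ) with hD
  have hD0 : D ≠ 0 := by rw [hD]; exact_mod_cast Fintype.card_ne_zero
  have hDs : star D⁻¹ = D⁻¹ := by rw [hD]; simp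
  let ws : Cos M × Fin r → Rd d → ℂ := fun i ζ => chi (latt (rep i.1)) (act N ζ) * Φ i.2 (act N ζ)
  choose w hw using fun i : Cos M × Fin r => happ i.1 i.2
  replace hw : ∀ i, EqMod (m + m) (ws i) (w i : Rd d → ℂ) := hw
  let A : Fin r → Cos M × Fin r → Trig d := fun ℓ i =>
    ⟨symbol (sub M hM (entry a ℓ i.2) (rep i.1)), symbol_mem_trig _⟩
  have hwsb : ∀ i, ws i =O[𝓝 0] fun _ => (1 : ℝ) := fun i =>
    (hw i).isBigO_one (isBigO_one_trig _)
  have hw0 : ∀ i, (w i : Rd d → ℂ) =O[𝓝 0] fun _ => (1 : ℝ) := fun i => isBigO_one_trig _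
  have bstar : ∀ {f : Rd d → ℂ}, f =O[𝓝 0] (fun _ => (1 : ℝ)) →
      (fun ξ => star (f ξ)) =O[𝓝 0] (fun _ => (1 : ℝ)) := by
    intro f hf
    refine IsBigO.of_norm_left (hf.norm_left.congr_left fun ξ => ?_)
    rw [norm_star]
  -- the polyphase vector is normalized
  have E1 : EqMod (m + m) (fun ζ => ∑ i, star ((w i : Rd d → ℂ) ζ) * (w i : Rd d → ℂ) ζ)
      (fun _ => D) := by
    have h1 : EqMod (m + m) (fun ζ => ∑ i, star (ws i ζ) * ws i ζ)
        (fun ζ => ∑ i, star ((w i : Rd d → ℂ) ζ) * (w i : Rd d → ℂ) ζ) :=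
      EqMod.sum _ fun i _ => (hw i).star.mul (hw i) (bstar (hwsb i)) (hw0 i)
    have h2 : ∀ ζ, ∑ i, star (ws i ζ) * ws i ζ
        = D * ∑ p, star (Φ p (act N ζ)) * Φ p (act N ζ) := by
      intro ζ
      rw [Fintype.sum_prod_type]
      have : ∀ g : Cos M, ∑ p, star (ws (g, p) ζ) * ws (g, p) ζ
          = ∑ p, star (Φ p (act N ζ)) * Φ p (act N ζ) := by
        intro g
        refine Finset.sum_congr rfl fun p _ => ?_
        have h3 := chi_neg_mul (latt (rep g)) (act N ζ)
        simp only [ws, star_mul, star_chi]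
        linear_combination (star (Φ p (act N ζ)) * Φ p (act N ζ)) * h3
      simp only [this, Finset.sum_const, Finset.card_univ, nsmul_eq_mul, hD]
    have h4 := (hnorm.comp_act N).const_mul_left D
    have h5 : EqMod (m + m) (fun ζ => ∑ i, star (ws i ζ) * ws i ζ) (fun _ => D) :=
      h4.congr_left fun ζ => by simp only [h2, mul_sub, mul_one]
    exact h1.symm.trans h5
  -- refinement: the low-pass polyphase matrix maps the polyphase vector to `φ̂`
  have E2 : ∀ ℓ, EqMod (m + m) (fun ζ => ∑ i, (A ℓ i : Rd d → ℂ) ζ * (w i : Rd d → ℂ) ζ)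
      (Φ ℓ) := by
    intro ℓ
    have h1 : EqMod (m + m) (fun ζ => ∑ i, (A ℓ i : Rd d → ℂ) ζ * ws i ζ)
        (fun ζ => ∑ i, (A ℓ i : Rd d → ℂ) ζ * (w i : Rd d → ℂ) ζ) :=
      EqMod.sum _ fun i _ => (EqMod.refl _).mul (hw i) (isBigO_one_trig _) (hw0 i)
    refine h1.symm.congr_right fun ζ => ?_
    have h2 := href (act N ζ) ℓ
    rw [act_transpose_inv_cancel hM] at h2
    rw [h2, Fintype.sum_prod_type, Finset.sum_comm]
    refine Finset.sum_congr rfl fun p _ => ?_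
    rw [symbol_eq_sum_cos hM, act_transpose_inv_cancel hM, Finset.sum_mul]
    refine Finset.sum_congr rfl fun g _ => ?_
    simp only [A, ws]
    ring
  -- sum rules: the adjoint of the low-pass polyphase matrix maps `φ̂` back
  have E3 : ∀ i, EqMod m (fun ζ => ∑ ℓ, star ((A ℓ i : Rd d → ℂ) ζ) * Φ ℓ ζ)
      (fun ζ => D⁻¹ * (w i : Rd d → ℂ) ζ) := by
    intro i
    have h1 := polyphase_of_sumRules hM (fun ℓ => entry a ℓ i.2)
      (fun ℓ ξ => star (Φ ℓ (act (realMat M)ᵀ ξ))) (fun ξ => star (Φ i.2 ξ))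
      (fun ω hω => hsum ω hω i.2) i.1
    have h2 := (h1.comp_act N).star
    have h3 := IsBigO.const_mul_left h2 D⁻¹
    have h4 : EqMod m (fun ζ => ∑ ℓ, star ((A ℓ i : Rd d → ℂ) ζ) * Φ ℓ ζ)
        (fun ζ => D⁻¹ * ws i ζ) := by
      refine h3.congr_left fun ζ => ?_
      simp only [act_transpose_inv_cancel hM, star_mul, star_star, star_sum, star_chi, neg_neg, A,
        ws, hN, mul_sub]
      congr 1
      · have hDD : star D = D := by rw [hD]; simp
        rw [← hD, hDD, mul_comm _ D, inv_mul_cancel_left₀ hD0]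
      · ring
    refine h4.trans ?_
    have h5 := IsBigO.const_mul_left ((hw i).mono (Nat.le_add_left m m)) D⁻¹
    exact h5.congr_left fun ζ => by ring
  set H : Matrix (Cos M × Fin r) (Cos M × Fin r) (Trig d) := Matrix.of fun i j =>
    (if i = j then algebraMap ℂ (Trig d) D⁻¹ else 0) - ∑ ℓ, star (A ℓ i) * A ℓ j with hH
  have hHw : ∀ i, (H *ᵥ w) i = algebraMap ℂ (Trig d) D⁻¹ * w i
      - ∑ ℓ, star (A ℓ i) * ∑ j, A ℓ j * w j := by
    intro i
    simp only [Matrix.mulVec, dotProduct, hH, Matrix.of_apply, sub_mul, Finset.sum_sub_distrib,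
      ite_mul, zero_mul, Finset.sum_ite_eq, Finset.mem_univ, if_true]
    congr 1
    simp only [Finset.sum_mul, Finset.mul_sum]
    rw [Finset.sum_comm]
    refine Finset.sum_congr rfl fun ℓ _ => Finset.sum_congr rfl fun j _ => by ring
  have hHherm : H.IsHermitian := by
    ext1 i j
    simp only [Matrix.conjTranspose_apply, hH, Matrix.of_apply, star_sub, star_sum, star_mul,
      star_star]
    congr 2
    by_cases hij : i = j
    · rw [if_pos hij, if_pos hij.symm, ← algebraMap_star_comm, hDs]
    · rw [if_neg hij, if_neg (Ne.symm hij), star_zero]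
  have hc : D⁻¹ • ∑ i, star (w i) * w i - 1 ∈ vanIdeal d m := by
    have h1 := IsBigO.const_mul_left (E1.mono (Nat.le_add_left m m)) D⁻¹
    rw [mem_vanIdeal]
    refine h1.congr_left fun ζ => ?_
    change _ = trigEval ζ (D⁻¹ • ∑ i, star (w i) * w i - 1)
    simp only [map_sub, map_smul, map_sum, map_mul, map_star, map_one, smul_eq_mul]
    rw [mul_sub, inv_mul_cancel₀ hD0]
    rfl
  have h1 : ∀ i, (H *ᵥ w) i ∈ vanIdeal d m := by
    intro i
    rw [mem_vanIdeal]
    have h2 : EqMod m (fun ζ => ∑ ℓ, star ((A ℓ i : Rd d → ℂ) ζ) *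
        ∑ j, (A ℓ j : Rd d → ℂ) ζ * (w j : Rd d → ℂ) ζ)
        (fun ζ => ∑ ℓ, star ((A ℓ i : Rd d → ℂ) ζ) * Φ ℓ ζ) :=
      EqMod.sum _ fun ℓ _ => (EqMod.refl _).mul ((E2 ℓ).mono (Nat.le_add_left m m))
        (bstar (isBigO_one_trig _)) (hbdd ℓ)
    refine IsBigO.congr_left (h2.trans (E3 i)).symm fun ζ => ?_
    change _ = trigEval ζ ((H *ᵥ w) i)
    rw [hHw]
    simp only [map_sub, map_sum, map_mul, map_star, AlgHomClass.commutes]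
    rfl
  have h2 : star w ⬝ᵥ (H *ᵥ w) ∈ vanIdeal d m * vanIdeal d m := by
    refine vanIdeal_add_le m m ?_
    rw [mem_vanIdeal]
    have hAwb : ∀ ℓ, (fun ζ => ∑ j, (A ℓ j : Rd d → ℂ) ζ * (w j : Rd d → ℂ) ζ)
        =O[𝓝 0] fun _ => (1 : ℝ) := fun ℓ => (E2 ℓ).isBigO_one (hbdd ℓ)
    have h3 : EqMod (m + m) (fun ζ => ∑ ℓ, star (∑ j, (A ℓ j : Rd d → ℂ) ζ * (w j : Rd d → ℂ) ζ) *
        ∑ j, (A ℓ j : Rd d → ℂ) ζ * (w j : Rd d → ℂ) ζ) (fun ξ => ∑ ℓ, star (Φ ℓ ξ) * Φ ℓ ξ) :=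
      EqMod.sum _ fun ℓ _ => (E2 ℓ).star.mul (E2 ℓ) (bstar (hAwb ℓ)) (hbdd ℓ)
    have h4 : EqMod (m + m)
        (fun ζ => D⁻¹ * ∑ i, star ((w i : Rd d → ℂ) ζ) * (w i : Rd d → ℂ) ζ) (fun _ => 1) :=
      (IsBigO.const_mul_left E1 D⁻¹).congr_left fun ζ => by rw [mul_sub, inv_mul_cancel₀ hD0]
    refine IsBigO.congr_left (h4.trans (h3.trans hnorm).symm) fun ζ => ?_
    change _ = trigEval ζ (star w ⬝ᵥ (H *ᵥ w))
    have h5 : star w ⬝ᵥ (H *ᵥ w) = algebraMap ℂ (Trig d) D⁻¹ * ∑ i, star (w i) * w i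
        - ∑ ℓ, star (∑ j, A ℓ j * w j) * ∑ j, A ℓ j * w j := by
      simp only [dotProduct, hHw, Pi.star_apply, mul_sub, Finset.sum_sub_distrib]
      congr 1
      · rw [Finset.mul_sum]
        refine Finset.sum_congr rfl fun i _ => by ring
      · simp only [star_sum, star_mul, Finset.sum_mul, Finset.mul_sum]
        rw [Finset.sum_comm]
        refine Finset.sum_congr rfl fun ℓ _ => ?_
        rw [Finset.sum_comm]
        refine Finset.sum_congr rfl fun i _ => Finset.sum_congr rfl fun j _ => by ring
    rw [h5]
    simp only [map_sub, map_sum, map_mul, map_star, AlgHomClass.commutes]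
    rfl
  obtain ⟨s, B, ε, hs, hε, hBw, hBH⟩ := exists_signed_gram
    (fun p hp => star_mem_vanIdeal hp) D⁻¹ hDs hc hHherm h1 h2
  choose u hu using fun l i => exists_symbol_eq (B l i).2
  obtain ⟨b, hb⟩ := exists_filter_of_polyphase hM u
  refine ⟨s, b, ε, hs, hε, fun i j ζ => ?_, fun l => ?_⟩
  · have h3 := congrArg (trigEval ζ) (hBH i j)
    have h4 : trigEval ζ (if i = j then algebraMap ℂ (Trig d) D⁻¹ else 0)
        = if i = j then D⁻¹ else 0 := by
      split_ifs
      · rfl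
      · rfl
    simp only [hH, Matrix.of_apply, map_sub, map_sum, map_mul, map_star, h4, map_smul,
      smul_eq_mul] at h3
    rw [sub_eq_iff_eq_add'] at h3
    simp only [hb, hu]
    exact h3.symm
  · have h3 : EqMod m (fun ζ => ∑ i, (B l i : Rd d → ℂ) ζ * ws i ζ) (fun _ => 0) := by
      have h4 : EqMod m (fun ζ => ∑ i, (B l i : Rd d → ℂ) ζ * ws i ζ)
          (fun ζ => ∑ i, (B l i : Rd d → ℂ) ζ * (w i : Rd d → ℂ) ζ) :=
        EqMod.sum _ fun i _ => (EqMod.refl _).mul ((hw i).mono (Nat.le_add_left m m))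
          (isBigO_one_trig _) (hw0 i)
      refine h4.trans ((mem_vanIdeal_iff_eqMod_zero.1 (hBw l)).congr_left fun ζ => ?_)
      change trigEval ζ (B l ⬝ᵥ w) = _
      simp only [dotProduct, map_sum, map_mul]
      rfl
    refine (h3.comp_act (realMat M)ᵀ).congr_left fun ξ => ?_
    rw [Fintype.sum_prod_type, Finset.sum_comm]
    refine Finset.sum_congr rfl fun p _ => ?_
    rw [symbol_eq_sum_cos hM, Finset.sum_mul]
    refine Finset.sum_congr rfl fun g _ => ?_
    simp only [hb l (g, p), hu, ws, hN, act_inv_transpose_cancel hM]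
    ring

end FilterBank

/-! ### The filter bank identity in the frequency and time domains -/

section TimeDomain

variable {d : ℕ} {M : Matrix (Fin d) (Fin d) ℤ}

/-- The polyphase identity `A* A + B* diag(ε) B = |det M|⁻¹` for two matrix-valued filters. -/
def PolyphaseIdentity [Fintype (Cos M)] (hM : M.det ≠ 0) {r s : ℕ}
    (a : Filt d (Matrix (Fin r) (Fin r) ℂ)) (b : Filt d (Matrix (Fin s) (Fin r) ℂ))
    (ε : Fin s → ℂ) : Prop :=
  ∀ (i j : Cos M × Fin r) (ζ : Rd d),
    ∑ ℓ, star (symbol (sub M hM (entry a ℓ i.2) (rep i.1)) ζ) *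
        symbol (sub M hM (entry a ℓ j.2) (rep j.1)) ζ
      + ∑ l, ε l * (star (symbol (sub M hM (entry b l i.2) (rep i.1)) ζ) *
        symbol (sub M hM (entry b l j.2) (rep j.1)) ζ)
      = open Classical in if i = j then ((Fintype.card (Cos M) : ℂ))⁻¹ else 0

variable {hM : M.det ≠ 0} {r s : ℕ}
  {a : Filt d (Matrix (Fin r) (Fin r) ℂ)} {b : Filt d (Matrix (Fin s) (Fin r) ℂ)}
  {ε : Fin s → ℂ}

/-- In the frequency domain the polyphase identity is the quasi-tight filter bank identity. -/
lemma PolyphaseIdentity.isQuasiTightFilterBank [Fintype (Cos M)] (h : PolyphaseIdentity hM a b ε)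
    (hε : ∀ l, ε l = 1 ∨ ε l = -1) : IsQuasiTightFilterBank M a b ε := by
  classical
  refine ⟨hε, fun ξ ω hω => ?_⟩
  set ζ := act (realMat M)ᵀ ξ with hζ
  have key : ∀ u w : Filt d ℂ, star (symbol u ξ) * symbol w (ξ + (2 * Real.pi) • ω)
      = ∑ g : Cos M, ∑ g' : Cos M, (chi (-latt (rep g)) ξ * (chi (latt (rep g')) ξ *
        chi (latt (rep g')) ((2 * Real.pi) • ω))) *
        (star (symbol (sub M hM u (rep g)) ζ) * symbol (sub M hM w (rep g')) ζ) := by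
    intro u w
    rw [symbol_eq_sum_cos hM u, symbol_add_omega hM w ξ hω, star_sum, Finset.sum_mul_sum]
    refine Finset.sum_congr rfl fun g _ => Finset.sum_congr rfl fun g' _ => ?_
    rw [star_mul, star_chi]; ring
  ext p p'
  have hL : ((symbol a ξ)ᴴ * symbol a (ξ + (2 * Real.pi) • ω)
      + (symbol b ξ)ᴴ * Matrix.diagonal ε * symbol b (ξ + (2 * Real.pi) • ω)) p p'
      = ∑ ℓ, star (symbol (entry a ℓ p) ξ) * symbol (entry a ℓ p') (ξ + (2 * Real.pi) • ω)
        + ∑ l, ε l * (star (symbol (entry b l p) ξ) *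
          symbol (entry b l p') (ξ + (2 * Real.pi) • ω)) := by
    rw [Matrix.add_apply, Matrix.mul_apply, Matrix.mul_apply]
    simp only [Matrix.conjTranspose_apply, Matrix.mul_diagonal, symbol_entry]
    congr 1
    refine Finset.sum_congr rfl fun l _ => by ring
  rw [hL]
  simp only [key, Finset.mul_sum]
  rw [Finset.sum_comm, Finset.sum_comm (s := (Finset.univ : Finset (Fin s))),
    ← Finset.sum_add_distrib]
  have hg : ∀ g : Cos M, (∑ ℓ, ∑ g' : Cos M, (chi (-latt (rep g)) ξ * (chi (latt (rep g')) ξ *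
        chi (latt (rep g')) ((2 * Real.pi) • ω))) *
        (star (symbol (sub M hM (entry a ℓ p) (rep g)) ζ) *
          symbol (sub M hM (entry a ℓ p') (rep g')) ζ))
      + ∑ l, ∑ g' : Cos M, ε l * ((chi (-latt (rep g)) ξ * (chi (latt (rep g')) ξ *
        chi (latt (rep g')) ((2 * Real.pi) • ω))) *
        (star (symbol (sub M hM (entry b l p) (rep g)) ζ) *
          symbol (sub M hM (entry b l p') (rep g')) ζ))
      = chi (latt (rep g)) ((2 * Real.pi) • ω) *
        (if p = p' then ((Fintype.card (Cos M) : ℂ))⁻¹ else 0) := by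
    intro g
    rw [Finset.sum_comm, Finset.sum_comm (s := (Finset.univ : Finset (Fin s))),
      ← Finset.sum_add_distrib]
    have hg' : ∀ g' : Cos M, (∑ ℓ, (chi (-latt (rep g)) ξ * (chi (latt (rep g')) ξ *
        chi (latt (rep g')) ((2 * Real.pi) • ω))) *
        (star (symbol (sub M hM (entry a ℓ p) (rep g)) ζ) *
          symbol (sub M hM (entry a ℓ p') (rep g')) ζ))
      + ∑ l, ε l * ((chi (-latt (rep g)) ξ * (chi (latt (rep g')) ξ *
        chi (latt (rep g')) ((2 * Real.pi) • ω))) *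
        (star (symbol (sub M hM (entry b l p) (rep g)) ζ) *
          symbol (sub M hM (entry b l p') (rep g')) ζ))
        = (chi (-latt (rep g)) ξ * (chi (latt (rep g')) ξ *
          chi (latt (rep g')) ((2 * Real.pi) • ω))) *
          (if (g, p) = (g', p') then ((Fintype.card (Cos M) : ℂ))⁻¹ else 0) := by
      intro g'
      rw [← h (g, p) (g', p') ζ, mul_add, Finset.mul_sum, Finset.mul_sum]
      congr 1
      refine Finset.sum_congr rfl fun l _ => by ring
    simp only [hg', Prod.mk.injEq]
    rw [Finset.sum_eq_single g]
    · rw [← mul_assoc, chi_neg_mul, one_mul]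
      simp
    · intro g' _ hne
      rw [if_neg (fun h => hne h.1.symm), mul_zero]
    · simp
  simp only [hg]
  rw [← Finset.sum_mul, sum_chi_rep hM hω, Matrix.smul_apply, Matrix.one_apply, smul_eq_mul]
  have hD0 : (Fintype.card (Cos M) : ℂ) ≠ 0 := by exact_mod_cast Fintype.card_ne_zero
  split_ifs
  · field_simp
  · simp

/-- The symbol as a linear map. -/
def symbolₗ (d : ℕ) : Filt d ℂ →ₗ[ℂ] (Rd d → ℂ) where
  toFun := symbol
  map_add' u w := funext fun ξ => symbol_add u w ξ
  map_smul' c u := by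
    ext ξ
    simp only [symbol_eq_sum, RingHom.id_apply, Pi.smul_apply, Finsupp.smul_sum]
    rw [Finsupp.sum_smul_index' (by simp)]
    refine Finsupp.sum_congr fun k _ => ?_
    rw [smul_comm]

/-- A linear functional that extracts the constant term of a trigonometric polynomial. -/
lemma exists_constantTerm (d : ℕ) : ∃ T : (Rd d → ℂ) →ₗ[ℂ] ℂ,
    ∀ k : Zd d, T (chi (latt k)) = if k = 0 then 1 else 0 := by
  have hker : LinearMap.ker (symbolₗ d) = ⊥ := LinearMap.ker_eq_bot.2 symbol_injective
  obtain ⟨g, hg⟩ := (symbolₗ d).exists_leftInverse_of_injective hker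
  refine ⟨(Finsupp.lapply (0 : Zd d)).comp g, fun k => ?_⟩
  have h1 : chi (latt k) = symbolₗ d (Finsupp.single k 1) := by
    ext ξ
    change _ = symbol (Finsupp.single k 1) ξ
    rw [symbol_single, smul_eq_mul, mul_one]
  rw [LinearMap.comp_apply, h1, ← LinearMap.comp_apply g, hg, LinearMap.id_apply,
    Finsupp.lapply_apply, Finsupp.single_apply]

lemma summable_star_mul (u w : Filt d ℂ) : Summable fun k => star (u k) * w k := by
  refine summable_of_hasFiniteSupport (u.support.finite_toSet.subset fun k hk => ?_)
  rw [Finset.mem_coe, Finsupp.mem_support_iff]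
  intro h
  simp [h] at hk

/-- Parseval's identity for trigonometric polynomials. -/
lemma constantTerm_star_mul {T : (Rd d → ℂ) →ₗ[ℂ] ℂ}
    (hT : ∀ k : Zd d, T (chi (latt k)) = if k = 0 then 1 else 0) (u w : Filt d ℂ) :
    T (fun ζ => star (symbol u ζ) * symbol w ζ) = ∑' k, star (u k) * w k := by
  have h1 : (fun ζ => star (symbol u ζ) * symbol w ζ)
      = ∑ k ∈ u.support, ∑ l ∈ w.support, (star (u k) * w l) • chi (latt (l - k)) := by
    ext ζ
    simp only [symbol_eq_sum, Finsupp.sum, star_sum, Finset.sum_mul_sum, Finset.sum_apply,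
      Pi.smul_apply, smul_eq_mul, star_mul, star_chi]
    refine Finset.sum_congr rfl fun k _ => Finset.sum_congr rfl fun l _ => ?_
    rw [sub_eq_add_neg, latt_add, chi_add_left, latt_neg]
    ring
  rw [h1, tsum_eq_sum (s := u.support)]
  · simp only [map_sum, map_smul, hT, sub_eq_zero, smul_eq_mul, mul_ite, mul_one, mul_zero]
    refine Finset.sum_congr rfl fun k _ => ?_
    rw [Finset.sum_ite_eq' w.support k]
    split_ifs with hk
    · rfl
    · rw [Finsupp.notMem_support_iff.1 hk, mul_zero]
  · intro k hk
    rw [Finsupp.notMem_support_iff.1 hk, star_zero, zero_mul]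

lemma symbol_sub_mulVec_add (u : Filt d ℂ) (j n : Zd d) (ζ : Rd d) :
    symbol (sub M hM u (M *ᵥ j + n)) ζ = chi (-latt j) ζ * symbol (sub M hM u n) ζ := by
  have h1 : sub M hM u (M *ᵥ j + n)
      = Finsupp.equivMapDomain (Equiv.subRight j) (sub M hM u n) := by
    ext k
    rw [Finsupp.equivMapDomain_apply]
    simp only [sub_apply, Equiv.subRight_symm_apply, Matrix.mulVec_add, add_assoc]
  rw [h1, Finsupp.equivMapDomain_eq_mapDomain, symbol_eq_sum, Finsupp.sum_mapDomain_index
    (by simp) (by intros; rw [smul_add]), symbol_eq_sum, Finsupp.sum, Finsupp.sum, Finset.mul_sum]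
  refine Finset.sum_congr rfl fun k _ => ?_
  rw [Equiv.subRight_apply, sub_eq_add_neg, latt_add, latt_neg, chi_add_left, smul_eq_mul,
    smul_eq_mul]
  ring

/-- The filter bank identity in the time domain. -/
lemma PolyphaseIdentity.timeDomain [Fintype (Cos M)] (h : PolyphaseIdentity hM a b ε)
    (n n' : Zd d) (p p' : Fin r) :
    ∑ ℓ, ∑' k, star (a (M *ᵥ k + n) ℓ p) * a (M *ᵥ k + n') ℓ p'
      + ∑ l, ε l * ∑' k, star (b (M *ᵥ k + n) l p) * b (M *ᵥ k + n') l p'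
      = if n = n' ∧ p = p' then ((Fintype.card (Cos M) : ℂ))⁻¹ else 0 := by
  classical
  obtain ⟨T, hT⟩ := exists_constantTerm d
  obtain ⟨j, hj⟩ := exists_eq_rep_add (M := M) n
  obtain ⟨j', hj'⟩ := exists_eq_rep_add (M := M) n'
  set g : Cos M := Submodule.Quotient.mk n
  set g' : Cos M := Submodule.Quotient.mk n'
  have hpar : ∀ u w : Filt d ℂ, ∑' k, star (u (M *ᵥ k + n)) * w (M *ᵥ k + n')
      = T (fun ζ => chi (latt (j - j')) ζ * (star (symbol (sub M hM u (rep g)) ζ) *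
        symbol (sub M hM w (rep g')) ζ)) := by
    intro u w
    have h1 := constantTerm_star_mul hT (sub M hM u n) (sub M hM w n')
    simp only [sub_apply] at h1
    rw [← h1]
    congr 1
    ext ζ
    conv_lhs => rw [hj, hj', symbol_sub_mulVec_add, symbol_sub_mulVec_add]
    rw [star_mul, star_chi, neg_neg, sub_eq_add_neg, latt_add, chi_add_left, latt_neg]
    ring
  have ha : ∀ ℓ, ∑' k, star (a (M *ᵥ k + n) ℓ p) * a (M *ᵥ k + n') ℓ p' = _ := fun ℓ =>
    hpar (entry a ℓ p) (entry a ℓ p')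
  have hb : ∀ l, ∑' k, star (b (M *ᵥ k + n) l p) * b (M *ᵥ k + n') l p' = _ := fun l =>
    hpar (entry b l p) (entry b l p')
  simp only [ha, hb, ← smul_eq_mul (ε _), ← map_smul, ← map_sum, ← map_add]
  have hfun : (∑ ℓ, (fun ζ => chi (latt (j - j')) ζ *
        (star (symbol (sub M hM (entry a ℓ p) (rep g)) ζ) *
          symbol (sub M hM (entry a ℓ p') (rep g')) ζ))
      + ∑ l, ε l • (fun ζ => chi (latt (j - j')) ζ *
        (star (symbol (sub M hM (entry b l p) (rep g)) ζ) *
          symbol (sub M hM (entry b l p') (rep g')) ζ)) : Rd d → ℂ)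
      = (if (g, p) = (g', p') then ((Fintype.card (Cos M) : ℂ))⁻¹ else 0) •
        chi (latt (j - j')) := by
    ext ζ
    have h2 := h (g, p) (g', p') ζ
    simp only [Pi.add_apply, Finset.sum_apply, Pi.smul_apply, smul_eq_mul]
    rw [← h2, add_mul, Finset.sum_mul, Finset.sum_mul]
    congr 1
    · refine Finset.sum_congr rfl fun l _ => by ring
    · refine Finset.sum_congr rfl fun l _ => by ring
  rw [hfun, map_smul, hT, smul_eq_mul]
  have hiff : n = n' ↔ g = g' ∧ j - j' = 0 := by
    constructor
    · intro hn
      have hgg : g = g' := by simp only [g, g', hn]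
      refine ⟨hgg, ?_⟩
      rw [hj, hj', hgg] at hn
      rw [sub_eq_zero]
      exact mulVec_injective hM (add_right_cancel hn)
    · rintro ⟨h1, h2⟩
      rw [hj, hj', h1, sub_eq_zero.1 h2]
  simp only [Prod.mk.injEq, hiff]
  by_cases h1 : g = g' <;> by_cases h2 : p = p' <;> by_cases h3 : j - j' = 0 <;> simp [h1, h2, h3]

lemma summable_entry_corr (hM : M.det ≠ 0) {t : ℕ} (u : Filt d (Matrix (Fin t) (Fin r) ℂ))
    (ℓ : Fin t) (n n' : Zd d) (p p' : Fin r) :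
    Summable fun k => star (u (M *ᵥ k + n) ℓ p) * u (M *ᵥ k + n') ℓ p' :=
  summable_star_mul (sub M hM (entry u ℓ p) n) (sub M hM (entry u ℓ p') n')

lemma tsum_normSq_analysis (hM : M.det ≠ 0) {t : ℕ} (u : Filt d (Matrix (Fin t) (Fin r) ℂ))
    (ℓ : Fin t) (F : Finset (Zd d)) (c : Zd d → Fin r → ℂ) :
    ((∑' k, ‖∑ n ∈ F, ∑ p, star (u (M *ᵥ k + n) ℓ p) * c n p‖ ^ 2 : ℝ) : ℂ)
      = ∑ n ∈ F, ∑ p, ∑ n' ∈ F, ∑ p', (c n p * star (c n' p')) *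
        ∑' k, star (u (M *ᵥ k + n) ℓ p) * u (M *ᵥ k + n') ℓ p' := by
  have hs : ∀ n p n' p', Summable fun k => (c n p * star (c n' p')) *
      (star (u (M *ᵥ k + n) ℓ p) * u (M *ᵥ k + n') ℓ p') := fun n p n' p' =>
    (summable_entry_corr hM u ℓ n n' p p').mul_left _
  simp only [← tsum_mul_left]
  rw [Complex.ofReal_tsum]
  have hk : ∀ k, ((‖∑ n ∈ F, ∑ p, star (u (M *ᵥ k + n) ℓ p) * c n p‖ ^ 2 : ℝ) : ℂ)
      = ∑ n ∈ F, ∑ p, ∑ n' ∈ F, ∑ p', (c n p * star (c n' p')) *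
        (star (u (M *ᵥ k + n) ℓ p) * u (M *ᵥ k + n') ℓ p') := by
    intro k
    rw [Complex.ofReal_pow, ← Complex.mul_conj', ← Complex.star_def, Finset.sum_mul]
    refine Finset.sum_congr rfl fun n _ => ?_
    rw [Finset.sum_mul]
    refine Finset.sum_congr rfl fun p _ => ?_
    rw [star_sum, Finset.mul_sum]
    refine Finset.sum_congr rfl fun n' _ => ?_
    rw [star_sum, Finset.mul_sum]
    refine Finset.sum_congr rfl fun p' _ => ?_
    rw [star_mul, star_star]
    ring
  simp only [hk]
  rw [Summable.tsum_finsetSum]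
  · refine Finset.sum_congr rfl fun n _ => ?_
    rw [Summable.tsum_finsetSum]
    · refine Finset.sum_congr rfl fun p _ => ?_
      rw [Summable.tsum_finsetSum]
      · refine Finset.sum_congr rfl fun n' _ => ?_
        rw [Summable.tsum_finsetSum]
        exact fun p' _ => hs n p n' p'
      · exact fun n' _ => summable_sum fun p' _ => hs n p n' p'
    · exact fun p _ => summable_sum fun n' _ => summable_sum fun p' _ => hs n p n' p'
  · exact fun n _ => summable_sum fun p _ => summable_sum fun n' _ => summable_sum fun p' _ =>
      hs n p n' p'

/-- The two-level energy identity for finitely supported coefficient sequences. -/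
lemma PolyphaseIdentity.energy [Fintype (Cos M)] (h : PolyphaseIdentity hM a b ε)
    (F : Finset (Zd d)) (c : Zd d → Fin r → ℂ) :
    ∑ ℓ, ((∑' k, ‖∑ n ∈ F, ∑ p, star (a (M *ᵥ k + n) ℓ p) * c n p‖ ^ 2 : ℝ) : ℂ)
      + ∑ l, ε l * ((∑' k, ‖∑ n ∈ F, ∑ p, star (b (M *ᵥ k + n) l p) * c n p‖ ^ 2 : ℝ) : ℂ)
      = ((Fintype.card (Cos M) : ℂ))⁻¹ * ((∑ n ∈ F, ∑ p, ‖c n p‖ ^ 2 : ℝ) : ℂ) := by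
  classical
  simp only [tsum_normSq_analysis hM]
  simp only [Finset.mul_sum]
  rw [Finset.sum_comm, Finset.sum_comm (s := (Finset.univ : Finset (Fin s))),
    ← Finset.sum_add_distrib, Complex.ofReal_sum, Finset.mul_sum]
  refine Finset.sum_congr rfl fun n hn => ?_
  rw [Finset.sum_comm, Finset.sum_comm (s := (Finset.univ : Finset (Fin s))),
    ← Finset.sum_add_distrib, Complex.ofReal_sum, Finset.mul_sum]
  refine Finset.sum_congr rfl fun p _ => ?_
  rw [Finset.sum_comm, Finset.sum_comm (s := (Finset.univ : Finset (Fin s))),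
    ← Finset.sum_add_distrib]
  have hinner : ∀ n', (∑ ℓ, ∑ p', (c n p * star (c n' p')) *
        ∑' k, star (a (M *ᵥ k + n) ℓ p) * a (M *ᵥ k + n') ℓ p')
      + ∑ l, ∑ p', ε l * ((c n p * star (c n' p')) *
        ∑' k, star (b (M *ᵥ k + n) l p) * b (M *ᵥ k + n') l p')
      = ∑ p', (c n p * star (c n' p')) *
        if n = n' ∧ p = p' then ((Fintype.card (Cos M) : ℂ))⁻¹ else 0 := by
    intro n'
    rw [Finset.sum_comm, Finset.sum_comm (s := (Finset.univ : Finset (Fin s))),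
      ← Finset.sum_add_distrib]
    refine Finset.sum_congr rfl fun p' _ => ?_
    rw [← h.timeDomain n n' p p', mul_add, Finset.mul_sum, Finset.mul_sum]
    congr 1
    refine Finset.sum_congr rfl fun l _ => by ring
  simp only [hinner]
  rw [Finset.sum_eq_single n, Finset.sum_eq_single p]
  · rw [if_pos ⟨rfl, rfl⟩, Complex.ofReal_pow, ← Complex.mul_conj', ← Complex.star_def]
    ring
  · intro p' _ hne
    rw [if_neg (fun h => hne h.2.symm), mul_zero]
  · simp
  · intro n' _ hne
    refine Finset.sum_eq_zero fun p' _ => ?_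
    rw [if_neg (fun h => hne h.1.symm), mul_zero]
  · exact fun h => absurd hn h

end TimeDomain

/-! ### Bessel families in Hilbert spaces -/

section Bessel

variable {H : Type*} [NormedAddCommGroup H] [InnerProductSpace ℂ H] {ι : Type*}

/-- The family `e` is a Bessel family with bound `B`. -/
def IsBessel (e : ι → H) (B : ℝ) : Prop :=
  ∀ (f : H) (F : Finset ι), ∑ i ∈ F, ‖inner ℂ (e i) f‖ ^ 2 ≤ B * ‖f‖ ^ 2

variable {e : ι → H} {B : ℝ}

lemma IsBessel.summable (h : IsBessel e B) (f : H) : Summable fun i => ‖inner ℂ (e i) f‖ ^ 2 :=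
  summable_of_sum_le (fun _ => by positivity) (h f)

lemma IsBessel.tsum_le (h : IsBessel e B) (f : H) :
    ∑' i, ‖inner ℂ (e i) f‖ ^ 2 ≤ B * ‖f‖ ^ 2 :=
  (h.summable f).tsum_le_of_sum_le (h f)

lemma IsBessel.memℓp (h : IsBessel e B) (f : H) :
    Memℓp (fun i => (inner ℂ (e i) f : ℂ)) 2 := by
  rw [memℓp_gen_iff (by norm_num)]
  simpa using h.summable f

/-- The analysis operator `f ↦ (⟨e_i, f⟩)_i` of a Bessel family. -/
def IsBessel.analysis (h : IsBessel e B) : H →L[ℂ] lp (fun _ : ι => ℂ) 2 :=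
  LinearMap.mkContinuous
    { toFun := fun f => ⟨fun i => inner ℂ (e i) f, h.memℓp f⟩
      map_add' := fun f g => by ext i; exact inner_add_right _ _ _
      map_smul' := fun c f => by ext i; exact inner_smul_right _ _ _ }
    (Real.sqrt B) (by
      intro f
      have h1 : ‖(⟨fun i => inner ℂ (e i) f, h.memℓp f⟩ : lp (fun _ : ι => ℂ) 2)‖ ^ 2
          ≤ B * ‖f‖ ^ 2 := by
        have := lp.norm_rpow_eq_tsum (p := 2) (by norm_num)
          (⟨fun i => inner ℂ (e i) f, h.memℓp f⟩ : lp (fun _ : ι => ℂ) 2)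
        simp only [ENNReal.toReal_ofNat, Real.rpow_two] at this
        rw [this]
        exact h.tsum_le f
      rcases eq_or_ne f 0 with rfl | hf
      · rw [map_zero, norm_zero, norm_zero, mul_zero]
      · have hB : 0 ≤ B := by
          have h2 : 0 ≤ B * ‖f‖ ^ 2 := (by positivity : (0 : ℝ) ≤ _).trans h1
          exact nonneg_of_mul_nonneg_left h2 (by positivity)
        refine abs_le_of_sq_le_sq' ?_ (by positivity) |>.2
        rwa [mul_pow, Real.sq_sqrt hB])

lemma IsBessel.analysis_apply (h : IsBessel e B) (f : H) (i : ι) :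
    h.analysis f i = inner ℂ (e i) f := rfl

lemma IsBessel.norm_analysis_sq (h : IsBessel e B) (f : H) :
    ‖h.analysis f‖ ^ 2 = ∑' i, ‖inner ℂ (e i) f‖ ^ 2 := by
  have := lp.norm_rpow_eq_tsum (p := 2) (by norm_num) (h.analysis f)
  simp only [ENNReal.toReal_ofNat, Real.rpow_two] at this
  exact this

/-- The signed expansion in a Bessel family reproduces every vector as soon as the associated
signed quadratic form is the square of the norm on a dense set. -/
theorem IsBessel.hasSum_of_quadratic [CompleteSpace H] (h : IsBessel e B) {σ : ι → ℂ}
    (hσ : ∀ i, σ i = 1 ∨ σ i = -1) {S : Set H} (hS : Dense S)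
    (hq : ∀ f ∈ S, ∑' i, σ i * (‖inner ℂ (e i) f‖ ^ 2 : ℝ) = ((‖f‖ ^ 2 : ℝ) : ℂ)) (f : H) :
    HasSum (fun i => (σ i * inner ℂ (e i) f) • e i) f := by
  classical
  have hσn : ∀ i, ‖σ i‖ = 1 := fun i => by rcases hσ i with h | h <;> simp [h]
  have hσs : ∀ i, star (σ i) = σ i := fun i => by rcases hσ i with h | h <;> simp [h]
  have h' : IsBessel (fun i => σ i • e i) B := by
    intro f F
    simpa [inner_smul_left, hσn] using h f F
  -- the signed frame operator, with quadratic form `∑ σ_i |⟨e_i, f⟩|²`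
  set A : H →L[ℂ] H := (ContinuousLinearMap.adjoint h.analysis).comp h'.analysis with hA
  have hAq : ∀ f, inner ℂ (A f) f = ∑' i, σ i * (‖inner ℂ (e i) f‖ ^ 2 : ℝ) := by
    intro f
    rw [hA, ContinuousLinearMap.comp_apply, ContinuousLinearMap.adjoint_inner_left,
      lp.inner_eq_tsum]
    refine tsum_congr fun i => ?_
    rw [h.analysis_apply, h'.analysis_apply, inner_smul_left]
    change inner ℂ (star (σ i) * inner ℂ (e i) f) (inner ℂ (e i) f) = _
    rw [hσs, ← smul_eq_mul, inner_smul_left, inner_self_eq_norm_sq_to_K]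
    change star (σ i) * _ = _
    rw [hσs]
    push_cast
    rfl
  have hquad : ∀ f, inner ℂ (A f) f = ((‖f‖ ^ 2 : ℝ) : ℂ) := by
    intro f
    have hcl : IsClosed {f : H | inner ℂ (A f) f = ((‖f‖ ^ 2 : ℝ) : ℂ)} :=
      isClosed_eq (by fun_prop) (by fun_prop)
    have hsub : S ⊆ {f : H | inner ℂ (A f) f = ((‖f‖ ^ 2 : ℝ) : ℂ)} := fun f hf => by
      change inner ℂ (A f) f = _
      rw [hAq, hq f hf]
    exact hcl.closure_subset_iff.2 hsub (hS f)
  have hAid : (A : H →ₗ[ℂ] H) = LinearMap.id := by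
    refine (ext_inner_map _ _).1 fun f => ?_
    simp only [ContinuousLinearMap.coe_coe, LinearMap.id_apply]
    rw [hquad, inner_self_eq_norm_sq_to_K]
    push_cast
    rfl
  have hAf : A f = f := congrArg (fun T : H →ₗ[ℂ] H => T f) hAid
  have hsum := (lp.hasSum_single (p := 2) (by norm_num) (h'.analysis f)).mapL
    (ContinuousLinearMap.adjoint h.analysis)
  have hval : (ContinuousLinearMap.adjoint h.analysis) (h'.analysis f) = f := hAf
  rw [hval] at hsum
  convert! hsum using 2 with i
  refine ext_inner_right ℂ fun g => ?_
  rw [ContinuousLinearMap.adjoint_inner_left, lp.inner_single_left, inner_smul_left,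
    h.analysis_apply, h'.analysis_apply, inner_smul_left]
  change _ = inner ℂ (star (σ i) * inner ℂ (e i) f) (inner ℂ (e i) g)
  rw [hσs, RCLike.inner_apply]
  ring

end Bessel

/-! ### Geometric decay of convergent linear iterations -/

section Decay

/-- In finite dimensions, a linear recursion that tends to zero does so geometrically. -/
lemma exists_geometric_of_tendsto {V : Type*} [NormedAddCommGroup V] [NormedSpace ℂ V]
    [FiniteDimensional ℂ V] (T : V →ₗ[ℂ] V) (X : ℕ → V) (hX : ∀ n, X (n + 1) = T (X n))
    (h0 : Tendsto X atTop (𝓝 0)) :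
    ∃ C ρ : ℝ, 0 ≤ C ∧ 0 < ρ ∧ ρ < 1 ∧ ∀ n, ‖X n‖ ≤ C * ρ ^ n := by
  -- the stable subspace of `T`
  let W : Submodule ℂ V :=
    { carrier := {x | Tendsto (fun n : ℕ => (T ^ n) x) atTop (𝓝 0)}
      zero_mem' := by simp
      add_mem' := fun {x y} hx hy => by
        have := Tendsto.add hx hy
        simpa using this
      smul_mem' := fun c x hx => by
        have := Tendsto.const_smul hx c
        simpa using this }
  have hXW : ∀ n, X n = (T ^ n) (X 0) := by
    intro n
    induction n with
    | zero => simp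
    | succ n ih => rw [hX, ih, pow_succ']; rfl
  have hX0 : ∀ j, X j ∈ W := by
    intro j
    have h1 : Tendsto (fun n => X (n + j)) atTop (𝓝 0) := (tendsto_add_atTop_iff_nat j).2 h0
    refine h1.congr fun n => ?_
    rw [hXW (n + j), hXW j, pow_add]
    rfl
  let b := Module.finBasis ℂ W
  let L := fun i => (b.coord i).toContinuousLinearMap
  set Q : ℕ → ℝ := fun n => ∑ i, ‖L i‖ * ‖(T ^ n) (b i : V)‖ with hQ
  have hQ0 : Tendsto Q atTop (𝓝 0) := by
    have : Tendsto Q atTop (𝓝 (∑ i, ‖L i‖ * 0)) :=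
      tendsto_finsetSum _ fun i _ => by
        have h1 : Tendsto (fun n : ℕ => (T ^ n) (b i : V)) atTop (𝓝 0) := (b i).2
        have h2 := h1.norm
        rw [norm_zero] at h2
        exact h2.const_mul _
    simpa using this
  have hbound : ∀ (n : ℕ) (x : W), ‖(T ^ n) (x : V)‖ ≤ Q n * ‖x‖ := by
    intro n x
    have hx : (x : V) = ∑ i, L i x • (b i : V) := by
      have := congrArg (Subtype.val) (b.sum_repr x)
      refine this.symm.trans ?_
      rw [AddSubmonoidClass.coe_finsetSum]
      rfl
    conv_lhs => rw [hx, map_sum]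
    refine (norm_sum_le _ _).trans ?_
    rw [hQ, Finset.sum_mul]
    refine Finset.sum_le_sum fun i _ => ?_
    rw [map_smul, norm_smul]
    calc ‖L i x‖ * ‖(T ^ n) (b i : V)‖ ≤ (‖L i‖ * ‖x‖) * ‖(T ^ n) (b i : V)‖ := by
          gcongr; exact (L i).le_opNorm x
      _ = _ := by ring
  obtain ⟨N, hN0, hN⟩ : ∃ N, 0 < N ∧ ∀ j, ‖X (j + N)‖ ≤ 1 / 2 * ‖X j‖ := by
    have h2 : ∀ᶠ n in atTop, Q n < 1 / 2 := hQ0.eventually (gt_mem_nhds (by norm_num))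
    obtain ⟨N, hN, hN1⟩ := (h2.and (eventually_ge_atTop 1)).exists
    refine ⟨N, hN1, fun j => ?_⟩
    have h3 := hbound N ⟨X j, hX0 j⟩
    have h4 : X (j + N) = (T ^ N) (X j) := by
      rw [hXW (j + N), hXW j, add_comm, pow_add]; rfl
    rw [h4]
    exact h3.trans (mul_le_mul_of_nonneg_right hN.le (norm_nonneg _))
  set ρ : ℝ := (1 / 2 : ℝ) ^ (1 / (N : ℝ)) with hρ
  have hNr : (0 : ℝ) < N := by exact_mod_cast hN0
  have hρ0 : 0 < ρ := by positivity
  have hρ1 : ρ < 1 := Real.rpow_lt_one (by norm_num) (by norm_num) (by positivity)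
  have hρN : ρ ^ N = 1 / 2 := by
    rw [hρ, ← Real.rpow_natCast, ← Real.rpow_mul (by norm_num), one_div_mul_cancel hNr.ne',
      Real.rpow_one]
  set C : ℝ := ∑ j ∈ Finset.range N, ‖X j‖ / ρ ^ N with hC
  have hC0 : 0 ≤ C := Finset.sum_nonneg fun j _ => by positivity
  refine ⟨C, ρ, hC0, hρ0, hρ1, fun n => ?_⟩
  induction n using Nat.strong_induction_on with
  | _ n ih =>
    rcases lt_or_ge n N with hn | hn
    · have h1 : ‖X n‖ / ρ ^ N ≤ C :=
        Finset.single_le_sum (f := fun j => ‖X j‖ / ρ ^ N) (fun j _ => by positivity)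
          (Finset.mem_range.2 hn)
      rw [div_le_iff₀ (by positivity)] at h1
      refine h1.trans (mul_le_mul_of_nonneg_left ?_ hC0)
      exact pow_le_pow_of_le_one hρ0.le hρ1.le hn.le
    · obtain ⟨j, rfl⟩ := Nat.exists_eq_add_of_le' hn
      refine (hN j).trans ?_
      rw [pow_add, hρN]
      have := ih j (by omega)
      linarith

end Decay

/-! ### The Bessel property across scales -/

section MultiScale

/-- A Hilbert space with isometric shifts by `ℤ^d` and an isometric dilation intertwining the
shift by `k` with the shift by `M k`. -/
structure MultiScale {d : ℕ} (M : Matrix (Fin d) (Fin d) ℤ) (H : Type*) [NormedAddCommGroup H]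
    [InnerProductSpace ℂ H] where
  /-- the dilation -/
  U : H →ₗᵢ[ℂ] H
  /-- the shifts -/
  τ : Zd d → H →ₗᵢ[ℂ] H
  τ_add : ∀ k l x, τ (k + l) x = τ k (τ l x)
  τ_U : ∀ k x, τ k (U x) = U (τ (M *ᵥ k) x)

variable {d : ℕ} {M : Matrix (Fin d) (Fin d) ℤ} {H : Type*} [NormedAddCommGroup H]
  [InnerProductSpace ℂ H]

lemma IsBessel.map [CompleteSpace H] {ι : Type*} {e : ι → H} {B : ℝ} (h : IsBessel e B)
    (hB : 0 ≤ B) (V : H →ₗᵢ[ℂ] H) : IsBessel (fun i => V (e i)) B := by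
  intro f F
  have h1 : ∀ i, inner ℂ (V (e i)) f
      = inner ℂ (e i) (ContinuousLinearMap.adjoint V.toContinuousLinearMap f) := fun i => by
    rw [ContinuousLinearMap.adjoint_inner_right]; rfl
  simp only [h1]
  refine (h _ F).trans ?_
  have h2 : ‖ContinuousLinearMap.adjoint V.toContinuousLinearMap f‖ ≤ ‖f‖ := by
    refine (ContinuousLinearMap.le_opNorm _ _).trans ?_
    rw [LinearIsometryEquiv.norm_map]
    exact mul_le_of_le_one_left (norm_nonneg _) V.norm_toContinuousLinearMap_le
  gcongr

namespace MultiScale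

variable (S : MultiScale M H)

lemma τ_zero (x : H) : S.τ 0 x = x := by
  apply (S.τ 0).injective
  rw [← S.τ_add, add_zero]

lemma U_pow_succ (J : ℕ) (x : H) : (S.U ^ (J + 1)) x = (S.U ^ J) (S.U x) := by
  rw [pow_succ]; rfl

lemma U_pow_succ' (J : ℕ) (x : H) : (S.U ^ (J + 1)) x = S.U ((S.U ^ J) x) := by
  rw [pow_succ']; rfl

lemma τ_U_pow (J : ℕ) (k : Zd d) (x : H) :
    S.τ k ((S.U ^ J) x) = (S.U ^ J) (S.τ ((M ^ J) *ᵥ k) x) := by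
  induction J generalizing k with
  | zero => simp
  | succ J ih =>
    rw [U_pow_succ', S.τ_U, ih, U_pow_succ', Matrix.mulVec_mulVec, ← pow_succ]

lemma U_pow_τ (J : ℕ) (k l : Zd d) (x : H) :
    (S.U ^ J) (S.τ l x) = S.τ k ((S.U ^ J) (S.τ (l - (M ^ J) *ᵥ k) x)) := by
  rw [τ_U_pow, ← S.τ_add, add_sub_cancel]

variable [CompleteSpace H] {η : H} {B : ℝ}

/-- The analysis operator of the family `U^J τ_l η`, `l ∈ ℤ^d`. -/
def level (hB : 0 ≤ B) (hη : IsBessel (fun l => S.τ l η) B) (J : ℕ) :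
    H →L[ℂ] lp (fun _ : Zd d => ℂ) 2 :=
  (hη.map hB (S.U ^ J)).analysis

variable {S} {hB : 0 ≤ B} {hη : IsBessel (fun l => S.τ l η) B}

lemma level_apply (J : ℕ) (f : H) (l : Zd d) :
    S.level hB hη J f l = inner ℂ ((S.U ^ J) (S.τ l η)) f := rfl

lemma level_succ_U (J : ℕ) (f : H) : S.level hB hη (J + 1) (S.U f) = S.level hB hη J f := by
  ext l
  rw [level_apply, level_apply, U_pow_succ', LinearIsometry.inner_map_map]

lemma level_τ_apply (J : ℕ) (k : Zd d) (f : H) (l : Zd d) :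
    S.level hB hη J (S.τ k f) l = S.level hB hη J f (l - (M ^ J) *ᵥ k) := by
  rw [level_apply, level_apply, S.U_pow_τ J k, LinearIsometry.inner_map_map]

lemma inner_level_τ (J : ℕ) (k l : Zd d) (f g : H) :
    inner ℂ (S.level hB hη J (S.τ k f)) (S.level hB hη J (S.τ l g))
      = inner ℂ (S.level hB hη J f) (S.level hB hη J (S.τ (l - k) g)) := by
  rw [lp.inner_eq_tsum, lp.inner_eq_tsum, ← (Equiv.addRight ((M ^ J) *ᵥ k)).tsum_eq]
  refine tsum_congr fun n => ?_
  rw [level_τ_apply, level_τ_apply, level_τ_apply, Equiv.coe_addRight]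
  congr 2
  · rw [add_sub_cancel_right]
  · rw [Matrix.mulVec_sub, ← sub_add, sub_add_eq_add_sub]

lemma norm_level_τ (J : ℕ) (k : Zd d) (f : H) :
    ‖S.level hB hη J (S.τ k f)‖ = ‖S.level hB hη J f‖ := by
  have h := inner_level_τ (hB := hB) (hη := hη) J k k f f
  rw [sub_self, τ_zero] at h
  simp only [inner_self_eq_norm_sq_to_K] at h
  have h' : ‖S.level hB hη J (S.τ k f)‖ ^ 2 = ‖S.level hB hη J f‖ ^ 2 := by exact_mod_cast h
  exact (pow_left_inj₀ (norm_nonneg _) (norm_nonneg _) two_ne_zero).1 h'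

/-- If the level-`J` coefficients of a refinable vector `φ` with respect to `U^J τ_l η` tend to
zero, they do so geometrically: the finitely many correlations of these coefficients are iterates
of a fixed linear map, because `φ` is refinable. -/
lemma exists_geometric_level {r : ℕ} {φ : Fin r → H} {a : Filt d (Matrix (Fin r) (Fin r) ℂ)}
    {q : ℂ} (href : ∀ p, φ p = q • ∑ l ∈ a.support, ∑ p', a l p p' • S.U (S.τ l (φ p')))
    (K : Finset (Zd d)) (hK : ∀ J p p', ∀ k ∉ K,
      inner ℂ (S.level hB hη J (φ p)) (S.level hB hη J (S.τ k (φ p'))) = 0)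
    (h0 : ∀ p, Tendsto (fun J => ‖S.level hB hη J (φ p)‖) atTop (𝓝 0)) :
    ∃ C ρ : ℝ, 0 ≤ C ∧ 0 < ρ ∧ ρ < 1 ∧ ∀ J p, ‖S.level hB hη J (φ p)‖ ≤ C * ρ ^ J := by
  classical
  let X : ℕ → Zd d → Fin r → Fin r → ℂ := fun J k p p' =>
    inner ℂ (S.level hB hη J (φ p)) (S.level hB hη J (S.τ k (φ p')))
  -- the linear recursion for the correlations
  let R : (Zd d → Fin r → Fin r → ℂ) → Zd d → Fin r → Fin r → ℂ := fun Y k p p' =>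
    ∑ l ∈ a.support, ∑ t, ∑ l' ∈ a.support, ∑ t', (star (q * a l p t) * (q * a l' p' t')) *
      Y (M *ᵥ k + l' - l) t t'
  have hφ : ∀ J k p, S.level hB hη (J + 1) (S.τ k (φ p))
      = ∑ l ∈ a.support, ∑ t, (q * a l p t) • S.level hB hη J (S.τ (M *ᵥ k + l) (φ t)) := by
    intro J k p
    conv_lhs => rw [href p]
    simp only [map_smul, map_sum, S.τ_U, level_succ_U, ← S.τ_add, Finset.smul_sum, smul_smul]
  have hrec : ∀ J, X (J + 1) = R (X J) := by
    intro J
    ext k p p'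
    have h1 := hφ J 0 p
    rw [τ_zero, Matrix.mulVec_zero] at h1
    simp only [zero_add] at h1
    simp only [X, R]
    rw [h1, hφ J k p', sum_inner]
    refine Finset.sum_congr rfl fun l _ => ?_
    rw [sum_inner]
    refine Finset.sum_congr rfl fun t _ => ?_
    rw [inner_sum]
    refine Finset.sum_congr rfl fun l' _ => ?_
    rw [inner_sum]
    refine Finset.sum_congr rfl fun t' _ => ?_
    rw [inner_smul_left, inner_smul_right, inner_level_τ, ← mul_assoc]
    rfl
  -- restriction to the finite set supporting all correlations
  let ext : (K → Fin r → Fin r → ℂ) →ₗ[ℂ] (Zd d → Fin r → Fin r → ℂ) :=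
    { toFun := fun Y k => if h : k ∈ K then Y ⟨k, h⟩ else 0
      map_add' := fun Y Z => by ext k; by_cases h : k ∈ K <;> simp [h]
      map_smul' := fun c Y => by ext k; by_cases h : k ∈ K <;> simp [h] }
  let T : (K → Fin r → Fin r → ℂ) →ₗ[ℂ] (K → Fin r → Fin r → ℂ) :=
    { toFun := fun Y k => R (ext Y) k
      map_add' := fun Y Z => by
        ext k p p'
        simp only [R, map_add, Pi.add_apply, mul_add, Finset.sum_add_distrib]
      map_smul' := fun c Y => by
        ext k p p'
        simp only [R, map_smul, Pi.smul_apply, smul_eq_mul, RingHom.id_apply, Finset.mul_sum]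
        refine Finset.sum_congr rfl fun l _ => Finset.sum_congr rfl fun t _ =>
          Finset.sum_congr rfl fun l' _ => Finset.sum_congr rfl fun t' _ => by ring }
  let XK : ℕ → K → Fin r → Fin r → ℂ := fun J k => X J k
  have hext : ∀ J, ext (XK J) = X J := by
    intro J
    ext k p p'
    by_cases h : k ∈ K
    · simp [ext, XK, h]
    · simp [ext, h, X, hK J p p' k h]
  have hXK : ∀ J, XK (J + 1) = T (XK J) := by
    intro J
    ext k p p'
    change X (J + 1) k p p' = R (ext (XK J)) k p p'
    rw [hext, hrec]
  have hXb : ∀ J k p p', ‖X J k p p'‖ ≤ ‖S.level hB hη J (φ p)‖ * ‖S.level hB hη J (φ p')‖ := by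
    intro J k p p'
    refine (norm_inner_le_norm _ _).trans_eq ?_
    rw [norm_level_τ]
  have hX0 : Tendsto XK atTop (𝓝 0) := by
    refine tendsto_pi_nhds.2 fun k => tendsto_pi_nhds.2 fun p => tendsto_pi_nhds.2 fun p' => ?_
    have h1 := (h0 p).mul (h0 p')
    rw [mul_zero] at h1
    exact squeeze_zero_norm (fun J => hXb J k p p') h1
  obtain ⟨C, ρ, hC, hρ0, hρ1, hgeo⟩ := exists_geometric_of_tendsto T XK hXK hX0
  refine ⟨Real.sqrt C, Real.sqrt ρ, Real.sqrt_nonneg _, Real.sqrt_pos.2 hρ0, ?_, fun J p => ?_⟩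
  · rw [Real.sqrt_lt' one_pos]; simpa using hρ1
  · refine abs_le_of_sq_le_sq' ?_ (by positivity) |>.2
    rw [mul_pow, ← pow_mul, mul_comm J 2, pow_mul, Real.sq_sqrt hC, Real.sq_sqrt hρ0.le]
    have h1 : ‖S.level hB hη J (φ p)‖ ^ 2 = ‖X J 0 p p‖ := by
      simp only [X, τ_zero, inner_self_eq_norm_sq_to_K]
      simp
    rw [h1]
    by_cases h : (0 : Zd d) ∈ K
    · refine le_trans ?_ (hgeo J)
      have h2 := norm_le_pi_norm (XK J) ⟨0, h⟩
      have h3 := norm_le_pi_norm (XK J ⟨0, h⟩) p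
      have h4 := norm_le_pi_norm (XK J ⟨0, h⟩ p) p
      exact h4.trans (h3.trans h2)
    · simp only [X, hK J p p 0 h, norm_zero]; positivity

end MultiScale

/-- Schur's test for a kernel that decays geometrically off the diagonal. -/
lemma sum_geometric_le {C ρ : ℝ} (hC : 0 ≤ C) (h0 : 0 ≤ ρ) (h1 : ρ < 1) (s : ℕ → ℝ) (n : ℕ) :
    ∑ i ∈ Finset.range n, ∑ j ∈ Finset.range n, C * ρ ^ ((i - j) + (j - i)) * (s i * s j)
      ≤ C * (2 / (1 - ρ)) * ∑ i ∈ Finset.range n, s i ^ 2 := by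
  have h1' : 0 < 1 - ρ := by linarith
  have hrow : ∀ i, ∑ j ∈ Finset.range n, ρ ^ ((i - j) + (j - i)) ≤ 2 / (1 - ρ) := by
    intro i
    have hgeom : ∀ k, ∑ j ∈ Finset.range k, ρ ^ j ≤ 1 / (1 - ρ) := fun k => by
      rw [one_div, ← tsum_geometric_of_lt_one h0 h1]
      exact (summable_geometric_of_lt_one h0 h1).sum_le_tsum _ fun j _ => by positivity
    have hA : ∑ j ∈ Finset.range (i + 1), ρ ^ (i - j) ≤ 1 / (1 - ρ) := by
      have := Finset.sum_range_reflect (fun j => ρ ^ j) (i + 1)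
      simp only [add_tsub_cancel_right] at this
      rw [this]; exact hgeom _
    have hB : ∑ j ∈ Finset.range n, ρ ^ j ≤ 1 / (1 - ρ) := hgeom n
    calc ∑ j ∈ Finset.range n, ρ ^ ((i - j) + (j - i))
        ≤ ∑ j ∈ Finset.range (i + 1 + n), ρ ^ ((i - j) + (j - i)) :=
          Finset.sum_le_sum_of_subset_of_nonneg
            (Finset.range_subset_range.2 (by omega)) fun _ _ _ => by positivity
      _ = ∑ j ∈ Finset.range (i + 1), ρ ^ (i - j) + ∑ j ∈ Finset.range n, ρ ^ (j + 1) := by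
          rw [Finset.sum_range_add]
          congr 1
          · refine Finset.sum_congr rfl fun j hj => ?_
            rw [Finset.mem_range] at hj
            congr 1; omega
          · refine Finset.sum_congr rfl fun j _ => ?_
            congr 1; omega
      _ ≤ 1 / (1 - ρ) + ∑ j ∈ Finset.range n, ρ ^ j := by
          refine add_le_add hA (Finset.sum_le_sum fun j _ => ?_)
          exact pow_le_pow_of_le_one h0 h1.le (Nat.le_succ j)
      _ ≤ 2 / (1 - ρ) := by
          rw [show (2 : ℝ) = 1 + 1 by norm_num, add_div]; linarith
  have hsym : ∀ i j, C * ρ ^ ((i - j) + (j - i)) * (s i * s j)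
      ≤ C * ρ ^ ((i - j) + (j - i)) * (s i ^ 2 / 2)
        + C * ρ ^ ((j - i) + (i - j)) * (s j ^ 2 / 2) := by
    intro i j
    rw [add_comm (j - i), ← mul_add]
    refine mul_le_mul_of_nonneg_left ?_ (by positivity)
    nlinarith [sq_nonneg (s i - s j)]
  have hhalf : ∑ i ∈ Finset.range n, ∑ j ∈ Finset.range n,
      C * ρ ^ ((i - j) + (j - i)) * (s i ^ 2 / 2)
      ≤ C * (1 / (1 - ρ)) * ∑ i ∈ Finset.range n, s i ^ 2 := by
    rw [Finset.mul_sum]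
    refine Finset.sum_le_sum fun i _ => ?_
    rw [← Finset.sum_mul, ← Finset.mul_sum]
    calc (C * ∑ j ∈ Finset.range n, ρ ^ ((i - j) + (j - i))) * (s i ^ 2 / 2)
        ≤ (C * (2 / (1 - ρ))) * (s i ^ 2 / 2) := by
          gcongr
          exact hrow i
      _ = C * (1 / (1 - ρ)) * s i ^ 2 := by ring
  calc _ ≤ ∑ i ∈ Finset.range n, ∑ j ∈ Finset.range n,
        (C * ρ ^ ((i - j) + (j - i)) * (s i ^ 2 / 2)
        + C * ρ ^ ((j - i) + (i - j)) * (s j ^ 2 / 2)) :=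
        Finset.sum_le_sum fun i _ => Finset.sum_le_sum fun j _ => hsym i j
    _ ≤ _ := by
        simp only [Finset.sum_add_distrib]
        rw [Finset.sum_comm (f := fun i j => C * ρ ^ ((j - i) + (i - j)) * (s j ^ 2 / 2))]
        refine (add_le_add hhalf hhalf).trans_eq ?_
        ring

/-- Synthesis bounds are Bessel bounds. -/
lemma IsBessel.of_synthesis {ι : Type*} {e : ι → H} {B : ℝ} (hB : 0 ≤ B)
    (h : ∀ (c : ι → ℂ) (F : Finset ι), ‖∑ i ∈ F, c i • e i‖ ^ 2 ≤ B * ∑ i ∈ F, ‖c i‖ ^ 2) :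
    IsBessel e B := by
  intro f F
  set s := ∑ i ∈ F, ‖inner ℂ (e i) f‖ ^ 2 with hs
  have hs0 : 0 ≤ s := Finset.sum_nonneg fun _ _ => by positivity
  have h1 : inner ℂ (∑ i ∈ F, inner ℂ (e i) f • e i) f = (s : ℂ) := by
    rw [sum_inner, hs]
    push_cast
    refine Finset.sum_congr rfl fun i _ => ?_
    rw [inner_smul_left, RCLike.conj_mul]
    rfl
  have h2 : s ≤ ‖∑ i ∈ F, inner ℂ (e i) f • e i‖ * ‖f‖ := by
    have := norm_inner_le_norm (𝕜 := ℂ) (∑ i ∈ F, inner ℂ (e i) f • e i) f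
    rwa [h1, Complex.norm_real, Real.norm_of_nonneg hs0] at this
  have h3 := h (fun i => inner ℂ (e i) f) F
  rcases hs0.eq_or_lt with h0 | h0
  · rw [← h0]; positivity
  · have h4 : s ^ 2 ≤ (B * s) * ‖f‖ ^ 2 := by
      calc s ^ 2 ≤ (‖∑ i ∈ F, inner ℂ (e i) f • e i‖ * ‖f‖) ^ 2 := by gcongr
        _ = ‖∑ i ∈ F, inner ℂ (e i) f • e i‖ ^ 2 * ‖f‖ ^ 2 := by ring
        _ ≤ _ := by gcongr
    nlinarith

/-- Schur's test for a kernel supported in a band. -/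
lemma sum_band_le (K F : Finset (Zd d)) (s : Zd d → ℝ) :
    ∑ k ∈ F, ∑ k' ∈ F, (if k' - k ∈ K then s k * s k' else 0)
      ≤ K.card * ∑ k ∈ F, s k ^ 2 := by
  classical
  have hrow : ∀ k, ∑ k' ∈ F, (if k' - k ∈ K then s k ^ 2 / 2 else 0) ≤ K.card * (s k ^ 2 / 2) := by
    intro k
    rw [← Finset.sum_filter, Finset.sum_const, nsmul_eq_mul]
    refine mul_le_mul_of_nonneg_right (Nat.cast_le.2 ?_) (by positivity)
    refine Finset.card_le_card_of_injOn (fun k' => k' - k) (fun k' hk' => ?_)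
      fun x _ y _ h => sub_left_injective h
    simpa using (Finset.mem_filter.1 hk').2
  have hcol : ∀ k', ∑ k ∈ F, (if k' - k ∈ K then s k' ^ 2 / 2 else 0)
      ≤ K.card * (s k' ^ 2 / 2) := by
    intro k'
    rw [← Finset.sum_filter, Finset.sum_const, nsmul_eq_mul]
    refine mul_le_mul_of_nonneg_right (Nat.cast_le.2 ?_) (by positivity)
    refine Finset.card_le_card_of_injOn (fun k => k' - k) (fun k hk => ?_)
      fun x _ y _ h => sub_right_injective h
    simpa using (Finset.mem_filter.1 hk).2
  calc _ ≤ ∑ k ∈ F, ∑ k' ∈ F, ((if k' - k ∈ K then s k ^ 2 / 2 else 0)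
        + (if k' - k ∈ K then s k' ^ 2 / 2 else 0)) := by
        refine Finset.sum_le_sum fun k _ => Finset.sum_le_sum fun k' _ => ?_
        split_ifs
        · nlinarith [sq_nonneg (s k - s k')]
        · simp
    _ = ∑ k ∈ F, ∑ k' ∈ F, (if k' - k ∈ K then s k ^ 2 / 2 else 0)
        + ∑ k' ∈ F, ∑ k ∈ F, (if k' - k ∈ K then s k' ^ 2 / 2 else 0) := by
        simp only [Finset.sum_add_distrib]
        congr 1
        exact Finset.sum_comm
    _ ≤ ∑ k ∈ F, K.card * (s k ^ 2 / 2) + ∑ k ∈ F, K.card * (s k ^ 2 / 2) :=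
        add_le_add (Finset.sum_le_sum fun k _ => hrow k) (Finset.sum_le_sum fun k _ => hcol k)
    _ = _ := by rw [← Finset.mul_sum, ← Finset.sum_div]; ring

/-- Vectors whose mutual inner products vanish off a band are almost orthogonal. -/
lemma norm_sum_sq_le_of_band {E : Type*} [NormedAddCommGroup E] [InnerProductSpace ℂ E]
    (K : Finset (Zd d)) {g : Zd d → E} {t : ℝ} (ht : 0 ≤ t) (hg : ∀ k, ‖g k‖ ≤ t)
    (hK : ∀ k k', k' - k ∉ K → (inner ℂ (g k) (g k') : ℂ) = 0) (F : Finset (Zd d))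
    (c : Zd d → ℂ) :
    ‖∑ k ∈ F, c k • g k‖ ^ 2 ≤ (K.card * ∑ k ∈ F, ‖c k‖ ^ 2) * t ^ 2 := by
  classical
  have h1 : ((‖∑ k ∈ F, c k • g k‖ ^ 2 : ℝ) : ℂ)
      = ∑ k ∈ F, ∑ k' ∈ F, star (c k) * (c k' * inner ℂ (g k) (g k')) := by
    have h2 := inner_self_eq_norm_sq_to_K (𝕜 := ℂ) (∑ k ∈ F, c k • g k)
    push_cast
    refine h2.symm.trans ?_
    rw [sum_inner]
    refine Finset.sum_congr rfl fun k _ => ?_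
    rw [inner_sum]
    refine Finset.sum_congr rfl fun k' _ => ?_
    rw [inner_smul_left, inner_smul_right]
    rfl
  have h3 : ‖∑ k ∈ F, c k • g k‖ ^ 2
      ≤ ∑ k ∈ F, ∑ k' ∈ F, (if k' - k ∈ K then ‖c k‖ * ‖c k'‖ else 0) * t ^ 2 := by
    have h4 := congrArg norm h1
    rw [Complex.norm_real, Real.norm_of_nonneg (by positivity)] at h4
    rw [h4]
    refine norm_sum_le_of_le _ fun k _ => norm_sum_le_of_le _ fun k' _ => ?_
    split_ifs with h
    · rw [norm_mul, norm_mul, norm_star, mul_assoc, sq]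
      gcongr
      exact (norm_inner_le_norm _ _).trans (mul_le_mul (hg k) (hg k') (norm_nonneg _) ht)
    · rw [hK _ _ h]; simp
  refine h3.trans ?_
  simp only [← Finset.sum_mul]
  gcongr
  exact sum_band_le K F fun k => ‖c k‖

namespace MultiScale

variable [CompleteSpace H] {S : MultiScale M H} {η : H} {B : ℝ} {hB : 0 ≤ B}
  {hη : IsBessel (fun l => S.τ l η) B}

omit [CompleteSpace H] in
/-- The shifts of `η` form a Bessel family when only finitely many of them overlap with `η`. -/
lemma isBessel_τ (S : MultiScale M H) (K : Finset (Zd d))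
    (hK : ∀ k ∉ K, inner ℂ η (S.τ k η) = 0) :
    IsBessel (fun l => S.τ l η) (K.card * ‖η‖ ^ 2) := by
  refine IsBessel.of_synthesis (by positivity) fun c F => ?_
  refine (norm_sum_sq_le_of_band K (norm_nonneg η) (fun k => ((S.τ k).norm_map η).le)
    (fun k k' h => ?_) F c).trans_eq (by ring)
  rw [show k' = k + (k' - k) by abel, S.τ_add, LinearIsometry.inner_map_map]
  exact hK _ h

lemma norm_level_sum_sq_le (K : Finset (Zd d)) (J : ℕ) (hK : ∀ k ∉ K,
      inner ℂ (S.level hB hη J η) (S.level hB hη J (S.τ k η)) = 0)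
    (F : Finset (Zd d)) (c : Zd d → ℂ) :
    ‖S.level hB hη J (∑ k ∈ F, c k • S.τ k η)‖ ^ 2
      ≤ (K.card * ∑ k ∈ F, ‖c k‖ ^ 2) * ‖S.level hB hη J η‖ ^ 2 := by
  simp only [map_sum, map_smul]
  refine norm_sum_sq_le_of_band K (norm_nonneg _) (fun k => (norm_level_τ J k η).le)
    (fun k k' h => ?_) F c
  rw [inner_level_τ]
  exact hK _ h

lemma norm_inner_U_pow_le (f : H) (J : ℕ) (F : Finset (Zd d)) (c : Zd d → ℂ) :
    ‖inner ℂ ((S.U ^ J) (∑ k ∈ F, c k • S.τ k η)) f‖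
      ≤ Real.sqrt (∑ k ∈ F, ‖c k‖ ^ 2) * ‖S.level hB hη J f‖ := by
  have h1 : inner ℂ ((S.U ^ J) (∑ k ∈ F, c k • S.τ k η)) f
      = ∑ k ∈ F, star (c k) * S.level hB hη J f k := by
    rw [map_sum, sum_inner]
    refine Finset.sum_congr rfl fun k _ => ?_
    rw [map_smul, inner_smul_left, level_apply]
    rfl
  have h2 : ‖S.level hB hη J f‖ ^ 2 = ∑' k, ‖S.level hB hη J f k‖ ^ 2 :=
    (hη.map hB (S.U ^ J)).norm_analysis_sq f
  have h3 : ∑ k ∈ F, ‖S.level hB hη J f k‖ ^ 2 ≤ ‖S.level hB hη J f‖ ^ 2 := by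
    rw [h2]
    exact ((hη.map hB (S.U ^ J)).summable f).sum_le_tsum F fun _ _ => by positivity
  rw [h1]
  calc ‖∑ k ∈ F, star (c k) * S.level hB hη J f k‖
      ≤ ∑ k ∈ F, ‖c k‖ * ‖S.level hB hη J f k‖ :=
        norm_sum_le_of_le _ fun k _ => by rw [norm_mul, norm_star]
    _ ≤ Real.sqrt (∑ k ∈ F, ‖c k‖ ^ 2) * Real.sqrt (∑ k ∈ F, ‖S.level hB hη J f k‖ ^ 2) :=
        Real.sum_mul_le_sqrt_mul_sqrt _ _ _
    _ ≤ _ := by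
        gcongr
        exact Real.sqrt_le_iff.2 ⟨norm_nonneg _, h3⟩

/-- The family `U^j τ_k η` is Bessel when the coefficients of `η` against the levels `j` decay
geometrically: different levels are then almost orthogonal. -/
theorem isBessel_of_geometric (K : Finset (Zd d)) (hK : ∀ J, ∀ k ∉ K,
      inner ℂ (S.level hB hη J η) (S.level hB hη J (S.τ k η)) = 0)
    {C ρ : ℝ} (hC : 0 ≤ C) (hρ0 : 0 ≤ ρ) (hρ1 : ρ < 1)
    (hgeo : ∀ J, ‖S.level hB hη J η‖ ≤ C * ρ ^ J) :
    ∃ B', 0 ≤ B' ∧ IsBessel (fun i : ℕ × Zd d => (S.U ^ i.1) (S.τ i.2 η)) B' := by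
  classical
  set C' := C * Real.sqrt K.card with hC'
  have hC'0 : 0 ≤ C' := by positivity
  have hB' : 0 ≤ C' * (2 / (1 - ρ)) := mul_nonneg hC'0 (div_nonneg two_pos.le (by linarith))
  refine ⟨C' * (2 / (1 - ρ)), hB', IsBessel.of_synthesis hB' fun c' F' => ?_⟩
  -- pass to coefficients supported on a rectangle
  obtain ⟨n, F, hF⟩ : ∃ (n : ℕ) (F : Finset (Zd d)), F' ⊆ Finset.range n ×ˢ F := by
    obtain ⟨n, hn⟩ := (F'.image Prod.fst).exists_nat_subset_range
    refine ⟨n, F'.image Prod.snd, fun i hi => Finset.mem_product.2 ⟨hn ?_, ?_⟩⟩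
    · exact Finset.mem_image_of_mem _ hi
    · exact Finset.mem_image_of_mem _ hi
  set c : ℕ → Zd d → ℂ := fun j k => if (j, k) ∈ F' then c' (j, k) else 0 with hc
  let x : ℕ → H := fun j => ∑ k ∈ F, c j k • S.τ k η
  let s : ℕ → ℝ := fun j => Real.sqrt (∑ k ∈ F, ‖c j k‖ ^ 2)
  have hsum : ∑ i ∈ F', c' i • (S.U ^ i.1) (S.τ i.2 η)
      = ∑ j ∈ Finset.range n, (S.U ^ j) (x j) := by
    rw [Finset.sum_subset_zero_on_sdiff (g := fun i => (if i ∈ F' then c' i else 0) •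
      (S.U ^ i.1) (S.τ i.2 η)) hF, Finset.sum_product]
    · refine Finset.sum_congr rfl fun j _ => ?_
      rw [map_sum]
      refine Finset.sum_congr rfl fun k _ => ?_
      rw [map_smul]
    · intro i hi
      rw [if_neg (Finset.mem_sdiff.1 hi).2, zero_smul]
    · intro i hi
      rw [if_pos hi]
  have hs2 : ∑ i ∈ F', ‖c' i‖ ^ 2 = ∑ j ∈ Finset.range n, s j ^ 2 := by
    rw [Finset.sum_subset_zero_on_sdiff (g := fun i => ‖if i ∈ F' then c' i else 0‖ ^ 2) hF,
      Finset.sum_product]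
    · refine Finset.sum_congr rfl fun j _ => ?_
      rw [Real.sq_sqrt (Finset.sum_nonneg fun _ _ => by positivity)]
    · intro i hi
      rw [if_neg (Finset.mem_sdiff.1 hi).2]; simp
    · intro i hi
      rw [if_pos hi]
  have hle : ∀ i t, ‖inner ℂ ((S.U ^ (i + t)) (x (i + t))) ((S.U ^ i) (x i))‖
      ≤ C' * ρ ^ t * (s i * s (i + t)) := by
    intro i t
    rw [pow_add, LinearIsometry.coe_mul, Function.comp_apply, LinearIsometry.inner_map_map]
    refine (norm_inner_U_pow_le (hB := hB) (hη := hη) (x i) t F (c (i + t))).trans ?_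
    have h1 : ‖S.level hB hη t (x i)‖ ≤ Real.sqrt K.card * s i * (C * ρ ^ t) := by
      refine abs_le_of_sq_le_sq' ?_ (by positivity) |>.2
      refine (norm_level_sum_sq_le K t (hK t) F (c i)).trans ?_
      rw [mul_pow, mul_pow, Real.sq_sqrt (Nat.cast_nonneg _),
        Real.sq_sqrt (Finset.sum_nonneg fun _ _ => by positivity)]
      gcongr
      exact hgeo t
    calc _ ≤ s (i + t) * (Real.sqrt K.card * s i * (C * ρ ^ t)) := by
          gcongr
      _ = _ := by rw [hC']; ring
  have hle' : ∀ i j, ‖inner ℂ ((S.U ^ i) (x i)) ((S.U ^ j) (x j))‖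
      ≤ C' * ρ ^ ((i - j) + (j - i)) * (s i * s j) := by
    intro i j
    rcases le_total i j with h | h
    · obtain ⟨t, rfl⟩ := Nat.exists_eq_add_of_le h
      rw [norm_inner_symm, show i - (i + t) + (i + t - i) = t by omega]
      exact hle i t
    · obtain ⟨t, rfl⟩ := Nat.exists_eq_add_of_le h
      rw [show j + t - j + (j - (j + t)) = t by omega, mul_comm (s _)]
      exact hle j t
  rw [hsum, hs2]
  refine le_trans ?_ (sum_geometric_le hC'0 hρ0 hρ1 s n)
  have h2 := inner_self_eq_norm_sq_to_K (𝕜 := ℂ) (∑ j ∈ Finset.range n, (S.U ^ j) (x j))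
  have h3 := congrArg norm h2
  have h4 : ‖∑ j ∈ Finset.range n, (S.U ^ j) (x j)‖ ^ 2
      = ‖(inner ℂ (∑ j ∈ Finset.range n, (S.U ^ j) (x j))
        (∑ j ∈ Finset.range n, (S.U ^ j) (x j)) : ℂ)‖ := by
    rw [h3]; simp
  rw [h4, sum_inner]
  refine norm_sum_le_of_le _ fun i _ => ?_
  rw [inner_sum]
  exact norm_sum_le_of_le _ fun j _ => hle' i j

/-- A finite combination of the `U τ_l φ_p`, with `φ` refinable, generates a Bessel family across
all scales as soon as the coefficients of `φ` against its levels tend to zero. -/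
theorem isBessel_of_refinable {r : ℕ} {φ : Fin r → H} {a : Filt d (Matrix (Fin r) (Fin r) ℂ)}
    {q : ℂ} (href : ∀ p, φ p = q • ∑ l ∈ a.support, ∑ p', a l p p' • S.U (S.τ l (φ p')))
    {T : Finset (Zd d)} {c : Zd d → Fin r → ℂ} {q' : ℂ}
    (hηφ : η = q' • ∑ l ∈ T, ∑ p, c l p • S.U (S.τ l (φ p)))
    (K : Finset (Zd d)) (hK : ∀ J p p', ∀ k ∉ K,
      inner ℂ (S.level hB hη J (φ p)) (S.level hB hη J (S.τ k (φ p'))) = 0)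
    (K' : Finset (Zd d)) (hK' : ∀ J, ∀ k ∉ K',
      inner ℂ (S.level hB hη J η) (S.level hB hη J (S.τ k η)) = 0)
    (h0 : ∀ p, Tendsto (fun J => ‖S.level hB hη J (φ p)‖) atTop (𝓝 0)) :
    ∃ B', 0 ≤ B' ∧ IsBessel (fun i : ℕ × Zd d => (S.U ^ i.1) (S.τ i.2 η)) B' := by
  obtain ⟨C, ρ, hC, hρ0, hρ1, hgeo⟩ := exists_geometric_level href K hK h0
  set A := ‖q'‖ * ∑ l ∈ T, ∑ p, ‖c l p‖ with hA
  have hA0 : 0 ≤ A := mul_nonneg (norm_nonneg _)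
    (Finset.sum_nonneg fun _ _ => Finset.sum_nonneg fun _ _ => norm_nonneg _)
  have hsucc : ∀ J, ‖S.level hB hη (J + 1) η‖ ≤ A * (C * ρ ^ J) := by
    intro J
    have h1 : S.level hB hη (J + 1) η
        = q' • ∑ l ∈ T, ∑ p, c l p • S.level hB hη J (S.τ l (φ p)) := by
      refine (congrArg (S.level hB hη (J + 1)) hηφ).trans ?_
      simp only [map_smul, map_sum, level_succ_U]
    rw [h1, norm_smul, hA, mul_assoc, Finset.sum_mul]
    refine mul_le_mul_of_nonneg_left (norm_sum_le_of_le _ fun l _ => ?_) (norm_nonneg _)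
    rw [Finset.sum_mul]
    refine norm_sum_le_of_le _ fun p _ => ?_
    rw [norm_smul, norm_level_τ]
    gcongr
    exact hgeo J p
  refine isBessel_of_geometric K' hK' (C := ‖S.level hB hη 0 η‖ + A * C / ρ) (by positivity)
    hρ0.le hρ1 fun J => ?_
  cases J with
  | zero => rw [pow_zero, mul_one]; exact le_add_of_nonneg_right (by positivity)
  | succ J =>
    refine (hsucc J).trans ?_
    rw [add_mul, pow_succ]
    refine le_add_of_nonneg_of_le (by positivity) (le_of_eq ?_)
    field_simp

end MultiScale

end MultiScale

/-! ### The signed expansion from the energy identity -/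

section Expansion

variable {H : Type*} [NormedAddCommGroup H] [InnerProductSpace ℂ H]

lemma IsBessel.comp_injective {ι κ : Type*} {e : ι → H} {B : ℝ} (h : IsBessel e B) {g : κ → ι}
    (hg : Function.Injective g) : IsBessel (fun x => e (g x)) B := by
  classical
  intro f F
  rw [← Finset.sum_image (f := fun i => ‖inner ℂ (e i) f‖ ^ 2) hg.injOn]
  exact h f _

lemma IsBessel.fintype_prod {ι κ : Type*} [Fintype κ] {e : κ → ι → H} {B : κ → ℝ}
    (h : ∀ i, IsBessel (e i) (B i)) :
    IsBessel (fun x : κ × ι => e x.1 x.2) (∑ i, B i) := by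
  classical
  intro f F
  calc ∑ x ∈ F, ‖inner ℂ (e x.1 x.2) f‖ ^ 2
      ≤ ∑ x ∈ Finset.univ ×ˢ F.image Prod.snd, ‖inner ℂ (e x.1 x.2) f‖ ^ 2 := by
        refine Finset.sum_le_sum_of_subset_of_nonneg (fun x hx => ?_) fun _ _ _ => by positivity
        exact Finset.mem_product.2 ⟨Finset.mem_univ _, Finset.mem_image_of_mem _ hx⟩
    _ = ∑ i, ∑ k ∈ F.image Prod.snd, ‖inner ℂ (e i k) f‖ ^ 2 := Finset.sum_product _ _ _
    _ ≤ ∑ i, B i * ‖f‖ ^ 2 := Finset.sum_le_sum fun i _ => h i f _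
    _ = _ := by rw [Finset.sum_mul]

lemma IsBessel.sumElim {ι κ : Type*} {e : ι → H} {e' : κ → H} {B B' : ℝ} (h : IsBessel e B)
    (h' : IsBessel e' B') : IsBessel (Sum.elim e e') (B + B') := by
  intro f F
  rw [← Finset.toLeft_disjSum_toRight (u := F), Finset.sum_disjSum, add_mul]
  exact add_le_add (h f _) (h' f _)

namespace MultiScale

variable {d : ℕ} {M : Matrix (Fin d) (Fin d) ℤ} (S : MultiScale M H) {r s : ℕ}

/-- The system formed by the shifts of `φ` and by all dilates and shifts of `ψ`. -/
def family (φ : Fin r → H) (ψ : Fin s → H) : Idx d r s → H :=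
  Sum.elim (fun i => S.τ i.2 (φ i.1)) fun i => (S.U ^ i.1) (S.τ i.2.2 (ψ i.2.1))

lemma isBessel_family {φ : Fin r → H} {ψ : Fin s → H} {B : Fin r → ℝ} {B' : Fin s → ℝ}
    (hφ : ∀ p, IsBessel (fun l => S.τ l (φ p)) (B p))
    (hψ : ∀ l, IsBessel (fun i : ℕ × Zd d => (S.U ^ i.1) (S.τ i.2 (ψ l))) (B' l)) :
    IsBessel (S.family φ ψ) (∑ p, B p + ∑ l, B' l) := by
  refine (IsBessel.fintype_prod hφ).sumElim ?_
  refine (IsBessel.fintype_prod hψ).comp_injective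
    (g := fun i : ℕ × Fin s × Zd d => (i.2.1, (i.1, i.2.2))) fun i j h => ?_
  obtain ⟨i1, i2, i3⟩ := i
  obtain ⟨j1, j2, j3⟩ := j
  simp only [Prod.mk.injEq] at h ⊢
  tauto

/-- The coefficients of `f` at scale `J` are obtained by filtering those at scale `J + 1`. -/
lemma inner_U_pow_τ {t : ℕ} {φ : Fin r → H} {u : Filt d (Matrix (Fin t) (Fin r) ℂ)} {q : ℝ}
    {η : H} {i : Fin t}
    (hη : η = (q : ℂ) • ∑ l ∈ u.support, ∑ p, u l i p • S.U (S.τ l (φ p)))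
    (J : ℕ) (f : H) (F : Finset (Zd d))
    (hF : ∀ p, ∀ n ∉ F, inner ℂ ((S.U ^ (J + 1)) (S.τ n (φ p))) f = 0) (k : Zd d) :
    inner ℂ ((S.U ^ J) (S.τ k η)) f = (q : ℂ) * ∑ n ∈ F, ∑ p,
      star (u (M *ᵥ (-k) + n) i p) * inner ℂ ((S.U ^ (J + 1)) (S.τ n (φ p))) f := by
  have h1 : inner ℂ ((S.U ^ J) (S.τ k η)) f = (q : ℂ) * ∑ l ∈ u.support, ∑ p,
      star (u l i p) * inner ℂ ((S.U ^ (J + 1)) (S.τ (M *ᵥ k + l) (φ p))) f := by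
    rw [hη]
    simp only [map_smul, map_sum, inner_smul_left, sum_inner, S.τ_U, ← U_pow_succ, ← S.τ_add,
      Complex.conj_ofReal]
    rfl
  rw [h1]
  congr 1
  set g : Zd d → ℂ := fun l => ∑ p,
    star (u l i p) * inner ℂ ((S.U ^ (J + 1)) (S.τ (M *ᵥ k + l) (φ p))) f with hg
  have h2 : ∑' l, g l = ∑ l ∈ u.support, g l := tsum_eq_sum fun l hl => by
    simp [hg, Finsupp.notMem_support_iff.1 hl]
  rw [← h2, ← (Equiv.addLeft (M *ᵥ (-k))).tsum_eq,
    tsum_eq_sum (s := F)]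
  · refine Finset.sum_congr rfl fun n _ => Finset.sum_congr rfl fun p _ => ?_
    rw [Equiv.coe_addLeft, Matrix.mulVec_neg, add_neg_cancel_left]
  · intro n hn
    refine Finset.sum_eq_zero fun p _ => ?_
    rw [Equiv.coe_addLeft, Matrix.mulVec_neg, add_neg_cancel_left, hF p n hn, mul_zero]

/-- The energy of the coefficients at scale `J + 1` splits into the energy of the coefficients
at scale `J` and the signed energy of the wavelet coefficients at scale `J`. -/
lemma energy_step [Fintype (Cos M)] {hM : M.det ≠ 0} {φ : Fin r → H} {ψ : Fin s → H}
    {a : Filt d (Matrix (Fin r) (Fin r) ℂ)} {b : Filt d (Matrix (Fin s) (Fin r) ℂ)}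
    {ε : Fin s → ℂ} (hab : PolyphaseIdentity hM a b ε) {q : ℝ}
    (hq : q ^ 2 = Fintype.card (Cos M))
    (href : ∀ p, φ p = (q : ℂ) • ∑ l ∈ a.support, ∑ p', a l p p' • S.U (S.τ l (φ p')))
    (hψ : ∀ i, ψ i = (q : ℂ) • ∑ l ∈ b.support, ∑ p', b l i p' • S.U (S.τ l (φ p')))
    (f : H) (J : ℕ) (hfin : ∃ F : Finset (Zd d), ∀ p, ∀ n ∉ F,
      inner ℂ ((S.U ^ (J + 1)) (S.τ n (φ p))) f = 0) :
    ((∑ p, ∑' k, ‖inner ℂ ((S.U ^ J) (S.τ k (φ p))) f‖ ^ 2 : ℝ) : ℂ)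
      + ∑ l, ε l * ((∑' k, ‖inner ℂ ((S.U ^ J) (S.τ k (ψ l))) f‖ ^ 2 : ℝ) : ℂ)
      = ((∑ p, ∑' k, ‖inner ℂ ((S.U ^ (J + 1)) (S.τ k (φ p))) f‖ ^ 2 : ℝ) : ℂ) := by
  obtain ⟨F, hF⟩ := hfin
  have key : ∀ {t : ℕ} {u : Filt d (Matrix (Fin t) (Fin r) ℂ)} {η : H} {i : Fin t},
      η = (q : ℂ) • ∑ l ∈ u.support, ∑ p, u l i p • S.U (S.τ l (φ p)) →
      ∑' k, ‖inner ℂ ((S.U ^ J) (S.τ k η)) f‖ ^ 2 = q ^ 2 * ∑' k, ‖∑ n ∈ F, ∑ p,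
        star (u (M *ᵥ k + n) i p) * inner ℂ ((S.U ^ (J + 1)) (S.τ n (φ p))) f‖ ^ 2 := by
    intro t u η i hη
    rw [← tsum_mul_left, ← (Equiv.neg (Zd d)).tsum_eq]
    refine tsum_congr fun k => ?_
    rw [S.inner_U_pow_τ hη J f F hF, norm_mul, mul_pow, Complex.norm_real, Real.norm_eq_abs,
      sq_abs, Equiv.neg_apply, neg_neg]
  have hE := hab.energy F fun n p => inner ℂ ((S.U ^ (J + 1)) (S.τ n (φ p))) f
  have hcard : ((Fintype.card (Cos M) : ℕ) : ℂ) = ((q ^ 2 : ℝ) : ℂ) := by rw [hq]; simp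
  have hq0 : ((q ^ 2 : ℝ) : ℂ) ≠ 0 := by
    rw [← hcard]
    have : Nonempty (Cos M) := ⟨0⟩
    exact Nat.cast_ne_zero.2 Fintype.card_ne_zero
  have hR : ∑ p, ∑' k, ‖inner ℂ ((S.U ^ (J + 1)) (S.τ k (φ p))) f‖ ^ 2
      = ∑ n ∈ F, ∑ p, ‖inner ℂ ((S.U ^ (J + 1)) (S.τ n (φ p))) f‖ ^ 2 := by
    rw [Finset.sum_comm]
    refine Finset.sum_congr rfl fun p _ => tsum_eq_sum fun n hn => ?_
    rw [hF p n hn]; simp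
  rw [hR]
  rw [hcard, eq_comm, inv_mul_eq_iff_eq_mul₀ hq0] at hE
  rw [hE, mul_add, Finset.mul_sum, Finset.mul_sum, Complex.ofReal_sum]
  congr 1
  · refine Finset.sum_congr rfl fun p _ => ?_
    rw [key (href p), Complex.ofReal_mul]
  · refine Finset.sum_congr rfl fun l _ => ?_
    rw [key (hψ l), Complex.ofReal_mul]
    ring

/-- Telescoping the energy over all scales. -/
theorem quadratic_family [Fintype (Cos M)] {hM : M.det ≠ 0} {φ : Fin r → H} {ψ : Fin s → H}
    {a : Filt d (Matrix (Fin r) (Fin r) ℂ)} {b : Filt d (Matrix (Fin s) (Fin r) ℂ)}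
    {ε : Fin s → ℂ} (hε : ∀ l, ε l = 1 ∨ ε l = -1) (hab : PolyphaseIdentity hM a b ε) {q : ℝ}
    (hq : q ^ 2 = Fintype.card (Cos M))
    (href : ∀ p, φ p = (q : ℂ) • ∑ l ∈ a.support, ∑ p', a l p p' • S.U (S.τ l (φ p')))
    (hψ : ∀ i, ψ i = (q : ℂ) • ∑ l ∈ b.support, ∑ p', b l i p' • S.U (S.τ l (φ p')))
    {B : ℝ} (hB : IsBessel (S.family φ ψ) B)
    (f : H) (hfin : ∀ J, ∃ F : Finset (Zd d), ∀ p, ∀ n ∉ F,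
      inner ℂ ((S.U ^ J) (S.τ n (φ p))) f = 0)
    (hlim : Tendsto (fun J => ∑ p, ∑' k, ‖inner ℂ ((S.U ^ J) (S.τ k (φ p))) f‖ ^ 2) atTop
      (𝓝 (‖f‖ ^ 2))) :
    ∑' i, signs ε i * (‖inner ℂ (S.family φ ψ i) f‖ ^ 2 : ℝ) = ((‖f‖ ^ 2 : ℝ) : ℂ) := by
  have hs : Summable fun i => signs (r := r) ε i * ((‖inner ℂ (S.family φ ψ i) f‖ ^ 2 : ℝ) : ℂ) := by
    refine Summable.of_norm ((hB.summable f).congr fun i => ?_)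
    have h1 : ‖signs (d := d) (r := r) ε i‖ = 1 := by
      rcases i with i | ⟨j, l, k⟩
      · simp [signs]
      · rcases hε l with h | h <;> simp [signs, h]
    rw [norm_mul, h1, one_mul, Complex.norm_real, Real.norm_of_nonneg (by positivity)]
  have hsl : Summable fun i => signs ε (Sum.inl i) *
      ((‖inner ℂ (S.family φ ψ (Sum.inl i)) f‖ ^ 2 : ℝ) : ℂ) :=
    hs.comp_injective Sum.inl_injective
  have hsr : Summable fun i => signs (r := r) ε (Sum.inr i) *
      ((‖inner ℂ (S.family φ ψ (Sum.inr i)) f‖ ^ 2 : ℝ) : ℂ) :=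
    hs.comp_injective Sum.inr_injective
  set E : ℕ → ℂ := fun J => ((∑ p, ∑' k, ‖inner ℂ ((S.U ^ J) (S.τ k (φ p))) f‖ ^ 2 : ℝ) : ℂ)
    with hE
  have hl : ∑' i, signs ε (Sum.inl i) * ((‖inner ℂ (S.family φ ψ (Sum.inl i)) f‖ ^ 2 : ℝ) : ℂ)
      = E 0 := by
    rw [hsl.tsum_prod, tsum_fintype, hE]
    push_cast
    refine Finset.sum_congr rfl fun p _ => tsum_congr fun k => ?_
    simp [signs, family]
  have hj : ∀ j, ∑' i : Fin s × Zd d, signs (r := r) ε (Sum.inr (j, i)) *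
      ((‖inner ℂ (S.family φ ψ (Sum.inr (j, i))) f‖ ^ 2 : ℝ) : ℂ) = E (j + 1) - E j := by
    intro j
    rw [eq_sub_iff_add_eq']
    refine Eq.trans ?_ (S.energy_step hab hq href hψ f j (hfin (j + 1)))
    refine congrArg (E j + ·) ?_
    rw [(hsr.prod_factor j).tsum_prod, tsum_fintype]
    refine Finset.sum_congr rfl fun l _ => ?_
    rw [Complex.ofReal_tsum, ← tsum_mul_left]
    rfl
  have hr : ∑' i, signs (r := r) ε (Sum.inr i) * ((‖inner ℂ (S.family φ ψ (Sum.inr i)) f‖ ^ 2 : ℝ) : ℂ)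
      = ((‖f‖ ^ 2 : ℝ) : ℂ) - E 0 := by
    have h1 : Summable fun j => E (j + 1) - E j := by
      have := hsr.prod
      simpa only [hj] using this
    rw [hsr.tsum_prod]
    simp only [hj]
    refine tendsto_nhds_unique h1.hasSum.tendsto_sum_nat ?_
    simp only [Finset.sum_range_sub]
    exact ((Complex.continuous_ofReal.tendsto _).comp hlim).sub_const _
  have h2 := (HasSum.sum (f := fun i => signs ε i *
    ((‖inner ℂ (S.family φ ψ i) f‖ ^ 2 : ℝ) : ℂ)) hsl.hasSum hsr.hasSum).tsum_eq
  rw [h2, hl, hr]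
  ring

end MultiScale

end Expansion

/-! ### Affine changes of variables in `L²(ℝ^d)` -/

section Affine

variable {d : ℕ}

/-- The Hilbert space `L²(ℝ^d)`. -/
abbrev L2 (d : ℕ) : Type := Lp ℂ 2 (volume : Measure (Rd d))

/-- The normalized affine change of variables `f ↦ |det A|^{1/2} f(A x - t)`. -/
def aff (A : Matrix (Fin d) (Fin d) ℝ) (t : Rd d) (f : Rd d → ℂ) : Rd d → ℂ :=
  fun x => ((Real.sqrt |A.det| : ℝ) : ℂ) * f (act A x - t)

variable {A B : Matrix (Fin d) (Fin d) ℝ}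

lemma continuous_act (A : Matrix (Fin d) (Fin d) ℝ) : Continuous (act A) :=
  LinearMap.continuous_of_finiteDimensional _

lemma measurable_affine (A : Matrix (Fin d) (Fin d) ℝ) (t : Rd d) :
    Measurable fun x => act A x - t :=
  ((continuous_act A).sub continuous_const).measurable

lemma map_affine (hA : A.det ≠ 0) (t : Rd d) :
    Measure.map (fun x => act A x - t) volume
      = ENNReal.ofReal |A.det|⁻¹ • (volume : Measure (Rd d)) := by
  have h1 : LinearMap.det (Matrix.toEuclideanLin A) = A.det := LinearMap.det_toLpLin 2 A
  have h2 := Measure.map_linearMap_addHaar_eq_smul_addHaar (volume : Measure (Rd d))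
    (f := Matrix.toEuclideanLin A) (by rwa [h1])
  have h3 : Measure.map (fun x : Rd d => x - t) volume = volume :=
    (measurePreserving_sub_right volume t).map_eq
  calc Measure.map (fun x => act A x - t) volume
      = Measure.map (fun x => x - t) (Measure.map (act A) volume) :=
        (Measure.map_map (measurable_id.sub_const t) (continuous_act A).measurable).symm
    _ = _ := by
        rw [show act A = Matrix.toEuclideanLin A from rfl, h2, h1, Measure.map_smul, h3, abs_inv]

lemma quasiMeasurePreserving_affine (hA : A.det ≠ 0) (t : Rd d) :
    Measure.QuasiMeasurePreserving (fun x => act A x - t) volume volume :=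
  ⟨measurable_affine A t, by
    rw [map_affine hA]; exact Measure.smul_absolutelyContinuous⟩

lemma integral_affine (hA : A.det ≠ 0) (t : Rd d) {f : Rd d → ℂ}
    (hf : AEStronglyMeasurable f volume) :
    ∫ x, f (act A x - t) = ((|A.det|⁻¹ : ℝ) : ℂ) * ∫ x, f x := by
  have h1 : AEStronglyMeasurable f (Measure.map (fun x => act A x - t) volume) := by
    rw [map_affine hA]; exact hf.mono_ac Measure.smul_absolutelyContinuous
  rw [← integral_map (measurable_affine A t).aemeasurable h1, map_affine hA,
    integral_smul_measure, ENNReal.toReal_ofReal (by positivity)]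
  simp

lemma aestronglyMeasurable_aff (hA : A.det ≠ 0) (t : Rd d) {f : Rd d → ℂ}
    (hf : AEStronglyMeasurable f volume) : AEStronglyMeasurable (aff A t f) volume :=
  (hf.comp_quasiMeasurePreserving (quasiMeasurePreserving_affine hA t)).const_mul _

lemma eLpNorm_aff (hA : A.det ≠ 0) (t : Rd d) {f : Rd d → ℂ}
    (hf : AEStronglyMeasurable f volume) :
    eLpNorm (aff A t f) 2 volume = eLpNorm f 2 volume := by
  have h1 : AEStronglyMeasurable f (Measure.map (fun x => act A x - t) volume) := by
    rw [map_affine hA]; exact hf.mono_ac Measure.smul_absolutelyContinuous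
  have h2 := eLpNorm_map_measure (p := 2) h1 (measurable_affine A t).aemeasurable
  rw [map_affine hA, eLpNorm_smul_measure_of_ne_top (by norm_num)] at h2
  have h3 : aff A t f = ((Real.sqrt |A.det| : ℝ) : ℂ) • (f ∘ fun x => act A x - t) := rfl
  rw [h3, eLpNorm_const_smul, ← h2, smul_eq_mul, ← mul_assoc]
  have h4 : 0 < |A.det| := abs_pos.2 hA
  have h5 : ‖((Real.sqrt |A.det| : ℝ) : ℂ)‖ₑ = ENNReal.ofReal (Real.sqrt |A.det|) := by
    rw [← ofReal_norm, Complex.norm_real, Real.norm_of_nonneg (Real.sqrt_nonneg _)]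
  have h6 : ENNReal.ofReal |A.det|⁻¹ ^ (1 / (2 : ℝ≥0∞)).toReal
      = ENNReal.ofReal (Real.sqrt |A.det|)⁻¹ := by
    rw [ENNReal.ofReal_rpow_of_nonneg (by positivity) (by positivity), ← Real.sqrt_inv,
      Real.sqrt_eq_rpow]
    simp
  rw [h5, h6, ← ENNReal.ofReal_mul (Real.sqrt_nonneg _),
    mul_inv_cancel₀ (Real.sqrt_pos.2 h4).ne', ENNReal.ofReal_one, one_mul]

lemma memLp_aff {f : Rd d → ℂ} (hf : MemLp f 2 volume) (hA : A.det ≠ 0) (t : Rd d) :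
    MemLp (aff A t f) 2 volume :=
  ⟨aestronglyMeasurable_aff hA t hf.1, by rw [eLpNorm_aff hA t hf.1]; exact hf.2⟩

lemma aff_congr (hA : A.det ≠ 0) (t : Rd d) {f g : Rd d → ℂ} (h : f =ᵐ[volume] g) :
    aff A t f =ᵐ[volume] aff A t g := by
  filter_upwards [(quasiMeasurePreserving_affine hA t).ae h] with x hx
  rw [aff, aff, hx]

lemma aff_aff (s t : Rd d) (f : Rd d → ℂ) :
    aff A s (aff B t f) = aff (B * A) (act B s + t) f := by
  ext x
  simp only [aff]
  rw [← mul_assoc, ← Complex.ofReal_mul, ← Real.sqrt_mul (abs_nonneg _), ← abs_mul,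
    Matrix.det_mul, mul_comm A.det, act_sub, act_act, sub_sub]

/-- `aff A t` as an isometry of `L²(ℝ^d)`. -/
def affL (A : Matrix (Fin d) (Fin d) ℝ) (hA : A.det ≠ 0) (t : Rd d) : L2 d →ₗᵢ[ℂ] L2 d where
  toFun h := (memLp_aff (Lp.memLp h) hA t).toLp
  map_add' f g := by
    ext1
    refine (MemLp.coeFn_toLp _).trans ?_
    refine EventuallyEq.trans ?_ (Lp.coeFn_add _ _).symm
    filter_upwards [aff_congr hA t (Lp.coeFn_add f g),
      MemLp.coeFn_toLp (memLp_aff (Lp.memLp f) hA t),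
      MemLp.coeFn_toLp (memLp_aff (Lp.memLp g) hA t)] with x h1 h2 h3
    rw [h1, Pi.add_apply, h2, h3]
    simp [aff, mul_add]
  map_smul' c f := by
    ext1
    refine (MemLp.coeFn_toLp _).trans ?_
    refine EventuallyEq.trans ?_ (Lp.coeFn_smul _ _).symm
    filter_upwards [aff_congr hA t (Lp.coeFn_smul c f),
      MemLp.coeFn_toLp (memLp_aff (Lp.memLp f) hA t)] with x h1 h2
    rw [h1, Pi.smul_apply, RingHom.id_apply, h2]
    simp only [aff, Pi.smul_apply, smul_eq_mul]
    ring
  norm_map' f := by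
    change ‖MemLp.toLp _ (memLp_aff (Lp.memLp f) hA t)‖ = ‖f‖
    rw [Lp.norm_toLp, eLpNorm_aff hA t (Lp.memLp f).1, Lp.norm_def]

lemma coeFn_affL (hA : A.det ≠ 0) (t : Rd d) (f : L2 d) : affL A hA t f =ᵐ[volume] aff A t f :=
  MemLp.coeFn_toLp (memLp_aff (Lp.memLp f) hA t)

lemma affL_toLp (hA : A.det ≠ 0) (t : Rd d) {f : Rd d → ℂ} (hf : MemLp f 2 volume) :
    affL A hA t hf.toLp = (memLp_aff hf hA t).toLp := by
  ext1
  exact (coeFn_affL hA t _).trans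
    ((aff_congr hA t hf.coeFn_toLp).trans (MemLp.coeFn_toLp _).symm)

lemma affL_affL (hA : A.det ≠ 0) (hB : B.det ≠ 0) (s t : Rd d) (f : L2 d) :
    affL A hA s (affL B hB t f)
      = affL (B * A) (by rw [Matrix.det_mul]; exact mul_ne_zero hB hA) (act B s + t) f := by
  ext1
  refine (coeFn_affL hA s _).trans ?_
  refine EventuallyEq.trans ?_ (coeFn_affL _ _ _).symm
  refine (aff_congr hA s (coeFn_affL hB t f)).trans ?_
  rw [aff_aff]

variable {M : Matrix (Fin d) (Fin d) ℤ}

/-- The dilation by `M` and the integer shifts on `L²(ℝ^d)`. -/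
def multiScale (hM : M.det ≠ 0) : MultiScale M (L2 d) where
  U := affL (realMat M) (det_realMat_ne_zero hM) 0
  τ k := affL 1 (by simp) (latt k)
  τ_add k l x := by
    rw [affL_affL]
    congr 2
    · simp
    · rw [latt_add, act_one]
  τ_U k x := by
    rw [affL_affL, affL_affL]
    congr 2
    · simp
    · rw [act_latt, act_zero]; simp

lemma multiScale_apply (hM : M.det ≠ 0) (J : ℕ) (k : Zd d) (f : L2 d) :
    ((multiScale hM).U ^ J) ((multiScale hM).τ k f)
      = affL (realMat M ^ J) (by rw [Matrix.det_pow]; exact pow_ne_zero _ (det_realMat_ne_zero hM))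
        (latt k) f := by
  induction J with
  | zero =>
    simp only [pow_zero]
    rfl
  | succ J ih =>
    rw [MultiScale.U_pow_succ', ih]
    simp only [multiScale]
    rw [affL_affL]
    congr 2
    rw [act_zero, zero_add]

lemma family_toLp (hM : M.det ≠ 0) {r s : ℕ} {φ : Fin r → Rd d → ℂ} {ψ : Fin s → Rd d → ℂ}
    (hφ : ∀ ℓ, MemLp (φ ℓ) 2 volume) (hψ : ∀ ℓ, MemLp (ψ ℓ) 2 volume) (i : Idx d r s) :
    (multiScale hM).family (fun ℓ => (hφ ℓ).toLp) (fun ℓ => (hψ ℓ).toLp) i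
      =ᵐ[volume] system M φ ψ i := by
  rcases i with ⟨ℓ, k⟩ | ⟨j, ℓ, k⟩
  · change affL 1 (by simp) (latt k) (hφ ℓ).toLp =ᵐ[volume] _
    rw [affL_toLp]
    refine (MemLp.coeFn_toLp _).trans (Eq.eventuallyEq ?_)
    ext x
    simp [aff, act_one, system]
  · change ((multiScale hM).U ^ j) ((multiScale hM).τ k (hψ ℓ).toLp) =ᵐ[volume] _
    rw [multiScale_apply, affL_toLp]
    refine (MemLp.coeFn_toLp _).trans (Eq.eventuallyEq ?_)
    ext x
    simp only [aff, system, Matrix.det_pow, abs_pow]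
    congr 2
    rw [Real.sqrt_eq_rpow, ← Real.rpow_natCast, ← Real.rpow_mul (abs_nonneg _)]
    congr 1
    ring

/-- The pairing of functions is the inner product of `L²(ℝ^d)`. -/
lemma ip_eq_inner {f g : Rd d → ℂ} {F G : L2 d} (hF : F =ᵐ[volume] f) (hG : G =ᵐ[volume] g) :
    ip f g = inner ℂ G F := by
  rw [L2.inner_def, ip]
  refine integral_congr_ae ?_
  filter_upwards [hF, hG] with x h1 h2
  rw [h1, h2]
  rfl

end Affine

/-! ### Iterates of a dilation matrix -/

section DilationMatrix

variable {d : ℕ} {M : Matrix (Fin d) (Fin d) ℤ}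

lemma IsDilation.isUnit_map (h : IsDilation M) : IsUnit (M.map (Int.cast : ℤ → ℂ)) := by
  rw [← spectrum.zero_notMem_iff ℂ]
  intro h0
  have := h 0 h0
  simp at this
  linarith

lemma IsDilation.det_ne_zero (h : IsDilation M) : M.det ≠ 0 := by
  have h1 := (Matrix.isUnit_iff_isUnit_det _).1 h.isUnit_map
  rw [← Int.cast_det (R := ℂ)] at h1
  exact_mod_cast h1.ne_zero

section Norm

attribute [local instance] Matrix.linftyOpNormedRing Matrix.linftyOpNormedAlgebra

lemma IsDilation.tendsto_complex_inv_pow (h : IsDilation M) :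
    Tendsto (fun J : ℕ => ((M.map (Int.cast : ℤ → ℂ))⁻¹) ^ J) atTop (𝓝 0) := by
  rcases isEmpty_or_nonempty (Fin d) with he | hne
  · exact tendsto_const_nhds.congr fun J => Subsingleton.elim _ _
  obtain ⟨u, hu⟩ := h.isUnit_map
  set A := (M.map (Int.cast : ℤ → ℂ))⁻¹ with hA
  have hAu : A = ((u⁻¹ : (Matrix (Fin d) (Fin d) ℂ)ˣ) : Matrix (Fin d) (Fin d) ℂ) := by
    rw [hA, ← hu, Matrix.coe_units_inv]
  have hrad : spectralRadius ℂ A < (1 : NNReal) := by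
    refine spectrum.spectralRadius_lt_of_forall_lt A fun z hz => ?_
    rw [hAu] at hz
    have h1 := h _ (hu ▸ spectrum.inv₀_mem_iff.2 hz)
    rw [norm_inv] at h1
    have h2 : ‖z‖ < 1 := by
      by_contra! hz1
      exact absurd h1 (not_lt.2 (inv_le_one_of_one_le₀ hz1))
    exact_mod_cast h2
  obtain ⟨ρ, hρ, hρ1⟩ := ENNReal.lt_iff_exists_nnreal_btwn.1 hrad
  have hev := (spectrum.pow_nnnorm_pow_one_div_tendsto_nhds_spectralRadius A).eventually_lt_const hρ
  refine squeeze_zero_norm' (a := fun J : ℕ => (ρ : ℝ) ^ J) ?_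
    (tendsto_pow_atTop_nhds_zero_of_lt_one ρ.2 (by exact_mod_cast hρ1))
  filter_upwards [hev, eventually_gt_atTop 0] with J hJ hJ0
  have hJ' : (0 : ℝ) < J := by exact_mod_cast hJ0
  have h3 := ENNReal.rpow_lt_rpow hJ hJ'
  rw [← ENNReal.rpow_mul, one_div, inv_mul_cancel₀ hJ'.ne', ENNReal.rpow_one,
    ENNReal.rpow_natCast] at h3
  have h4 : ‖A ^ J‖₊ < ρ ^ J := by exact_mod_cast h3
  exact_mod_cast h4.le

end Norm

lemma realMat_pow_inv_apply (hM : M.det ≠ 0) (J : ℕ) (i j : Fin d) :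
    ((((M.map (Int.cast : ℤ → ℂ))⁻¹) ^ J) i j) = ((((realMat M ^ J)⁻¹) i j : ℝ) : ℂ) := by
  have h1 : M.map (Int.cast : ℤ → ℂ) = (realMat M).map Complex.ofRealHom := by
    ext i j; simp [realMat]
  have h2 : (M.map (Int.cast : ℤ → ℂ))⁻¹ = ((realMat M)⁻¹).map Complex.ofRealHom := by
    rw [h1]
    refine Matrix.inv_eq_left_inv ?_
    rw [← Matrix.map_mul, Matrix.nonsing_inv_mul _ (by simpa using det_realMat_ne_zero hM)]
    simp
  rw [h2, ← Matrix.map_pow, Matrix.inv_pow']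
  rfl

lemma norm_act_le (A : Matrix (Fin d) (Fin d) ℝ) (x : Rd d) :
    ‖act A x‖ ≤ (∑ i, ∑ j, |A i j|) * ‖x‖ := by
  have h1 : act A x = ∑ i, ∑ j, PiLp.single 2 i (A i j * x j) := by
    ext k
    rw [Finset.sum_comm]
    simp [act, Matrix.toLpLin_apply, Matrix.mulVec, dotProduct, Finset.sum_apply, Pi.single_apply]
  rw [h1, Finset.sum_mul]
  refine norm_sum_le_of_le _ fun i _ => ?_
  rw [Finset.sum_mul]
  refine norm_sum_le_of_le _ fun j _ => ?_
  rw [PiLp.norm_single, norm_mul]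
  exact mul_le_mul_of_nonneg_left (PiLp.norm_apply_le x j) (norm_nonneg _)

/-- The inverse powers of a dilation matrix tend to zero. -/
lemma IsDilation.exists_norm_act_inv_pow_le (h : IsDilation M) :
    ∃ c : ℕ → ℝ, (∀ J, 0 ≤ c J) ∧ Tendsto c atTop (𝓝 0) ∧
      ∀ J x, ‖act (realMat M ^ J)⁻¹ x‖ ≤ c J * ‖x‖ := by
  refine ⟨fun J => ∑ i, ∑ j, |((realMat M ^ J)⁻¹) i j|,
    fun J => Finset.sum_nonneg fun _ _ => Finset.sum_nonneg fun _ _ => abs_nonneg _, ?_,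
    fun J x => norm_act_le _ x⟩
  have h1 := h.tendsto_complex_inv_pow
  have h2 : Tendsto (fun J : ℕ => ∑ i, ∑ j, |((realMat M ^ J)⁻¹) i j|) atTop
      (𝓝 (∑ _i : Fin d, ∑ _j : Fin d, 0)) := by
    refine tendsto_finsetSum _ fun i _ => tendsto_finsetSum _ fun j _ => ?_
    have h3 := (tendsto_pi_nhds.1 (tendsto_pi_nhds.1 h1 i) j).norm
    simp only [realMat_pow_inv_apply h.det_ne_zero, Complex.norm_real, Real.norm_eq_abs] at h3
    simpa using h3
  simpa using h2

lemma finite_latt_ball (d : ℕ) (R : ℝ) : {k : Zd d | ‖latt k‖ ≤ R}.Finite := by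
  refine (Set.finite_Icc (fun _ : Fin d => -⌈R⌉) (fun _ => ⌈R⌉)).subset fun k hk => ?_
  have h1 : ∀ i, |k i| ≤ ⌈R⌉ := fun i => by
    have h2 := (PiLp.norm_apply_le (latt k) i).trans hk
    rw [latt_apply, Real.norm_eq_abs] at h2
    have h3 : ((|k i| : ℤ) : ℝ) ≤ ⌈R⌉ := by push_cast; exact h2.trans (Int.le_ceil R)
    exact_mod_cast h3
  exact ⟨fun i => (abs_le.1 (h1 i)).1, fun i => (abs_le.1 (h1 i)).2⟩

end DilationMatrix

/-! ### Refinement in `L²(ℝ^d)` -/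

section Refinement

variable {d : ℕ}

/-- An integrable function is determined by its Fourier transform. -/
lemma ae_eq_zero_of_hat_eq_zero {f : Rd d → ℂ} (hf : Integrable f) (h : ∀ ξ, hat f ξ = 0) :
    ∀ᵐ x, f x = 0 := by
  have hF : ∀ w : Rd d, VectorFourier.fourierIntegral Real.fourierChar volume
      (innerₗ (Rd d)).flip f w = 0 := by
    intro w
    rw [← h ((2 * Real.pi) • w), hat_eq, VectorFourier.fourierIntegral]
    refine integral_congr_ae (Eventually.of_forall fun x => ?_)
    simp only [Circle.smul_def, Real.fourierChar_apply, smul_eq_mul, chi, LinearMap.flip_apply,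
      innerₗ_apply_apply]
    rw [mul_comm, inner_smul_right, real_inner_comm]
    congr 2
    push_cast
    ring
  refine ae_eq_zero_of_integral_contDiff_smul_eq_zero hf.locallyIntegrable fun g hg hgc => ?_
  have hg' : ContDiff ℝ (⊤ : ℕ∞) fun x => ((g x : ℝ) : ℂ) := Complex.ofRealCLM.contDiff.comp hg
  have hgc' : HasCompactSupport fun x => ((g x : ℝ) : ℂ) :=
    hgc.comp_left (g := fun t : ℝ => (t : ℂ)) Complex.ofReal_zero
  let G := hgc'.toSchwartzMap hg'
  let K := (FourierTransform.fourierInv G : SchwartzMap (Rd d) ℂ)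
  have hK : ∀ x, VectorFourier.fourierIntegral Real.fourierChar volume (innerₗ (Rd d)) K x
      = ((g x : ℝ) : ℂ) := by
    intro x
    have h1 : (FourierTransform.fourier K : SchwartzMap (Rd d) ℂ) = G :=
      FourierTransform.fourier_fourierInv_eq G
    have h2 := DFunLike.congr_fun h1 x
    rw [SchwartzMap.fourier_coe] at h2
    exact h2
  have h3 := VectorFourier.integral_fourierIntegral_smul_eq_flip (L := innerₗ (Rd d))
    (μ := volume) (ν := volume) Real.continuous_fourierChar continuous_inner K.integrable hf
  simp only [hK, hF, smul_zero, integral_zero] at h3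
  rw [← h3]
  rfl

lemma inner_act (A : Matrix (Fin d) (Fin d) ℝ) (x y : Rd d) :
    inner ℝ (act A x) y = inner ℝ x (act Aᵀ y) := by
  rw [act, act, EuclideanSpace.inner_eq_star_dotProduct, EuclideanSpace.inner_eq_star_dotProduct]
  simp only [Matrix.toLpLin_apply, star_trivial]
  rw [Matrix.dotProduct_mulVec, Matrix.mulVec_transpose]

lemma chi_act (A : Matrix (Fin d) (Fin d) ℝ) (x ξ : Rd d) :
    chi (act A x) ξ = chi x (act Aᵀ ξ) := by
  rw [chi, chi, inner_act]

variable {A : Matrix (Fin d) (Fin d) ℝ}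

lemma act_inv_act (hA : A.det ≠ 0) (x : Rd d) : act A⁻¹ (act A x) = x := by
  rw [act_act, Matrix.nonsing_inv_mul _ (by simpa using hA), act_one]

lemma hat_aff (hA : A.det ≠ 0) (t : Rd d) {f : Rd d → ℂ} (hf : Integrable f) (ξ : Rd d) :
    hat (aff A t f) ξ = (((Real.sqrt |A.det|)⁻¹ : ℝ) : ℂ) *
      (chi t (act (Aᵀ)⁻¹ ξ) * hat f (act (Aᵀ)⁻¹ ξ)) := by
  set ζ := act (Aᵀ)⁻¹ ξ with hζ
  have h1 : ∀ x, chi x ξ = chi (act A x - t) ζ * chi t ζ := by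
    intro x
    rw [← chi_add_left, sub_add_cancel, hζ, ← Matrix.transpose_nonsing_inv, ← chi_act,
      act_inv_act hA]
  have h2 : hat (aff A t f) ξ = ((Real.sqrt |A.det| : ℝ) : ℂ) * chi t ζ *
      ∫ x, (fun y => f y * chi y ζ) (act A x - t) := by
    rw [hat_eq, ← integral_const_mul]
    refine integral_congr_ae (Eventually.of_forall fun x => ?_)
    simp only [aff]
    rw [h1 x]
    ring
  have hchi : Continuous fun y : Rd d => chi y ζ := by unfold chi; fun_prop
  have h5 : AEStronglyMeasurable (fun y => f y * chi y ζ) volume :=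
    hf.1.mul hchi.aestronglyMeasurable
  rw [h2, integral_affine hA t h5, ← hat_eq]
  have h3 : Real.sqrt |A.det| * |A.det|⁻¹ = (Real.sqrt |A.det|)⁻¹ := by
    have h4 : 0 < Real.sqrt |A.det| := Real.sqrt_pos.2 (abs_pos.2 hA)
    nth_rewrite 2 [← Real.mul_self_sqrt (abs_nonneg A.det)]
    field_simp
  rw [← h3]
  push_cast
  ring

lemma IsCompactlySupported.aff (hA : A.det ≠ 0) (t : Rd d) {f : Rd d → ℂ}
    (hf : IsCompactlySupported f) : IsCompactlySupported (aff A t f) := by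
  obtain ⟨K, hK, hKf⟩ := hf
  refine ⟨(fun y => act A⁻¹ (y + t)) '' K,
    hK.image ((continuous_act _).comp (continuous_add_const t)), ?_⟩
  filter_upwards [(quasiMeasurePreserving_affine hA t).ae hKf] with x hx hxK
  rw [Framelet.aff, hx fun h => hxK ⟨_, h, ?_⟩, mul_zero]
  simp only [sub_add_cancel]
  exact act_inv_act hA x

lemma IsCompactlySupported.const_mul {f : Rd d → ℂ} (hf : IsCompactlySupported f) (c : ℂ) :
    IsCompactlySupported fun x => c * f x := by
  obtain ⟨K, hK, hKf⟩ := hf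
  refine ⟨K, hK, ?_⟩
  filter_upwards [hKf] with x hx hxK
  rw [hx hxK, mul_zero]

lemma IsCompactlySupported.sum {ι : Type*} {F : Finset ι} {f : ι → Rd d → ℂ}
    (hf : ∀ i, IsCompactlySupported (f i)) : IsCompactlySupported fun x => ∑ i ∈ F, f i x := by
  choose K hK hKf using hf
  refine ⟨⋃ i ∈ F, K i, F.isCompact_biUnion fun i _ => hK i, ?_⟩
  filter_upwards [(ae_ball_iff F.countable_toSet).2 fun i (_ : i ∈ F) => hKf i] with x hx hxK
  refine Finset.sum_eq_zero fun i hi => hx i hi fun h => hxK ?_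
  exact Set.mem_biUnion hi h

variable {M : Matrix (Fin d) (Fin d) ℤ} {r t : ℕ}

/-- The functions `|det M| ∑_k u(k) φ(M x - k)` obtained from `φ` with the filter `u`. -/
def combine (M : Matrix (Fin d) (Fin d) ℤ) (u : Filt d (Matrix (Fin t) (Fin r) ℂ))
    (φ : Fin r → Rd d → ℂ) (i : Fin t) : Rd d → ℂ := fun x =>
  ∑ k ∈ u.support, ∑ p, (((Real.sqrt |(realMat M).det| : ℝ) : ℂ) * u k i p) *
    aff (realMat M) (latt k) (φ p) x

variable {u : Filt d (Matrix (Fin t) (Fin r) ℂ)} {φ : Fin r → Rd d → ℂ}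

lemma isCompactlySupported_combine (hM : M.det ≠ 0) (hφ : ∀ p, IsCompactlySupported (φ p))
    (i : Fin t) : IsCompactlySupported (combine M u φ i) :=
  IsCompactlySupported.sum fun _ => IsCompactlySupported.sum fun p =>
    ((hφ p).aff (det_realMat_ne_zero hM) _).const_mul _

lemma memLp_combine (hM : M.det ≠ 0) (hφ : ∀ p, MemLp (φ p) 2 volume) (i : Fin t) :
    MemLp (combine M u φ i) 2 volume :=
  memLp_finsetSum _ fun _ _ => memLp_finsetSum _ fun p _ =>
    (memLp_aff (hφ p) (det_realMat_ne_zero hM) _).const_mul _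

lemma eventuallyEq_sum_L2 {ι : Type*} {F : Finset ι} {f g : ι → Rd d → ℂ}
    (h : ∀ i ∈ F, f i =ᵐ[volume] g i) :
    (fun x => ∑ i ∈ F, f i x) =ᵐ[volume] fun x => ∑ i ∈ F, g i x := by
  filter_upwards [(ae_ball_iff F.countable_toSet).2 h] with x hx
  exact Finset.sum_congr rfl fun i hi => hx i hi

lemma toLp_combine (hM : M.det ≠ 0) (hφ : ∀ p, MemLp (φ p) 2 volume) (i : Fin t) :
    (memLp_combine (u := u) hM hφ i).toLp
      = ((Real.sqrt |(realMat M).det| : ℝ) : ℂ) • ∑ k ∈ u.support, ∑ p,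
        u k i p • (multiScale hM).U ((multiScale hM).τ k (hφ p).toLp) := by
  have h1 : ∀ k p, (multiScale hM).U ((multiScale hM).τ k (hφ p).toLp)
      =ᵐ[volume] aff (realMat M) (latt k) (φ p) := by
    intro k p
    have h2 := multiScale_apply hM 1 k (hφ p).toLp
    simp only [pow_one] at h2
    rw [h2, affL_toLp]
    exact MemLp.coeFn_toLp _
  simp only [Finset.smul_sum, smul_smul]
  ext1
  refine (MemLp.coeFn_toLp _).trans (EventuallyEq.trans ?_ (Lp.coeFn_fun_finsetSum _ _).symm)
  refine eventuallyEq_sum_L2 fun k _ =>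
    EventuallyEq.trans (eventuallyEq_sum_L2 fun p _ => ?_) (Lp.coeFn_fun_finsetSum _ _).symm
  refine EventuallyEq.trans ?_ (Lp.coeFn_smul _ _).symm
  filter_upwards [h1 k p] with x hx
  rw [Pi.smul_apply, hx, smul_eq_mul]

lemma hat_combine (hM : M.det ≠ 0) (hφ : ∀ p, MemLp (φ p) 2 volume)
    (hφc : ∀ p, IsCompactlySupported (φ p)) (i : Fin t) (ξ : Rd d) :
    hat (combine M u φ i) ξ
      = (symbol u (act ((realMat M)ᵀ)⁻¹ ξ) *ᵥ vhat φ (act ((realMat M)ᵀ)⁻¹ ξ)) i := by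
  have hA := det_realMat_ne_zero hM
  set ζ := act ((realMat M)ᵀ)⁻¹ ξ with hζ
  have hint : ∀ k p, Integrable fun x => aff (realMat M) (latt k) (φ p) x * chi x ξ := by
    intro k p
    refine integrable_mul_of_compact (((hφc p).aff hA _).integrable (memLp_aff (hφ p) hA _))
      ((hφc p).aff hA _) ?_
    unfold chi; fun_prop
  have hs : ((Real.sqrt |(realMat M).det| : ℝ) : ℂ) *
      (((Real.sqrt |(realMat M).det|)⁻¹ : ℝ) : ℂ) = 1 := by
    rw [← Complex.ofReal_mul, mul_inv_cancel₀ (Real.sqrt_pos.2 (abs_pos.2 hA)).ne',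
      Complex.ofReal_one]
  rw [hat_eq]
  simp only [combine, Finset.sum_mul, mul_assoc]
  rw [integral_finsetSum _ fun k _ => integrable_finsetSum _ fun p _ =>
    ((hint k p).const_mul _).const_mul _]
  simp only [Matrix.mulVec, dotProduct, vhat]
  have hsym : ∀ p, symbol u ζ i p = ∑ k ∈ u.support, chi (latt k) ζ * u k i p := by
    intro p
    rw [symbol_eq_sum, Finsupp.sum, Matrix.sum_apply]
    rfl
  simp only [hsym, Finset.sum_mul]
  rw [Finset.sum_comm (s := Finset.univ)]
  refine Finset.sum_congr rfl fun k _ => ?_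
  rw [integral_finsetSum _ fun p _ => ((hint k p).const_mul _).const_mul _]
  refine Finset.sum_congr rfl fun p _ => ?_
  rw [integral_const_mul, integral_const_mul, ← hat_eq,
    hat_aff hA _ ((hφc p).integrable (hφ p))]
  linear_combination (u k i p * (chi (latt k) ζ * hat (φ p) ζ)) * hs

/-- A refinable vector is recovered from its refinement filter. -/
lemma combine_ae_eq (hM : M.det ≠ 0) {a : Filt d (Matrix (Fin r) (Fin r) ℂ)}
    (hφ : ∀ p, MemLp (φ p) 2 volume) (hφc : ∀ p, IsCompactlySupported (φ p))
    (href : ∀ ξ, vhat φ (act (realMat M)ᵀ ξ) = symbol a ξ *ᵥ vhat φ ξ) (p : Fin r) :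
    φ p =ᵐ[volume] combine M a φ p := by
  have hi1 := (hφc p).integrable (hφ p)
  have hi2 := (isCompactlySupported_combine (u := a) hM hφc p).integrable (memLp_combine hM hφ p)
  have h0 : ∀ ξ, hat (fun x => φ p x - combine M a φ p x) ξ = 0 := by
    intro ξ
    have h1 : hat (fun x => φ p x - combine M a φ p x) ξ
        = hat (φ p) ξ - hat (combine M a φ p) ξ := by
      have hchi : Continuous fun x : Rd d => chi x ξ := by unfold chi; fun_prop
      simp only [hat_eq, sub_mul]
      exact integral_sub (integrable_mul_of_compact hi1 (hφc p) hchi)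
        (integrable_mul_of_compact hi2 (isCompactlySupported_combine hM hφc p) hchi)
    rw [h1, hat_combine hM hφ hφc, ← href, act_transpose_inv_cancel hM, vhat, sub_self]
  filter_upwards [ae_eq_zero_of_hat_eq_zero (hi1.sub hi2) h0] with x hx
  exact sub_eq_zero.1 hx

end Refinement

/-! ### Overlaps of supports across scales -/

section Overlap

variable {d : ℕ} {M : Matrix (Fin d) (Fin d) ℤ}

/-- `f` vanishes almost everywhere outside the ball of radius `ρ` about the origin. -/
def SuppBall (ρ : ℝ) (f : Rd d → ℂ) : Prop := ∀ᵐ x, f x ≠ 0 → ‖x‖ ≤ ρ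

lemma IsCompactlySupported.exists_suppBall {f : Rd d → ℂ} (hf : IsCompactlySupported f) :
    ∃ ρ, SuppBall ρ f := by
  obtain ⟨K, hK, hKf⟩ := hf
  obtain ⟨ρ, hρ⟩ := hK.isBounded.exists_norm_le
  refine ⟨ρ, ?_⟩
  filter_upwards [hKf] with x hx h
  exact hρ x (by_contra fun h' => h (hx h'))

lemma SuppBall.mono {ρ ρ' : ℝ} {f : Rd d → ℂ} (h : SuppBall ρ f) (hρ : ρ ≤ ρ') :
    SuppBall ρ' f := by
  filter_upwards [h] with x hx h0
  exact (hx h0).trans hρ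

lemma SuppBall.congr {ρ : ℝ} {f g : Rd d → ℂ} (h : SuppBall ρ f) (hfg : f =ᵐ[volume] g) :
    SuppBall ρ g := by
  filter_upwards [h, hfg] with x hx h0
  rwa [← h0]

lemma exists_common_suppBall {ι : Type*} [Fintype ι] {f : ι → Rd d → ℂ}
    (hf : ∀ i, IsCompactlySupported (f i)) : ∃ ρ, ∀ i, SuppBall ρ (f i) := by
  choose ρ hρ using fun i => (hf i).exists_suppBall
  obtain ⟨R, hR⟩ := (Set.finite_range ρ).bddAbove
  exact ⟨R, fun i => (hρ i).mono (hR ⟨i, rfl⟩)⟩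

lemma SuppBall.aff {ρ : ℝ} {f : Rd d → ℂ} (h : SuppBall ρ f) {A : Matrix (Fin d) (Fin d) ℝ}
    (hA : A.det ≠ 0) (t : Rd d) :
    ∀ᵐ x, aff A t f x ≠ 0 → ‖act A x - t‖ ≤ ρ := by
  filter_upwards [(quasiMeasurePreserving_affine hA t).ae h] with x hx h0
  exact hx fun h' => h0 (by rw [Framelet.aff, h', mul_zero])

lemma SuppBall.U_pow_τ (hM : M.det ≠ 0) {ρ : ℝ} {f : L2 d} (h : SuppBall ρ f) (J : ℕ)
    (k : Zd d) : ∀ᵐ x, ((multiScale hM).U ^ J) ((multiScale hM).τ k f) x ≠ 0 →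
      ‖act (realMat M ^ J) x - latt k‖ ≤ ρ := by
  have hJ : (realMat M ^ J).det ≠ 0 := by
    rw [Matrix.det_pow]; exact pow_ne_zero _ (det_realMat_ne_zero hM)
  rw [multiScale_apply]
  filter_upwards [h.aff hJ (latt k), coeFn_affL hJ (latt k) f] with x hx h0
  rwa [h0]

lemma exists_of_inner_ne_zero {f g : L2 d} {P Q : Rd d → Prop} (hf : ∀ᵐ x, f x ≠ 0 → P x)
    (hg : ∀ᵐ x, g x ≠ 0 → Q x) (h : (inner ℂ f g : ℂ) ≠ 0) : ∃ x, P x ∧ Q x := by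
  by_contra! hno
  refine h ?_
  rw [L2.inner_def]
  refine integral_eq_zero_of_ae ?_
  filter_upwards [hf, hg] with x h1 h2
  by_cases h3 : f x = 0
  · rw [h3]; simp
  · by_cases h4 : g x = 0
    · rw [h4]; simp
    · exact absurd (h2 h4) (hno x (h1 h3))

/-- At any scale, two shifts of functions supported in a fixed ball meet the support of a common
dilate only if the shifts are close: inverse powers of `M` are uniformly bounded. -/
lemma exists_overlap (hM : IsDilation M) (ρ : ℝ) : ∃ K : Finset (Zd d), ∀ η f g : L2 d,
    SuppBall ρ η → SuppBall ρ f → SuppBall ρ g → ∀ (J : ℕ), ∀ k ∉ K, ∀ l,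
      inner ℂ (((multiScale hM.det_ne_zero).U ^ J) ((multiScale hM.det_ne_zero).τ l η)) f = 0 ∨
      inner ℂ (((multiScale hM.det_ne_zero).U ^ J) ((multiScale hM.det_ne_zero).τ l η))
        ((multiScale hM.det_ne_zero).τ k g) = 0 := by
  obtain ⟨c, hc0, hc, hcM⟩ := hM.exists_norm_act_inv_pow_le
  obtain ⟨C, hC⟩ := hc.bddAbove_range
  refine ⟨(finite_latt_ball d (C * (ρ + ρ) + (ρ + ρ))).toFinset, fun η f g hη hf hg J k hk l => ?_⟩
  by_contra! hne
  have hJ : (realMat M ^ J).det ≠ 0 := by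
    rw [Matrix.det_pow]; exact pow_ne_zero _ (det_realMat_ne_zero hM.det_ne_zero)
  have hτ := hg.U_pow_τ hM.det_ne_zero 0 k
  simp only [pow_zero, act_one] at hτ
  obtain ⟨x, hx1, hx2⟩ := exists_of_inner_ne_zero (hη.U_pow_τ hM.det_ne_zero J l) hf hne.1
  obtain ⟨y, hy1, hy2⟩ := exists_of_inner_ne_zero (hη.U_pow_τ hM.det_ne_zero J l) hτ hne.2
  apply hk
  rw [Set.Finite.mem_toFinset]
  have h1 : ‖y - x‖ ≤ C * (ρ + ρ) := by
    have h2 : y - x = act (realMat M ^ J)⁻¹ ((act (realMat M ^ J) y - latt l)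
        - (act (realMat M ^ J) x - latt l)) := by
      rw [sub_sub_sub_cancel_right, ← act_sub, act_inv_act hJ]
    have h3 : 0 ≤ ρ + ρ := by linarith [norm_nonneg x]
    rw [h2]
    refine (hcM J _).trans ((mul_le_mul_of_nonneg_left ?_ (hc0 J)).trans
      (mul_le_mul_of_nonneg_right (hC ⟨J, rfl⟩) h3))
    exact (norm_sub_le _ _).trans (add_le_add hy1 hx1)
  calc ‖latt k‖ = ‖(y - x) + (x - (y - latt k))‖ := by congr 1; abel
    _ ≤ ‖y - x‖ + (‖x‖ + ‖y - latt k‖) :=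
      (norm_add_le _ _).trans (add_le_add le_rfl (norm_sub_le _ _))
    _ ≤ _ := add_le_add h1 (add_le_add hx2 hy2)

/-- Only finitely many elements of a given scale meet a given compact set. -/
lemma exists_finset_inner_eq_zero (hM : M.det ≠ 0) (ρ : ℝ) (J : ℕ) :
    ∃ F : Finset (Zd d), ∀ η f : L2 d, SuppBall ρ η → SuppBall ρ f → ∀ k ∉ F,
      inner ℂ (((multiScale hM).U ^ J) ((multiScale hM).τ k η)) f = 0 := by
  refine ⟨(finite_latt_ball d (ρ + (∑ i, ∑ j, |(realMat M ^ J) i j|) * ρ)).toFinset,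
    fun η f hη hf k hk => ?_⟩
  by_contra hne
  obtain ⟨x, hx1, hx2⟩ := exists_of_inner_ne_zero (hη.U_pow_τ hM J k) hf hne
  apply hk
  rw [Set.Finite.mem_toFinset]
  calc ‖latt k‖ = ‖act (realMat M ^ J) x - (act (realMat M ^ J) x - latt k)‖ := by
        congr 1; abel
    _ ≤ ‖act (realMat M ^ J) x - latt k‖ + ‖act (realMat M ^ J) x‖ := by
        rw [add_comm]; exact norm_sub_le _ _
    _ ≤ _ := add_le_add hx1 ((norm_act_le _ x).trans (mul_le_mul_of_nonneg_left hx2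
        (Finset.sum_nonneg fun _ _ => Finset.sum_nonneg fun _ _ => abs_nonneg _)))

/-- The shifts of a compactly supported function form a Bessel family. -/
lemma exists_isBessel_shifts (hM : IsDilation M) {ρ : ℝ} {η : L2 d} (hη : SuppBall ρ η) :
    ∃ B, 0 ≤ B ∧ IsBessel (fun l => (multiScale hM.det_ne_zero).τ l η) B := by
  obtain ⟨K, hK⟩ := exists_overlap hM ρ
  refine ⟨K.card * ‖η‖ ^ 2, by positivity,
    MultiScale.isBessel_τ (multiScale hM.det_ne_zero) K fun k hk => ?_⟩
  rcases hK η η η hη hη hη 0 k hk 0 with h | h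
  · rw [pow_zero, MultiScale.τ_zero] at h
    have h0 : η = 0 := inner_self_eq_zero.1 h
    rw [h0, inner_zero_left]
  · rwa [pow_zero, MultiScale.τ_zero] at h

end Overlap

/-! ### The energy of the fine scales -/

section FineScales

variable {d : ℕ} {M : Matrix (Fin d) (Fin d) ℤ}

/-- The componentwise integer part. -/
def floorVec (x : Rd d) : Zd d := fun i => ⌊x i⌋

lemma measurable_floorVec : Measurable (floorVec (d := d)) :=
  measurable_pi_lambda _ fun i => Int.measurable_floor.comp (by fun_prop)

lemma norm_sub_floorVec_le (x : Rd d) : ‖x - latt (floorVec x)‖ ≤ d := by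
  have h1 : x - latt (floorVec x) = ∑ i, PiLp.single 2 i (Int.fract (x i)) := by
    ext j
    simp [latt_apply, floorVec, Pi.single_apply]
  rw [h1]
  refine (norm_sum_le_of_le _ fun i _ => ?_).trans (b := ∑ _i : Fin d, (1 : ℝ)) (by simp)
  rw [PiLp.norm_single, Real.norm_of_nonneg (Int.fract_nonneg _)]
  exact (Int.fract_lt_one _).le

/-- Each lattice cube has unit volume. -/
lemma map_floorVec : Measure.map (floorVec (d := d)) volume = Measure.count := by
  refine Measure.ext_of_singleton fun k => ?_
  rw [Measure.map_apply measurable_floorVec (measurableSet_singleton k), Measure.count_singleton]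
  have h1 : floorVec ⁻¹' {k} = WithLp.ofLp (p := 2) (V := Fin d → ℝ) ⁻¹'
      (Set.pi Set.univ fun i => Set.Ico (k i : ℝ) (k i + 1)) := by
    ext x
    simp [floorVec, funext_iff, Int.floor_eq_iff]
  rw [h1, (PiLp.volume_preserving_ofLp (Fin d)).measure_preimage
    (MeasurableSet.univ_pi fun _ => measurableSet_Ico).nullMeasurableSet, Real.volume_pi_Ico]
  simp

lemma map_floorVec_act {A : Matrix (Fin d) (Fin d) ℝ} (hA : A.det ≠ 0) :
    Measure.map (fun x => floorVec (act A x)) volume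
      = ENNReal.ofReal |A.det|⁻¹ • Measure.count := by
  have h1 := map_affine hA (0 : Rd d)
  simp only [sub_zero] at h1
  rw [← map_floorVec, ← Measure.map_smul, ← h1,
    Measure.map_map measurable_floorVec (continuous_act A).measurable]
  rfl

/-- The energy of the coefficients of a continuous function against the `J`-th dilates of the
shifts of `η` tends to `|∫ η|² ‖f‖²`. -/
theorem tendsto_level_energy (hM : IsDilation M) {η : Rd d → ℂ} (hη : MemLp η 2 volume)
    (hηc : IsCompactlySupported η) {f : Rd d → ℂ} (hf : Continuous f) (hfc : HasCompactSupport f)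
    (hf2 : MemLp f 2 volume) :
    Tendsto (fun J => ∑' k, ‖inner ℂ (((multiScale hM.det_ne_zero).U ^ J)
      ((multiScale hM.det_ne_zero).τ k hη.toLp)) hf2.toLp‖ ^ 2) atTop
      (𝓝 (‖∫ x, η x‖ ^ 2 * ‖hf2.toLp‖ ^ 2)) := by
  obtain ⟨c, hc0, hc, hcM⟩ := hM.exists_norm_act_inv_pow_le
  obtain ⟨C, hC⟩ := hc.bddAbove_range
  have hC0 : 0 ≤ C := (hc0 0).trans (hC ⟨0, rfl⟩)
  have hdet : ∀ J : ℕ, (realMat M ^ J).det ≠ 0 := fun J => by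
    rw [Matrix.det_pow]; exact pow_ne_zero _ (det_realMat_ne_zero hM.det_ne_zero)
  have hη1 := hηc.integrable hη
  obtain ⟨Cf, hCf⟩ := hf.bounded_above_of_compact_support hfc
  have hCf0 : 0 ≤ Cf := (norm_nonneg _).trans (hCf 0)
  obtain ⟨ρ, hρη⟩ := hηc.exists_suppBall
  obtain ⟨ρf, hρf⟩ := hfc.isCompact.isBounded.exists_norm_le
  have hρf' : ∀ x, f x ≠ 0 → ‖x‖ ≤ ρf := fun x hx => hρf x (subset_tsupport f hx)
  -- the rescaled coefficients
  let G : ℕ → Zd d → ℂ := fun J k => ∫ y, conj (η y) * f (act (realMat M ^ J)⁻¹ (y + latt k))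
  have hcoef : ∀ J k, inner ℂ (((multiScale hM.det_ne_zero).U ^ J)
      ((multiScale hM.det_ne_zero).τ k hη.toLp)) hf2.toLp
      = (((Real.sqrt |(realMat M ^ J).det|)⁻¹ : ℝ) : ℂ) * G J k := by
    intro J k
    rw [multiScale_apply, affL_toLp, ← ip_eq_inner hf2.coeFn_toLp (MemLp.coeFn_toLp _), ip]
    have h1 : ∀ x, f x * conj (aff (realMat M ^ J) (latt k) η x)
        = ((Real.sqrt |(realMat M ^ J).det| : ℝ) : ℂ) *
          (fun y => conj (η y) * f (act (realMat M ^ J)⁻¹ (y + latt k)))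
            (act (realMat M ^ J) x - latt k) := by
      intro x
      simp only [aff, sub_add_cancel, act_inv_act (hdet J), map_mul, Complex.conj_ofReal]
      ring
    have h2 : AEStronglyMeasurable
        (fun y => conj (η y) * f (act (realMat M ^ J)⁻¹ (y + latt k))) volume :=
      (Complex.continuous_conj.comp_aestronglyMeasurable hη.1).mul
        (hf.comp ((continuous_act _).comp (continuous_add_const _))).aestronglyMeasurable
    simp only [h1]
    rw [integral_const_mul, integral_affine (hdet J) _ h2, ← mul_assoc, ← Complex.ofReal_mul]
    congr 2
    have h4 : 0 < Real.sqrt |(realMat M ^ J).det| := Real.sqrt_pos.2 (abs_pos.2 (hdet J))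
    nth_rewrite 2 [← Real.mul_self_sqrt (abs_nonneg (realMat M ^ J).det)]
    field_simp
  -- the argument of `f` is close to `x`
  have hclose : ∀ J (x y : Rd d), ‖act (realMat M ^ J)⁻¹
      (y + latt (floorVec (act (realMat M ^ J) x))) - x‖ ≤ c J * (‖y‖ + d) := by
    intro J x y
    set z := act (realMat M ^ J) x with hz
    have h1 : act (realMat M ^ J)⁻¹ (y + latt (floorVec z)) - x
        = act (realMat M ^ J)⁻¹ (y - (z - latt (floorVec z))) := by
      conv_lhs => rw [← act_inv_act (hdet J) x, ← act_sub, ← hz]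
      congr 1
      abel
    rw [h1]
    refine (hcM J _).trans (mul_le_mul_of_nonneg_left ?_ (hc0 J))
    exact (norm_sub_le _ _).trans (add_le_add le_rfl (norm_sub_floorVec_le z))
  set R := ρf + C * (ρ + d) with hR
  set b := ((∫ y, ‖η y‖) * Cf) ^ 2 with hb
  have hGle : ∀ J k, ‖G J k‖ ≤ (∫ y, ‖η y‖) * Cf := by
    intro J k
    rw [← integral_mul_const]
    refine norm_integral_le_of_norm_le (hη1.norm.mul_const _) (Eventually.of_forall fun y => ?_)
    rw [norm_mul, RCLike.norm_conj]
    exact mul_le_mul_of_nonneg_left (hCf _) (norm_nonneg _)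
  have hbound : ∀ J x, ‖‖G J (floorVec (act (realMat M ^ J) x))‖ ^ 2‖
      ≤ (Metric.closedBall (0 : Rd d) R).indicator (fun _ => b) x := by
    intro J x
    rw [Real.norm_of_nonneg (by positivity)]
    by_cases hx : x ∈ Metric.closedBall (0 : Rd d) R
    · rw [Set.indicator_of_mem hx, hb]
      exact pow_le_pow_left₀ (norm_nonneg _) (hGle J _) 2
    · rw [Set.indicator_of_notMem hx]
      have h0 : G J (floorVec (act (realMat M ^ J) x)) = 0 := by
        refine integral_eq_zero_of_ae ?_
        filter_upwards [hρη] with y hy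
        by_contra hne
        rw [Pi.zero_apply, mul_eq_zero, not_or] at hne
        have h1 := hy fun h => hne.1 (by rw [h, map_zero])
        have h2 := hρf' _ hne.2
        refine hx (mem_closedBall_zero_iff.2 ?_)
        have h3 := hclose J x y
        have h4 : c J * (‖y‖ + d) ≤ C * (ρ + d) :=
          mul_le_mul (hC ⟨J, rfl⟩) (by linarith) (by positivity) hC0
        rw [norm_sub_rev] at h3
        have h5 := norm_le_insert' x (act (realMat M ^ J)⁻¹
          (y + latt (floorVec (act (realMat M ^ J) x))))
        rw [hR]
        linarith
      rw [h0]; simp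
  have hbint : Integrable ((Metric.closedBall (0 : Rd d) R).indicator fun _ => b) :=
    (integrable_indicator_iff measurableSet_closedBall).2
      (integrableOn_const (isCompact_closedBall _ _).measure_lt_top.ne)
  have hmeas : ∀ J, Measurable fun x : Rd d => floorVec (act (realMat M ^ J) x) := fun J =>
    measurable_floorVec.comp (continuous_act _).measurable
  have hFmeas : ∀ J, AEStronglyMeasurable
      (fun x => ‖G J (floorVec (act (realMat M ^ J) x))‖ ^ 2) volume := fun J =>
    ((Measurable.of_discrete (f := fun k => ‖G J k‖ ^ 2)).comp (hmeas J)).aestronglyMeasurable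
  have hsum : ∀ J, ∑' k, ‖inner ℂ (((multiScale hM.det_ne_zero).U ^ J)
      ((multiScale hM.det_ne_zero).τ k hη.toLp)) hf2.toLp‖ ^ 2
      = ∫ x, ‖G J (floorVec (act (realMat M ^ J) x))‖ ^ 2 := by
    intro J
    have hm : AEStronglyMeasurable (fun k => ‖G J k‖ ^ 2)
        (Measure.map (fun x => floorVec (act (realMat M ^ J) x)) volume) :=
      Measurable.of_discrete.aestronglyMeasurable
    have hint : Integrable (fun k => ‖G J k‖ ^ 2)
        (Measure.map (fun x => floorVec (act (realMat M ^ J) x)) volume) :=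
      (integrable_map_measure hm (hmeas J).aemeasurable).2
        (hbint.mono' (hFmeas J) (Eventually.of_forall (hbound J)))
    rw [← integral_map (hmeas J).aemeasurable hm, integral_countable hint]
    refine tsum_congr fun k => ?_
    rw [map_floorVec_act (hdet J), hcoef, norm_mul, mul_pow, Complex.norm_real, Real.norm_eq_abs,
      sq_abs, inv_pow, Real.sq_sqrt (abs_nonneg _), smul_eq_mul]
    congr 1
    simp [Measure.real]
  simp only [hsum]
  have hlim : ‖∫ x, η x‖ ^ 2 * ‖hf2.toLp‖ ^ 2 = ∫ x, ‖conj (∫ y, η y) * f x‖ ^ 2 := by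
    simp only [norm_mul, mul_pow, RCLike.norm_conj]
    rw [integral_const_mul]
    congr 1
    have h1 := inner_self_eq_norm_sq_to_K (𝕜 := ℂ) hf2.toLp
    rw [← ip_eq_inner hf2.coeFn_toLp hf2.coeFn_toLp, ip] at h1
    have h2 : ∫ x, f x * conj (f x) = ((∫ x, ‖f x‖ ^ 2 : ℝ) : ℂ) := by
      rw [← integral_complex_ofReal]
      refine integral_congr_ae (Eventually.of_forall fun x => ?_)
      simp only [RCLike.mul_conj]
      push_cast
      rfl
    rw [h2] at h1
    exact Complex.ofReal_injective (by rw [Complex.ofReal_pow]; exact h1.symm)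
  rw [hlim]
  refine tendsto_integral_of_dominated_convergence _ hFmeas hbint
    (fun J => Eventually.of_forall (hbound J)) (Eventually.of_forall fun x => ?_)
  refine Tendsto.pow (Tendsto.norm ?_) 2
  have h1 : conj (∫ y, η y) * f x = ∫ y, conj (η y) * f x := by
    rw [integral_mul_const, integral_conj]
  rw [h1]
  refine tendsto_integral_of_dominated_convergence (fun y => ‖η y‖ * Cf) (fun J => ?_)
    (hη1.norm.mul_const _) (fun J => Eventually.of_forall fun y => ?_)
    (Eventually.of_forall fun y => ?_)
  · exact (Complex.continuous_conj.comp_aestronglyMeasurable hη.1).mul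
      (hf.comp ((continuous_act _).comp (continuous_add_const _))).aestronglyMeasurable
  · rw [norm_mul, RCLike.norm_conj]
    exact mul_le_mul_of_nonneg_left (hCf _) (norm_nonneg _)
  · refine Tendsto.const_mul _ ((hf.tendsto x).comp ?_)
    rw [tendsto_iff_norm_sub_tendsto_zero]
    refine squeeze_zero (fun _ => norm_nonneg _) (fun J => hclose J x y) ?_
    simpa using hc.mul_const (‖y‖ + d)

/-- Continuous compactly supported functions are dense in `L²(ℝ^d)`. -/
lemma dense_continuous_compact (d : ℕ) : Dense {F : L2 d | ∃ (f : Rd d → ℂ)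
    (hf : MemLp f 2 volume), Continuous f ∧ HasCompactSupport f ∧ F = hf.toLp} := by
  rw [Metric.dense_iff]
  intro F ε hε
  obtain ⟨g, hgc, hg, hgcont, hg2⟩ := (Lp.memLp F).exists_hasCompactSupport_eLpNorm_sub_le
    (by norm_num) (ε := ENNReal.ofReal (ε / 2)) (by simpa using hε)
  refine ⟨hg2.toLp, ?_, g, hg2, hgcont, hgc, rfl⟩
  rw [Metric.mem_ball, dist_comm, dist_eq_norm]
  have h1 : F - hg2.toLp = ((Lp.memLp F).sub hg2).toLp := by
    rw [MemLp.toLp_sub (Lp.memLp F) hg2, Lp.toLp_coeFn]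
  rw [h1, Lp.norm_toLp]
  have h2 := ENNReal.toReal_mono ENNReal.ofReal_ne_top hg
  rw [ENNReal.toReal_ofReal (by positivity)] at h2
  linarith

/-- If `∫ η = 0`, the energy of the coefficients against the `J`-th dilates of the shifts of `η`
tends to zero for every function in `L²(ℝ^d)`. -/
lemma tendsto_norm_level (hM : IsDilation M) {η : Rd d → ℂ} (hη : MemLp η 2 volume)
    (hηc : IsCompactlySupported η) (h0 : ∫ x, η x = 0) {B : ℝ} (hB : 0 ≤ B)
    (hbes : IsBessel (fun l => (multiScale hM.det_ne_zero).τ l hη.toLp) B) (F : L2 d) :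
    Tendsto (fun J => ‖(multiScale hM.det_ne_zero).level hB hbes J F‖) atTop (𝓝 0) := by
  set S := multiScale hM.det_ne_zero with hS
  have hsq : ∀ J G, ‖S.level hB hbes J G‖ ^ 2
      = ∑' k, ‖inner ℂ ((S.U ^ J) (S.τ k hη.toLp)) G‖ ^ 2 := fun J G =>
    (hbes.map hB (S.U ^ J)).norm_analysis_sq G
  have hop : ∀ J G, ‖S.level hB hbes J G‖ ≤ Real.sqrt B * ‖G‖ := by
    intro J G
    refine abs_le_of_sq_le_sq' ?_ (by positivity) |>.2
    rw [hsq, mul_pow, Real.sq_sqrt hB]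
    exact (hbes.map hB (S.U ^ J)).tsum_le G
  rw [Metric.tendsto_atTop]
  intro ε hε
  set δ := ε / (2 * (Real.sqrt B + 1)) with hδ
  have hδ0 : 0 < δ := by positivity
  obtain ⟨G, hG, f, hf2, hf, hfc, rfl⟩ := Metric.dense_iff.1 (dense_continuous_compact d) F δ hδ0
  have h1 := tendsto_level_energy hM hη hηc hf hfc hf2
  rw [h0, norm_zero, zero_pow two_ne_zero, zero_mul] at h1
  simp only [← hS, ← hsq] at h1
  obtain ⟨N, hN⟩ := (Metric.tendsto_atTop.1 h1) ((ε / 2) ^ 2) (by positivity)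
  refine ⟨N, fun J hJ => ?_⟩
  have h2 := hN J hJ
  rw [dist_zero_right, Real.norm_of_nonneg (by positivity)] at h2
  have h3 : ‖S.level hB hbes J hf2.toLp‖ < ε / 2 := lt_of_pow_lt_pow_left₀ 2 (by positivity) h2
  rw [dist_zero_right, norm_norm]
  have h4 : ‖S.level hB hbes J (F - hf2.toLp)‖ ≤ Real.sqrt B * δ := by
    refine (hop J _).trans (mul_le_mul_of_nonneg_left ?_ (Real.sqrt_nonneg _))
    rw [← dist_eq_norm, dist_comm]
    exact hG.le
  have h5 : Real.sqrt B * δ ≤ ε / 2 := by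
    have : (Real.sqrt B + 1) * δ = ε / 2 := by rw [hδ]; field_simp
    nlinarith
  calc ‖S.level hB hbes J F‖
      = ‖S.level hB hbes J (F - hf2.toLp) + S.level hB hbes J hf2.toLp‖ := by
        rw [← map_add, sub_add_cancel]
    _ ≤ _ := norm_add_le _ _
    _ < ε := by linarith

end FineScales

/-! ### From Hilbert space expansions to quasi-tight framelets -/

section Convert

variable {H : Type*} [NormedAddCommGroup H] [InnerProductSpace ℂ H]

lemma norm_sq_le_tsum_of_hasSum {ι : Type*} {e : ι → H} {B : ℝ} (h : IsBessel e B) {σ : ι → ℂ}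
    (hσ : ∀ i, σ i = 1 ∨ σ i = -1) {f : H}
    (hf : HasSum (fun i => (σ i * inner ℂ (e i) f) • e i) f) :
    ‖f‖ ^ 2 ≤ ∑' i, ‖inner ℂ (e i) f‖ ^ 2 := by
  have h1 := (innerSL ℂ f).hasSum hf
  have hn : ∀ i, ‖innerSL ℂ f ((σ i * inner ℂ (e i) f) • e i)‖ = ‖inner ℂ (e i) f‖ ^ 2 := by
    intro i
    have h2 : ‖σ i‖ = 1 := by rcases hσ i with h | h <;> simp [h]
    rw [innerSL_apply_apply, inner_smul_right, norm_mul, norm_mul, h2, one_mul,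
      norm_inner_symm f (e i), sq]
  have h3 : ‖f‖ ^ 2 = ‖innerSL ℂ f f‖ := by
    rw [innerSL_apply_apply, inner_self_eq_norm_sq_to_K]
    simp
  rw [h3, ← h1.tsum_eq]
  refine (norm_tsum_le_tsum_norm ?_).trans_eq (tsum_congr hn)
  simpa only [Function.comp_def, hn] using h.summable f

variable {d r s : ℕ} {M : Matrix (Fin d) (Fin d) ℤ}

/-- A Bessel system with a signed expansion is a quasi-tight framelet; the expansion provides the
lower frame bound `1`. -/
lemma isQuasiTightFramelet_of_hasSum (hM : M.det ≠ 0) {φ : Fin r → Rd d → ℂ}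
    {ψ : Fin s → Rd d → ℂ} (hφ : ∀ ℓ, MemLp (φ ℓ) 2 volume) (hψ : ∀ ℓ, MemLp (ψ ℓ) 2 volume)
    {ε : Fin s → ℂ} (hε : ∀ l, ε l = 1 ∨ ε l = -1) {B : ℝ} (hB0 : 0 ≤ B)
    (hB : IsBessel
      ((multiScale hM).family (fun ℓ => (hφ ℓ).toLp) (fun ℓ => (hψ ℓ).toLp)) B)
    (hs : ∀ F : L2 d, HasSum (fun i : Idx d r s => (signs ε i * inner ℂ ((multiScale hM).family
      (fun ℓ => (hφ ℓ).toLp) (fun ℓ => (hψ ℓ).toLp) i) F) •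
      (multiScale hM).family (fun ℓ => (hφ ℓ).toLp) (fun ℓ => (hψ ℓ).toLp) i) F) :
    IsQuasiTightFramelet M φ ψ ε := by
  set e := (multiScale hM).family (fun ℓ => (hφ ℓ).toLp) (fun ℓ => (hψ ℓ).toLp) with he
  have hsys : ∀ i, e i =ᵐ[volume] system M φ ψ i := family_toLp hM hφ hψ
  have hip : ∀ {f : Rd d → ℂ} (hf : MemLp f 2 volume) i,
      ip f (system M φ ψ i) = inner ℂ (e i) hf.toLp := fun hf i =>
    ip_eq_inner hf.coeFn_toLp (hsys i)
  have hσ : ∀ i : Idx d r s, signs ε i = 1 ∨ signs ε i = -1 := by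
    rintro (i | ⟨j, l, k⟩)
    · exact Or.inl rfl
    · exact hε l
  have hnorm : ∀ {f : Rd d → ℂ} (hf : MemLp f 2 volume),
      eLpNorm f 2 volume ^ 2 = ENNReal.ofReal (‖hf.toLp‖ ^ 2) := fun {f} hf => by
    rw [ENNReal.ofReal_pow (norm_nonneg _), Lp.norm_toLp, ENNReal.ofReal_toReal hf.2.ne]
  have hen : ∀ {f : Rd d → ℂ} (hf : MemLp f 2 volume),
      ∑' i, ‖ip f (system M φ ψ i)‖ₑ ^ 2
        = ENNReal.ofReal (∑' i, ‖inner ℂ (e i) hf.toLp‖ ^ 2) := fun {f} hf => by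
    rw [ENNReal.ofReal_tsum_of_nonneg (fun _ => by positivity) (hB.summable _)]
    refine tsum_congr fun i => ?_
    rw [hip hf, ← ofReal_norm, ENNReal.ofReal_pow (norm_nonneg _)]
  refine ⟨hε, ⟨hφ, hψ, 1, B + 1, one_pos, by linarith, fun f hf => ?_⟩, fun f hf => ?_⟩
  · rw [hen hf, hnorm hf]
    constructor
    · rw [ENNReal.ofReal_one, one_mul]
      exact ENNReal.ofReal_le_ofReal (norm_sq_le_tsum_of_hasSum hB hσ (hs _))
    · rw [← ENNReal.ofReal_mul (by linarith)]
      refine ENNReal.ofReal_le_ofReal ((hB.tsum_le _).trans ?_)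
      gcongr
      linarith
  · have h1 : ∀ F : Finset (Idx d r s), eLpNorm (fun x => f x -
          ∑ i ∈ F, signs ε i * ip f (system M φ ψ i) * system M φ ψ i x) 2 volume
        = ENNReal.ofReal ‖∑ i ∈ F, (signs ε i * inner ℂ (e i) hf.toLp) • e i - hf.toLp‖ := by
      intro F
      rw [norm_sub_rev, Lp.norm_def, ENNReal.ofReal_toReal (Lp.eLpNorm_ne_top _)]
      refine eLpNorm_congr_ae ?_
      have h2 := eventuallyEq_sum_L2 (F := F)
        (f := fun i => ((signs ε i * inner ℂ (e i) hf.toLp) • e i : L2 d))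
        (g := fun i x => signs ε i * ip f (system M φ ψ i) * system M φ ψ i x) fun i _ => by
          filter_upwards [Lp.coeFn_smul (signs ε i * inner ℂ (e i) hf.toLp) (e i), hsys i]
            with x hx1 hx2
          rw [hx1, Pi.smul_apply, hx2, hip hf, smul_eq_mul]
      filter_upwards [h2, hf.coeFn_toLp, Lp.coeFn_sub hf.toLp
        (∑ i ∈ F, (signs ε i * inner ℂ (e i) hf.toLp) • e i), Lp.coeFn_fun_finsetSum F
        (fun i => (signs ε i * inner ℂ (e i) hf.toLp) • e i)] with x hx1 hx2 hx3 hx4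
      rw [hx3, Pi.sub_apply, hx2, hx4, hx1]
    simp only [h1]
    have h3 := tendsto_iff_norm_sub_tendsto_zero.1 (hs hf.toLp)
    simpa using ENNReal.tendsto_ofReal h3

end Convert

/-! ### The signed expansion for refinable functions -/

section Refinable

variable {d r s : ℕ} {M : Matrix (Fin d) (Fin d) ℤ}

lemma sq_sqrt_abs_det [Fintype (Cos M)] (hM : M.det ≠ 0) :
    Real.sqrt |(realMat M).det| ^ 2 = Fintype.card (Cos M) := by
  rw [Real.sq_sqrt (abs_nonneg _), ← Nat.card_eq_fintype_card, card_cos hM, realMat,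
    ← Int.cast_det (R := ℝ), Nat.cast_natAbs, Int.cast_abs]

/-- The filters `a`, `b` with the polyphase identity turn a refinable vector `φ` with
`‖φ̂(0)‖ = 1` into a quasi-tight framelet, provided the resulting `ψ` have mean zero. -/
theorem isQuasiTightFramelet_combine [Fintype (Cos M)] (hM : IsDilation M)
    {a : Filt d (Matrix (Fin r) (Fin r) ℂ)} {b : Filt d (Matrix (Fin s) (Fin r) ℂ)}
    {ε : Fin s → ℂ} (hε : ∀ l, ε l = 1 ∨ ε l = -1)
    (hab : PolyphaseIdentity hM.det_ne_zero a b ε) {φ : Fin r → Rd d → ℂ}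
    (hφ : ∀ p, MemLp (φ p) 2 volume) (hφc : ∀ p, IsCompactlySupported (φ p))
    (href : ∀ ξ, vhat φ (act (realMat M)ᵀ ξ) = symbol a ξ *ᵥ vhat φ ξ)
    (h1 : ∑ p, ‖∫ x, φ p x‖ ^ 2 = 1) (h0 : ∀ l, ∫ x, combine M b φ l x = 0) :
    IsQuasiTightFramelet M φ (combine M b φ) ε := by
  have hM0 := hM.det_ne_zero
  have hψ : ∀ l, MemLp (combine M b φ l) 2 volume := memLp_combine hM0 hφ
  have hψc : ∀ l, IsCompactlySupported (combine M b φ l) := isCompactlySupported_combine hM0 hφc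
  set S := multiScale hM0 with hS
  set φL : Fin r → L2 d := fun p => (hφ p).toLp with hφL
  set ψL : Fin s → L2 d := fun l => (hψ l).toLp with hψL
  have hrefL : ∀ p, φL p = ((Real.sqrt |(realMat M).det| : ℝ) : ℂ) •
      ∑ l ∈ a.support, ∑ p', a l p p' • S.U (S.τ l (φL p')) := by
    intro p
    rw [← toLp_combine hM0 hφ p]
    exact (MemLp.toLp_eq_toLp_iff _ _).2 (combine_ae_eq hM0 hφ hφc href p)
  have hψLeq : ∀ i, ψL i = ((Real.sqrt |(realMat M).det| : ℝ) : ℂ) •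
      ∑ l ∈ b.support, ∑ p', b l i p' • S.U (S.τ l (φL p')) := fun i =>
    toLp_combine hM0 hφ i
  -- all functions involved live in a common ball
  obtain ⟨ρ₁, hρ₁⟩ := exists_common_suppBall hφc
  obtain ⟨ρ₂, hρ₂⟩ := exists_common_suppBall hψc
  set ρ := max ρ₁ ρ₂ with hρ
  have hφρ : ∀ p, SuppBall ρ (φL p) := fun p =>
    ((hρ₁ p).mono (le_max_left _ _)).congr (hφ p).coeFn_toLp.symm
  have hψρ : ∀ l, SuppBall ρ (ψL l) := fun l =>
    ((hρ₂ l).mono (le_max_right _ _)).congr (hψ l).coeFn_toLp.symm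
  obtain ⟨K, hK⟩ := exists_overlap hM ρ
  have hbφ : ∀ p, ∃ B, IsBessel (fun l => S.τ l (φL p)) B := fun p => by
    obtain ⟨B, -, hB⟩ := exists_isBessel_shifts hM (hφρ p)
    exact ⟨B, hB⟩
  have hbψ : ∀ l, ∃ B, 0 ≤ B ∧ IsBessel (fun i : ℕ × Zd d => (S.U ^ i.1) (S.τ i.2 (ψL l))) B := by
    intro l
    obtain ⟨B, hB0, hB⟩ := exists_isBessel_shifts hM (hψρ l)
    have hKl : ∀ f g : L2 d, SuppBall ρ f → SuppBall ρ g → ∀ J, ∀ k ∉ K,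
        inner ℂ (S.level hB0 hB J f) (S.level hB0 hB J (S.τ k g)) = 0 := by
      intro f g hf hg J k hk
      rw [lp.inner_eq_tsum]
      refine (tsum_congr fun n => ?_).trans tsum_zero
      rw [MultiScale.level_apply, MultiScale.level_apply]
      rcases hK (ψL l) f g (hψρ l) hf hg J k hk n with h | h
      · rw [h, inner_zero_left]
      · rw [h, inner_zero_right]
    exact MultiScale.isBessel_of_refinable (hB := hB0) (hη := hB) hrefL (hψLeq l) K
      (fun J p p' k hk => hKl _ _ (hφρ p) (hφρ p') J k hk) K
      (fun J k hk => hKl _ _ (hψρ l) (hψρ l) J k hk)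
      (fun p => tendsto_norm_level hM (hψ l) (hψc l) (h0 l) hB0 hB (φL p))
  choose Bφ hBφ using hbφ
  choose Bψ hBψ0 hBψ using hbψ
  have hfam := S.isBessel_family hBφ hBψ
  have hfam' : IsBessel (S.family φL ψL) (|∑ p, Bφ p + ∑ l, Bψ l|) := fun f F =>
    (hfam f F).trans (mul_le_mul_of_nonneg_right (le_abs_self _) (by positivity))
  refine isQuasiTightFramelet_of_hasSum hM0 hφ hψ hε (abs_nonneg _) hfam' fun F => ?_
  refine hfam'.hasSum_of_quadratic (σ := signs ε) ?_ (dense_continuous_compact d) ?_ F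
  · rintro (i | ⟨j, l, k⟩)
    · exact Or.inl rfl
    · exact hε l
  · rintro _ ⟨f, hf2, hf, hfc, rfl⟩
    have hfc' : IsCompactlySupported f :=
      ⟨tsupport f, hfc, Eventually.of_forall fun x hx => image_eq_zero_of_notMem_tsupport hx⟩
    obtain ⟨ρ₃, hρ₃⟩ := hfc'.exists_suppBall
    refine S.quadratic_family hε hab (sq_sqrt_abs_det hM0) hrefL hψLeq hfam' hf2.toLp
      (fun J => ?_) ?_
    · obtain ⟨F, hF⟩ := exists_finset_inner_eq_zero hM0 (max ρ ρ₃) J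
      refine ⟨F, fun p n hn => hF _ _ ((hφρ p).mono (le_max_left _ _))
        ((hρ₃.mono (le_max_right _ _)).congr hf2.coeFn_toLp.symm) n hn⟩
    · have h2 := tendsto_finsetSum Finset.univ fun p (_ : p ∈ Finset.univ) =>
        tendsto_level_energy hM (hφ p) (hφc p) hf hfc hf2
      rwa [← Finset.sum_mul, h1, one_mul] at h2

end Refinable

/-! ### Matching conditions at the origin -/

section Matching

variable {d r : ℕ} {φ : Fin r → Rd d → ℂ}

lemma norm_hat_le (f : Rd d → ℂ) (ξ : Rd d) : ‖hat f ξ‖ ≤ ∫ x, ‖f x‖ := by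
  rw [hat_eq]
  refine (norm_integral_le_integral_norm _).trans_eq (integral_congr_ae ?_)
  exact Eventually.of_forall fun x => by simp [norm_chi]

lemma isBigO_one_hat {f : Rd d → ℂ} : hat f =O[𝓝 0] fun _ => (1 : ℝ) :=
  IsBigO.of_bound (∫ x, ‖f x‖) (Eventually.of_forall fun ξ => by
    rw [norm_one, mul_one]; exact norm_hat_le f ξ)

lemma trigApprox_shifted_hat {M : Matrix (Fin d) (Fin d) ℤ} (K : ℕ) {f : Rd d → ℂ}
    (hf : Integrable f) (hc : IsCompactlySupported f) (t : Rd d) :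
    TrigApprox K fun ζ => chi t (act ((realMat M)ᵀ)⁻¹ ζ) * hat f (act ((realMat M)ᵀ)⁻¹ ζ) := by
  have h1 := TrigApprox.integral_chi K hf hc (y := fun x => act (realMat M)⁻¹ (t + x))
    ((continuous_act _).comp (continuous_const_add _))
  have h2 : ∀ ζ, ∫ x, f x * chi (act (realMat M)⁻¹ (t + x)) ζ
      = chi t (act ((realMat M)ᵀ)⁻¹ ζ) * hat f (act ((realMat M)ᵀ)⁻¹ ζ) := by
    intro ζ
    rw [hat_eq, ← integral_const_mul]
    refine integral_congr_ae (Eventually.of_forall fun x => ?_)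
    simp only [chi_act, Matrix.transpose_nonsing_inv, chi_add_left]
    ring
  simpa only [h2] using h1

lemma normSqHat_eq_sum (ξ : Rd d) :
    ((normSqHat φ ξ : ℝ) : ℂ) = ∑ p, star (hat (φ p) ξ) * hat (φ p) ξ := by
  rw [normSqHat, Complex.ofReal_sum]
  refine Finset.sum_congr rfl fun p _ => ?_
  rw [Complex.star_def, RCLike.conj_mul, Complex.ofReal_pow]
  rfl

lemma EqMod.normSqHat_complex {n : ℕ} (h : EqMod n (normSqHat φ) (fun _ => 1)) :
    EqMod n (fun ξ => ((normSqHat φ ξ : ℝ) : ℂ)) (fun _ => 1) := by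
  refine IsBigO.of_norm_left (IsBigO.congr_left (IsBigO.norm_left h) fun ξ => ?_)
  rw [← Complex.ofReal_one, ← Complex.ofReal_sub, Complex.norm_real]

lemma EqMod.apply_zero {n : ℕ} (hn : n ≠ 0) {V : Type} [NormedAddCommGroup V] {f g : Rd d → V}
    (h : EqMod n f g) : f 0 = g 0 := by
  have h1 := h.eq_zero_imp.self_of_nhds
  refine sub_eq_zero.1 (h1 ?_)
  simp [hn]

/-- If `v` is the normalized dual of `φ̂` and `‖φ̂‖² = 1`, both modulo `O(‖ξ‖^m)`, then `v` is the
adjoint of `φ̂` modulo `O(‖ξ‖^m)`. -/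
lemma eqMod_star_hat {m : ℕ} (hm : m ≠ 0) {w : Rd d → Fin r → ℂ}
    (hw : EqMod m w (fun ξ => ((normSqHat φ ξ : ℝ) : ℂ)⁻¹ • star (vhat φ ξ)))
    (h1 : EqMod m (normSqHat φ) (fun _ => 1)) (p : Fin r) :
    EqMod m (fun ξ => w ξ p) (fun ξ => star (hat (φ p) ξ)) := by
  have h2 := h1.normSqHat_complex
  have ht : Tendsto (fun ξ => ((normSqHat φ ξ : ℝ) : ℂ)) (𝓝 0) (𝓝 1) := by
    have h3 : Tendsto (fun ξ : Rd d => ‖ξ‖ ^ m) (𝓝 0) (𝓝 0) := by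
      have : Continuous fun ξ : Rd d => ‖ξ‖ ^ m := by fun_prop
      simpa [hm] using this.tendsto 0
    have h4 := (IsBigO.trans_tendsto h2 h3).add_const 1
    simpa using h4
  have hti := ht.inv₀ one_ne_zero
  have h5 : EqMod m (fun ξ => ((normSqHat φ ξ : ℝ) : ℂ)⁻¹) (fun _ => 1) := by
    have h6 := IsBigO.mul (hti.isBigO_one ℝ) h2.symm
    simp only [one_mul] at h6
    refine IsBigO.congr' h6 ?_ EventuallyEq.rfl
    filter_upwards [ht.eventually_ne one_ne_zero] with ξ hξ
    rw [mul_sub, inv_mul_cancel₀ hξ, mul_one]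
  have h7 := h5.mul (EqMod.refl fun ξ => star (hat (φ p) ξ)) (hti.isBigO_one ℝ)
    (by simpa using (isBigO_one_hat (f := φ p)).norm_left)
  exact ((hw.apply p).trans h7).congr_right fun ξ => one_mul _

end Matching

end Framelet

end

/-! ### The quasi-tight framelet -/

theorem mainTheorem4 {d r m n : ℕ} (hm : 1 ≤ m) (hn : 2 * m ≤ n) (hr : 2 ≤ r)
    (M N : Matrix (Fin d) (Fin d) ℤ) (hM : Framelet.IsDilation M) (hN : N.det.natAbs = r)
    (κ : Fin r → Framelet.Zd d) (hκ : Framelet.IsCosetEnum N κ)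
    (a : Framelet.Filt d (Matrix (Fin r) (Fin r) ℂ))
    (φ : Fin r → Framelet.Rd d → ℂ)
    (hφ : ∀ ℓ, MemLp (φ ℓ) 2 volume) (hφc : ∀ ℓ, Framelet.IsCompactlySupported (φ ℓ))
    (haφ : Framelet.IsBalancedRefinementFilter M N κ m a φ)
    (v : Framelet.Filt d (Fin r → ℂ)) (hv : Framelet.HasBalancedSumRules M N κ m a v)
    (hvφ : Framelet.EqMod m (Framelet.symbol v)
      (fun ξ => ((Framelet.normSqHat φ ξ : ℝ) : ℂ)⁻¹ • star (Framelet.vhat φ ξ)))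
    (hφN : Framelet.IsBalancedRow N κ m
      (fun ξ => ((Framelet.normSqHat φ ξ : ℝ) : ℂ)⁻¹ • star (Framelet.vhat φ ξ)))
    (hφn : Framelet.EqMod n (Framelet.normSqHat φ) (fun _ => 1)) :
    ∃ s : ℕ, 1 ≤ s ∧ ∃ (b : Framelet.Filt d (Matrix (Fin s) (Fin r) ℂ)) (ε : Fin s → ℂ),
      Framelet.IsQuasiTightFilterBank M a b ε ∧
      ∃ ψ : Fin s → Framelet.Rd d → ℂ,
        (∀ ℓ, MemLp (ψ ℓ) 2 volume) ∧ (∀ ℓ, Framelet.IsCompactlySupported (ψ ℓ)) ∧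
        (∀ ξ, Framelet.vhat ψ ξ =
          Framelet.symbol b (Framelet.act ((Framelet.realMat M)ᵀ)⁻¹ ξ) *ᵥ
            Framelet.vhat φ (Framelet.act ((Framelet.realMat M)ᵀ)⁻¹ ξ)) ∧
        Framelet.IsQuasiTightFramelet M φ ψ ε ∧
        ∀ ℓ, Framelet.HasVanishingMoments m (ψ ℓ) := by
  classical
  have hM0 := hM.det_ne_zero
  have hm0 : m ≠ 0 := by omega
  have : Finite (Framelet.Cos M) := Framelet.finite_cos hM0
  have : Fintype (Framelet.Cos M) := Fintype.ofFinite _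
  have hint : ∀ p, Integrable (φ p) := fun p => (hφc p).integrable (hφ p)
  -- since `‖φ̂‖² ≡ 1`, the matching filter agrees with `φ̂*`, which thus satisfies the sum rules
  have hstar : ∀ p, Framelet.EqMod m (fun ξ => Framelet.symbol v ξ p)
      (fun ξ => star (Framelet.hat (φ p) ξ)) :=
    Framelet.eqMod_star_hat hm0 hvφ (hφn.mono (by omega))
  obtain ⟨s, b, ε, hs, hε, hab, hvan⟩ := Framelet.exists_highpass (m := m) hM0 a
    (fun p => Framelet.hat (φ p)) (fun p => Framelet.isBigO_one_hat)
    (fun ξ ℓ => by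
      have h1 := congrFun (haφ.1 ξ) ℓ
      simp only [Framelet.symbol_entry]
      exact h1)
    (fun g p => Framelet.trigApprox_shifted_hat _ (hint p) (hφc p) _)
    ((hφn.mono (by omega)).normSqHat_complex.congr_left fun ξ => Framelet.normSqHat_eq_sum ξ)
    (fun ω hω p => by
      have h1 := (hv.1.2 ω hω).apply p
      have h2 : Framelet.EqMod m
          (fun ξ => ∑ ℓ, star (Framelet.hat (φ ℓ) (Framelet.act (Framelet.realMat M)ᵀ ξ)) *
            Framelet.symbol (Framelet.entry a ℓ p) (ξ + (2 * Real.pi) • ω))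
          (fun ξ => ∑ ℓ, Framelet.symbol v (Framelet.act (Framelet.realMat M)ᵀ ξ) ℓ *
            Framelet.symbol (Framelet.entry a ℓ p) (ξ + (2 * Real.pi) • ω)) := by
        refine Framelet.EqMod.sum _ fun ℓ _ => ?_
        have hc : Continuous fun ξ =>
            Framelet.symbol (Framelet.entry a ℓ p) (ξ + (2 * Real.pi) • ω) :=
          (Framelet.continuous_of_mem_trig (Framelet.symbol_mem_trig _)).comp
            (continuous_add_const _)
        refine ((hstar ℓ).symm.comp_act _).mul (Framelet.EqMod.refl _) ?_
          (Framelet.isBigO_one_of_continuous hc)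
        refine IsBigO.of_bound (∫ x, ‖φ ℓ x‖) (Eventually.of_forall fun ξ => ?_)
        rw [norm_star, norm_one, mul_one]
        exact Framelet.norm_hat_le _ _
      have h3 : Framelet.EqMod m (fun ξ => Framelet.delta ω * Framelet.symbol v ξ p)
          (fun ξ => Framelet.delta ω * star (Framelet.hat (φ p) ξ)) :=
        (IsBigO.const_mul_left (hstar p) _).congr_left fun ξ => mul_sub _ _ _
      refine h2.trans (Framelet.EqMod.trans (h1.congr_left fun ξ => ?_) h3)
      simp only [Matrix.vecMul, dotProduct, Framelet.symbol_entry])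
  -- the wavelets are the combinations `Framelet.combine M b φ` of dilated shifts of `φ`
  have hhat : ∀ ξ, Framelet.vhat (Framelet.combine M b φ) ξ =
      Framelet.symbol b (Framelet.act ((Framelet.realMat M)ᵀ)⁻¹ ξ) *ᵥ
        Framelet.vhat φ (Framelet.act ((Framelet.realMat M)ᵀ)⁻¹ ξ) := fun ξ =>
    funext fun i => Framelet.hat_combine hM0 hφ hφc i ξ
  have hψc := Framelet.isCompactlySupported_combine (u := b) hM0 hφc
  have hψ := Framelet.memLp_combine (u := b) hM0 hφ
  -- `b̂ φ̂ = O(‖ξ‖^m)` carries over to `ψ̂` by the change of variables `ξ ↦ M^{-T} ξ`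
  have hψ0 : ∀ l, Framelet.EqMod m (Framelet.hat (Framelet.combine M b φ l)) (fun _ => 0) := by
    intro l
    refine ((hvan l).comp_act ((Framelet.realMat M)ᵀ)⁻¹).congr_left fun ξ => ?_
    rw [Framelet.hat_combine hM0 hφ hφc]
    simp only [Matrix.mulVec, dotProduct, Framelet.symbol_entry, Framelet.vhat]
  have hhat0 : ∀ f : Framelet.Rd d → ℂ, Framelet.hat f 0 = ∫ x, f x := fun f => by
    simp [Framelet.hat_eq]
  refine ⟨s, hs, b, ε, Framelet.PolyphaseIdentity.isQuasiTightFilterBank hab hε,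
    Framelet.combine M b φ, hψ, hψc, hhat,
    Framelet.isQuasiTightFramelet_combine hM hε hab hφ hφc haφ.1 ?_ fun l => ?_,
    fun l => Framelet.hasVanishingMoments_of_isBigO ((hψc l).integrable (hψ l)) (hψc l) (hψ0 l)⟩
  -- `∑ |∫ φ_p|² = 1` and `∫ ψ_l = 0` are the values at `ξ = 0` of the matching conditions
  · have h1 := hφn.apply_zero (by omega)
    simpa [Framelet.normSqHat, Framelet.vhat, hhat0] using h1
  · rw [← hhat0]
    exact (hψ0 l).apply_zero hm0
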